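/- A hyperbolic surface with convex boundary is a surface $X$, with a metric, each of whose points has a neighbourhood isometric to a neighbourhood of a point in a closed convex subset, with nonempty interior, of the hyperbolic plane $\mathbb H^2$; its boundary $\partial X$ consists of the points that have no neighbourhood isometric to an open disc of $\mathbb H^2$. A geodesic path is a unit speed geodesic $s:[a,b]\to X$, $a<b$; it is called simple if $s|_{(a,b)}$ is injective. Let $X$ be a compact connected hyperbolic surface with convex boundary that is not simply connected. (1) If $X$ is homeomorphic to $S^1\times[0,1]$, then every geodesic path in $X$ joining different components of $\partial X$ is simple. (2) Let $s:[a,b]\to X$ be a geodesic path joining different components of $\partial X$, and let $t:[c,d]\to X$, $c<d$, be a path that is either a simple geodesic path or an arbitrary continuous path injective on $[c,d]$. Suppose that $s$ and $t$ are homotopic through paths with endpoints in $\partial X$: there is a continuous $H:[0,1]\times[0,1]\to X$ with $H(\tau,0)=s(a+\tau(b-a))$, $H(\tau,1)=t(c+\tau(d-c))$ and $H(\{0,1\}\times[0,1])\subset\partial X$. Then $s$ is simple. (3) Let $p\in\partial X$, let $s:[a,b]\to X$ be a geodesic path with $s(a)=s(b)=p$, and let $t:[c,d]\to X$, $c<d$,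 be a continuous loop with $t(c)=t(d)=p$ that is simple, i.e. injective on $[c,d)$. If $s$ and $t$ are homotopic relative to $p$, that is, through loops based at $p$, then $s$ is a simple loop, i.e. injective on $[a,b)$. -/

import Mathlib

open Set

namespace ConvexHyperbolic

/-- Geodesic convexity of a set in the hyperbolic plane (the upper half-plane with its metric of
curvature `-1`): `C` contains the geodesic segment `{r | d(p,r) + d(r,q) = d(p,q)}` between any
two of its points. -/
def GeodesicallyConvex (C : Set UpperHalfPlane) : Prop :=
  ∀ p ∈ C, ∀ q ∈ C, ∀ r, dist p r + dist r q = dist p q → r ∈ C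

section

variable {X : Type*} [MetricSpace X]

/-- `φ` maps the open ball of radius `ε` about `x` isometrically onto the part of `C` in the open
hyperbolic disc of radius `ε` about `φ x`. -/
def IsIsometricChart (C : Set UpperHalfPlane) (x : X) (ε : ℝ) (φ : X → UpperHalfPlane) : Prop :=
  (∀ y ∈ Metric.ball x ε, ∀ z ∈ Metric.ball x ε, dist (φ y) (φ z) = dist y z) ∧
    φ '' Metric.ball x ε = C ∩ Metric.ball (φ x) ε

variable (X) in
/-- Hyperbolic surface with (locally) convex, possibly empty, boundary: near each of its points
the metric space `X` is isometric to a closed convex subset of the hyperbolic plane with nonempty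
interior. The boundary curves may have corners. -/
def IsConvexHyperbolicSurface : Prop :=
  ∀ x : X, ∃ C : Set UpperHalfPlane, IsClosed C ∧ GeodesicallyConvex C ∧ (interior C).Nonempty ∧
    ∃ ε > 0, ∃ φ : X → UpperHalfPlane, IsIsometricChart C x ε φ

variable (X) in
/-- The boundary `∂X`: the points without a neighbourhood isometric to an open disc of the
hyperbolic plane. -/
def surfaceBoundary : Set X :=
  {x | ¬ ∃ ε > 0, ∃ φ : X → UpperHalfPlane, IsIsometricChart univ x ε φ}

/-- `s` restricted to `[a, b]`, `a < b`, is a unit speed geodesic: locally distance preserving. -/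
def IsGeodesicPath (s : ℝ → X) (a b : ℝ) : Prop :=
  a < b ∧ ∀ τ ∈ Icc a b, ∃ δ > 0, ∀ u ∈ Icc a b, ∀ v ∈ Icc a b,
    |u - τ| < δ → |v - τ| < δ → dist (s u) (s v) = |u - v|

/-- A geodesic path on `[a, b]` is simple if it is injective on the open interval `(a, b)`. -/
def IsSimple (s : ℝ → X) (a b : ℝ) : Prop :=
  InjOn s (Ioo a b)

/-- A simple loop at `p` on `[a, b]`: starts and ends at `p`, and takes no value twice otherwise. -/
def IsSimpleLoop (s : ℝ → X) (a b : ℝ) (p : X) : Prop :=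
  s a = p ∧ s b = p ∧ InjOn s (Ico a b)

/-- The path `s` on `[a, b]` joins two different components of `∂X`. -/
def JoinsDifferentBoundaryComponents (s : ℝ → X) (a b : ℝ) : Prop :=
  s a ∈ surfaceBoundary X ∧ s b ∈ surfaceBoundary X ∧
    connectedComponentIn (surfaceBoundary X) (s a) ≠
      connectedComponentIn (surfaceBoundary X) (s b)

/-- The paths `s` on `[a, b]` and `t` on `[c, d]`, with endpoints in `∂X`, are homotopic through
paths with endpoints in `∂X`. -/
def PathsHomotopic (s : ℝ → X) (a b : ℝ) (t : ℝ → X) (c d : ℝ) : Prop :=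
  ∃ H : unitInterval × unitInterval → X, Continuous H ∧
    (∀ τ : unitInterval, H (τ, 0) = s (a + τ * (b - a))) ∧
    (∀ τ : unitInterval, H (τ, 1) = t (c + τ * (d - c))) ∧
    ∀ u : unitInterval, H (0, u) ∈ surfaceBoundary X ∧ H (1, u) ∈ surfaceBoundary X

/-- The loops `s` on `[a, b]` and `t` on `[c, d]` at `p` are homotopic through loops at `p`. -/
def LoopsHomotopicRel (p : X) (s : ℝ → X) (a b : ℝ) (t : ℝ → X) (c d : ℝ) : Prop :=
  ∃ H : unitInterval × unitInterval → X, Continuous H ∧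
    (∀ τ : unitInterval, H (τ, 0) = s (a + τ * (b - a))) ∧
    (∀ τ : unitInterval, H (τ, 1) = t (c + τ * (d - c))) ∧
    ∀ u : unitInterval, H (0, u) = p ∧ H (1, u) = p

end

end ConvexHyperbolic

/-!
Chains of charts develop `X` into the hyperbolic plane. A chain of least energy among those with
the same endpoints and holonomy develops to a geodesic segment, so the developing map is injective
on the universal cover and its image `K` is convex. A geodesic path of `X` lifts to a line in `K`,
and in the projective model `K` is a planar convex set in which lines are straight.

Let `s u = s v` with `u ≠ v`. The lifts of `s` and of the homotopy that agree over these parameters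
differ at every point of the square, yet the two lines intersect. During the homotopy the ends of
the lifted paths stay on `∂K`, where they keep their order, because the ends of one lift never meet
those of the other. So the lifts of `t` have interlaced ends, and their difference, which would have
to wind around `0`, vanishes somewhere: `t` is not simple. In the annulus, a path that is straight
in the covering strip can serve as `t`.
-/

namespace ConvexHyperbolic

open UpperHalfPlane Topology Filter ComplexConjugate

/-! ### The hyperboloid model -/

/-- The matrix of the quadratic form `v₀ v₂ - v₁²` on `ℝ³`. -/
noncomputable def lorentzMatrix : Matrix (Fin 3) (Fin 3) ℝ :=
  !![0, 0, 1 / 2; 0, -1, 0; 1 / 2, 0, 0]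

/-- The Lorentzian form on `ℝ³`, of signature `(1, 2)`. -/
noncomputable def lorentzForm : LinearMap.BilinForm ℝ (Fin 3 → ℝ) := Matrix.toBilin' lorentzMatrix

/-- The point of the hyperboloid `v₀ v₂ - v₁² = 1` representing a point of the upper half-plane. -/
noncomputable def toHyperboloid (z : ℍ) : Fin 3 → ℝ :=
  ![(z.re ^ 2 + z.im ^ 2) / z.im, z.re / z.im, 1 / z.im]

theorem lorentzForm_apply (v w : Fin 3 → ℝ) :
    lorentzForm v w = (v 0 * w 2 + v 2 * w 0) / 2 - v 1 * w 1 := by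
  simp only [lorentzForm, Matrix.toBilin'_apply, Fin.sum_univ_three, lorentzMatrix,
    Matrix.of_apply, Matrix.cons_val_zero, Matrix.cons_val_one, Matrix.cons_val]
  ring

theorem lorentzForm_comm (v w : Fin 3 → ℝ) : lorentzForm v w = lorentzForm w v := by
  simp only [lorentzForm_apply]; ring

theorem lorentzForm_combo_left (a b : ℝ) (u v w : Fin 3 → ℝ) :
    lorentzForm (a • u + b • v) w = a * lorentzForm u w + b * lorentzForm v w := by
  simp only [map_add, map_smul, LinearMap.add_apply, LinearMap.smul_apply, smul_eq_mul]

theorem lorentzForm_combo_right (a b : ℝ) (u v w : Fin 3 → ℝ) :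
    lorentzForm w (a • u + b • v) = a * lorentzForm w u + b * lorentzForm w v := by
  simp only [map_add, map_smul, smul_eq_mul]

theorem cosh_dist_eq_lorentzForm (z w : ℍ) :
    Real.cosh (dist z w) = lorentzForm (toHyperboloid z) (toHyperboloid w) := by
  have hz := z.im_ne_zero
  have hw := w.im_ne_zero
  rw [cosh_dist', lorentzForm_apply]
  simp only [toHyperboloid, Matrix.cons_val_zero, Matrix.cons_val_one, Matrix.cons_val]
  field_simp
  ring

theorem lorentzForm_toHyperboloid_self (z : ℍ) :
    lorentzForm (toHyperboloid z) (toHyperboloid z) = 1 := by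
  rw [← cosh_dist_eq_lorentzForm, dist_self, Real.cosh_zero]

theorem toHyperboloid_two_pos (z : ℍ) : 0 < toHyperboloid z 2 :=
  one_div_pos.2 z.im_pos

theorem dist_eq_abs_of_lorentzForm_eq_cosh {z w : ℍ} {t : ℝ}
    (h : lorentzForm (toHyperboloid z) (toHyperboloid w) = Real.cosh t) : dist z w = |t| := by
  rw [← cosh_dist_eq_lorentzForm] at h
  have := le_antisymm (Real.cosh_le_cosh.1 h.le) (Real.cosh_le_cosh.1 h.ge)
  rwa [abs_of_nonneg dist_nonneg] at this

theorem toHyperboloid_injective : Function.Injective toHyperboloid := by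
  intro z w h
  have : lorentzForm (toHyperboloid z) (toHyperboloid w) = Real.cosh 0 := by
    rw [h, lorentzForm_toHyperboloid_self, Real.cosh_zero]
  simpa using dist_eq_abs_of_lorentzForm_eq_cosh this

theorem exists_toHyperboloid_eq {v : Fin 3 → ℝ} (hv : lorentzForm v v = 1) (h2 : 0 < v 2) :
    ∃ z : ℍ, toHyperboloid z = v := by
  refine ⟨⟨⟨v 1 / v 2, 1 / v 2⟩, by simpa using h2⟩, ?_⟩
  have h2' := h2.ne'
  rw [lorentzForm_apply] at hv
  ext i
  fin_cases i <;> simp only [toHyperboloid, UpperHalfPlane.re, UpperHalfPlane.im] <;> simp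
  · field_simp
    nlinarith
  · field_simp

/-- The sheet of the hyperboloid containing `v` is detected by pairing with any point of `ℍ`. -/
theorem exists_toHyperboloid_eq_of_lorentzForm_pos {v : Fin 3 → ℝ} (hv : lorentzForm v v = 1)
    {z : ℍ} (hz : 0 < lorentzForm v (toHyperboloid z)) : ∃ z : ℍ, toHyperboloid z = v := by
  refine exists_toHyperboloid_eq hv (not_le.1 fun hle => ?_)
  have hne : v 2 ≠ 0 := by
    intro h
    rw [lorentzForm_apply, h] at hv
    nlinarith [sq_nonneg (v 1)]
  obtain ⟨w, hw⟩ := exists_toHyperboloid_eq (v := -v) (by simpa using hv)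
    (neg_pos.2 (hle.lt_of_ne hne))
  have h1 := Real.one_le_cosh (dist w z)
  rw [cosh_dist_eq_lorentzForm, hw, map_neg, LinearMap.neg_apply] at h1
  linarith

/-! ### Geodesic lines -/

theorem sinh_dist_pos {p q : ℍ} (hpq : p ≠ q) : 0 < Real.sinh (dist p q) :=
  Real.sinh_pos_iff.2 (dist_pos.2 hpq)

/-- The unit speed line with `p` at time `0` and `q` at time `dist p q`, in the hyperboloid model.
For `p = q` the coefficients are the junk value `x / 0 = 0`. -/
noncomputable def lineVec (p q : ℍ) (t : ℝ) : Fin 3 → ℝ :=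
  (Real.sinh (dist p q - t) / Real.sinh (dist p q)) • toHyperboloid p +
    (Real.sinh t / Real.sinh (dist p q)) • toHyperboloid q

theorem lorentzForm_lineVec_toHyperboloid {p q : ℍ} (hpq : p ≠ q) (t : ℝ) :
    lorentzForm (lineVec p q t) (toHyperboloid p) = Real.cosh t := by
  have hs := (sinh_dist_pos hpq).ne'
  rw [lineVec, lorentzForm_combo_left, lorentzForm_toHyperboloid_self,
    lorentzForm_comm (toHyperboloid q), ← cosh_dist_eq_lorentzForm, Real.sinh_sub]
  field_simp
  ring

theorem lorentzForm_lineVec_lineVec {p q : ℍ} (hpq : p ≠ q) (s t : ℝ) :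
    lorentzForm (lineVec p q s) (lineVec p q t) = Real.cosh (s - t) := by
  have hs := (sinh_dist_pos hpq).ne'
  have hd := Real.cosh_sq (dist p q)
  rw [lineVec, lineVec, lorentzForm_combo_left, lorentzForm_combo_right, lorentzForm_combo_right,
    lorentzForm_toHyperboloid_self, lorentzForm_toHyperboloid_self,
    lorentzForm_comm (toHyperboloid q), ← cosh_dist_eq_lorentzForm, Real.sinh_sub, Real.sinh_sub,
    Real.cosh_sub]
  field_simp
  linear_combination (-1 : ℝ) * Real.sinh s * Real.sinh t * hd

/-- The unit speed geodesic line with `line p q 0 = p` and `line p q (dist p q) = q`, for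
`p ≠ q`. -/
noncomputable def line (p q : ℍ) (t : ℝ) : ℍ := Function.invFun toHyperboloid (lineVec p q t)

theorem toHyperboloid_line {p q : ℍ} (hpq : p ≠ q) (t : ℝ) :
    toHyperboloid (line p q t) = lineVec p q t :=
  Function.invFun_eq <| exists_toHyperboloid_eq_of_lorentzForm_pos (z := p)
    (by rw [lorentzForm_lineVec_lineVec hpq, sub_self, Real.cosh_zero])
    (by rw [lorentzForm_lineVec_toHyperboloid hpq]; exact Real.cosh_pos t)

theorem isometry_line {p q : ℍ} (hpq : p ≠ q) : Isometry (line p q) :=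
  Isometry.of_dist_eq fun s t => by
    rw [Real.dist_eq]
    apply dist_eq_abs_of_lorentzForm_eq_cosh
    rw [toHyperboloid_line hpq, toHyperboloid_line hpq, lorentzForm_lineVec_lineVec hpq]

theorem line_zero {p q : ℍ} (hpq : p ≠ q) : line p q 0 = p :=
  toHyperboloid_injective <| by
    rw [toHyperboloid_line hpq]
    simp [lineVec, (sinh_dist_pos hpq).ne']

theorem line_dist {p q : ℍ} (hpq : p ≠ q) : line p q (dist p q) = q :=
  toHyperboloid_injective <| by
    rw [toHyperboloid_line hpq]
    simp [lineVec, (sinh_dist_pos hpq).ne']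

theorem exists_isometry_line {p q : ℍ} (hpq : p ≠ q) :
    ∃ γ : ℝ → ℍ, Isometry γ ∧ γ 0 = p ∧ γ (dist p q) = q :=
  ⟨line p q, isometry_line hpq, line_zero hpq, line_dist hpq⟩

theorem eq_line_of_dist {p q : ℍ} (hpq : p ≠ q) {r : ℍ} {u : ℝ}
    (hp : dist p r = |u|) (hq : dist q r = |u - dist p q|) : r = line p q u := by
  have hs := (sinh_dist_pos hpq).ne'
  have hu := Real.cosh_sq u
  have h1 := cosh_dist_eq_lorentzForm p r
  have h2 := cosh_dist_eq_lorentzForm q r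
  rw [hp, Real.cosh_abs] at h1
  rw [hq, Real.cosh_abs, Real.cosh_sub] at h2
  have : lorentzForm (toHyperboloid r) (toHyperboloid (line p q u)) = Real.cosh 0 := by
    rw [lorentzForm_comm, toHyperboloid_line hpq, lineVec, lorentzForm_combo_left, ← h1, ← h2,
      Real.sinh_sub, Real.cosh_zero]
    field_simp
    linear_combination hu * Real.sinh (dist p q)
  simpa using dist_eq_abs_of_lorentzForm_eq_cosh this

theorem dist_line_of_le {γ : ℝ → ℍ} (hγ : Isometry γ) {s t : ℝ} (hst : s ≤ t) :
    dist (γ s) (γ t) = t - s := by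
  rw [hγ.dist_eq, Real.dist_eq, abs_sub_comm, abs_of_nonneg (sub_nonneg.2 hst)]

/-- A point of a geodesic line is determined by its distances to two points of the line. -/
theorem eq_of_isometry_line {γ : ℝ → ℍ} (hγ : Isometry γ) {s t u : ℝ} (hst : s ≠ t) {r : ℍ}
    (hs : dist (γ s) r = |u - s|) (ht : dist (γ t) r = |u - t|) : r = γ u := by
  wlog hlt : s < t generalizing s t
  · exact this hst.symm ht hs (hst.symm.lt_of_le (not_lt.1 hlt))
  have key : ∀ r', dist (γ s) r' = |u - s| → dist (γ t) r' = |u - t| →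
      r' = line (γ s) (γ t) (u - s) := by
    intro r' h1 h2
    refine eq_line_of_dist (hγ.injective.ne hst) h1 ?_
    rw [dist_line_of_le hγ hlt.le, h2, sub_sub_sub_cancel_right]
  rw [key r hs ht, key (γ u)] <;> rw [hγ.dist_eq, Real.dist_eq, abs_sub_comm]

theorem eq_of_eqOn_nontrivial {γ δ : ℝ → ℍ} (hγ : Isometry γ) (hδ : Isometry δ) {S : Set ℝ}
    (hS : S.Nontrivial) (h : EqOn γ δ S) : γ = δ := by
  obtain ⟨x, hx, y, hy, hxy⟩ := hS
  funext t
  apply eq_of_isometry_line hδ hxy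
  · rw [← h hx, hγ.dist_eq, Real.dist_eq, abs_sub_comm]
  · rw [← h hy, hγ.dist_eq, Real.dist_eq, abs_sub_comm]

theorem exists_line_of_dist_eq {S : Set ℝ} (hS : S.Nontrivial) {σ : ℝ → ℍ}
    (hσ : ∀ u ∈ S, ∀ v ∈ S, dist (σ u) (σ v) = |u - v|) :
    ∃ γ : ℝ → ℍ, Isometry γ ∧ EqOn σ γ S := by
  obtain ⟨x, hx, y, hy, hxy⟩ := hS.exists_lt
  have hd : dist (σ x) (σ y) = y - x := by
    rw [hσ x hx y hy, abs_sub_comm, abs_of_pos (sub_pos.2 hxy)]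
  have hne : σ x ≠ σ y := dist_pos.1 (hd ▸ sub_pos.2 hxy)
  have hγ : Isometry fun t => line (σ x) (σ y) (t - x) :=
    (isometry_line hne).comp (Isometry.of_dist_eq fun s t => by simp)
  have hγx : line (σ x) (σ y) (x - x) = σ x := by rw [sub_self, line_zero hne]
  have hγy : line (σ x) (σ y) (y - x) = σ y := by rw [← hd, line_dist hne]
  refine ⟨_, hγ, fun u hu => eq_of_isometry_line hγ hxy.ne ?_ ?_⟩
  · rw [hγx, hσ x hx u hu, abs_sub_comm]
  · rw [hγy, hσ y hy u hu, abs_sub_comm]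

/-- Each point of `[a, b]` has a neighbourhood on which the path is part of a line; as lines
agreeing at two points are equal, this line is a locally constant function of the point. -/
theorem IsGeodesicPath.exists_line {σ : ℝ → ℍ} {a b : ℝ} (h : IsGeodesicPath σ a b) :
    ∃ γ : ℝ → ℍ, Isometry γ ∧ ∀ τ ∈ Icc a b, σ τ = γ τ := by
  obtain ⟨hab, hloc⟩ := h
  have hIcc : (Icc a b).Nontrivial :=
    ⟨a, left_mem_Icc.2 hab.le, b, right_mem_Icc.2 hab.le, hab.ne⟩
  have hnontriv : ∀ x ∈ Icc a b, ∀ U ∈ 𝓝 x, (U ∩ Icc a b).Nontrivial := by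
    intro x hx U hU
    obtain ⟨y, hy, hyx⟩ := accPt_iff_nhds.1
      (isPreconnected_Icc.preperfect_of_nontrivial hIcc x hx) U hU
    exact ⟨y, hy, x, ⟨mem_of_mem_nhds hU, hx⟩, hyx⟩
  have hline : ∀ x : Icc a b, ∃ U ∈ 𝓝 (x : ℝ), ∃ γ : ℝ → ℍ, Isometry γ ∧
      EqOn σ γ (U ∩ Icc a b) := by
    rintro ⟨x, hx⟩
    obtain ⟨δ, hδ, hσ⟩ := hloc x hx
    have hU : Metric.ball x δ ∈ 𝓝 x := Metric.ball_mem_nhds x hδ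
    exact ⟨_, hU, exists_line_of_dist_eq (hnontriv x hx _ hU) fun u hu v hv =>
      hσ u hu.2 v hv.2 hu.1 hv.1⟩
  choose U hU γ hγ hσγ using hline
  have hconst : IsLocallyConstant γ := by
    refine IsLocallyConstant.iff_eventually_eq _ |>.2 fun x => ?_
    filter_upwards [continuous_subtype_val.continuousAt.eventually
      (eventually_mem_nhds_iff.2 (hU x))] with y hy
    refine eq_of_eqOn_nontrivial (hγ y) (hγ x) (hnontriv y y.2 _ (inter_mem (hU y) hy)) ?_
    rintro u ⟨⟨huy, hux⟩, hu⟩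
    rw [← hσγ y ⟨huy, hu⟩, hσγ x ⟨hux, hu⟩]
  have : PreconnectedSpace (Icc a b) := Subtype.preconnectedSpace isPreconnected_Icc
  let x₀ : Icc a b := ⟨a, left_mem_Icc.2 hab.le⟩
  refine ⟨γ x₀, hγ x₀, fun τ hτ => ?_⟩
  rw [hσγ ⟨τ, hτ⟩ ⟨mem_of_mem_nhds (hU ⟨τ, hτ⟩), hτ⟩, hconst.apply_eq_of_isPreconnected
    isPreconnected_univ (mem_univ ⟨τ, hτ⟩) (mem_univ x₀)]

theorem exists_midpoint (p q : ℍ) : ∃ m, dist p m = dist p q / 2 ∧ dist m q = dist p q / 2 := by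
  rcases eq_or_ne p q with rfl | hpq
  · exact ⟨p, by simp⟩
  obtain ⟨γ, hγ, h0, h1⟩ := exists_isometry_line hpq
  have hd : 0 ≤ dist p q := dist_nonneg
  refine ⟨γ (dist p q / 2), ?_, ?_⟩
  · nth_rw 1 [← h0]
    rw [dist_line_of_le hγ (by linarith), sub_zero]
  · nth_rw 2 [← h1]
    rw [dist_line_of_le hγ (by linarith), sub_half]

theorem GeodesicallyConvex.exists_midpoint {C : Set ℍ} (hC : GeodesicallyConvex C) {p q : ℍ}
    (hp : p ∈ C) (hq : q ∈ C) :
    ∃ m ∈ C, dist p m = dist p q / 2 ∧ dist m q = dist p q / 2 := by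
  obtain ⟨m, h1, h2⟩ := ConvexHyperbolic.exists_midpoint p q
  exact ⟨m, hC p hp q hq m (by rw [h1, h2, add_halves]), h1, h2⟩

theorem exists_line_of_midpoint_chain {P : ℕ → ℍ} {N : ℕ} {ℓ : ℝ} (hℓ : 0 < ℓ) (hN : 0 < N)
    (h1 : ∀ i < N, dist (P i) (P (i + 1)) = ℓ)
    (h2 : ∀ i, i + 1 < N → dist (P i) (P (i + 2)) = 2 * ℓ) :
    ∃ γ : ℝ → ℍ, Isometry γ ∧ ∀ i ≤ N, P i = γ (i * ℓ) := by
  have h01 : dist (P 0) (P 1) = ℓ := h1 0 hN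
  have hne : P 0 ≠ P 1 := dist_pos.1 (h01 ▸ hℓ)
  obtain ⟨γ, hγ, hγ0, hγ1⟩ := exists_isometry_line hne
  rw [h01] at hγ1
  have key : ∀ i, i + 1 ≤ N → P i = γ (i * ℓ) ∧ P (i + 1) = γ ((i + 1 : ℕ) * ℓ) := by
    intro i
    induction i with
    | zero => intro _; simp [hγ0, hγ1]
    | succ i ih =>
      intro hi
      obtain ⟨hPi, hPi'⟩ := ih (by omega)
      refine ⟨hPi', eq_of_isometry_line hγ (s := i * ℓ) (t := (i + 1 : ℕ) * ℓ) ?_ ?_ ?_⟩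
      · push_cast
        linarith
      · rw [← hPi, h2 i hi]
        push_cast
        rw [abs_of_nonneg] <;> linarith
      · rw [← hPi', h1 (i + 1) hi]
        push_cast
        rw [abs_of_nonneg] <;> linarith
  refine ⟨γ, hγ, fun i hi => ?_⟩
  cases i with
  | zero => simp [hγ0]
  | succ i => exact (key i hi).2

/-! ### The projective model -/

/-- The chart `x + i y ↦ x + i (x² + y²)` of the hyperbolic plane, in which geodesics are straight
segments: the projective model, with the parabola `im = re²` in place of the circle at infinity. -/
noncomputable def klein (z : ℍ) : ℂ := ⟨z.re, z.re ^ 2 + z.im ^ 2⟩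

theorem klein_eq_toHyperboloid (z : ℍ) :
    klein z = ⟨toHyperboloid z 1 / toHyperboloid z 2, toHyperboloid z 0 / toHyperboloid z 2⟩ := by
  have := z.im_ne_zero
  simp only [klein, toHyperboloid, Matrix.cons_val_zero, Matrix.cons_val_one, Matrix.cons_val]
  congr 1 <;> field_simp

theorem continuous_klein : Continuous klein := by
  have : klein = fun z : ℍ => (z.re : ℂ) + ((z.re ^ 2 + z.im ^ 2 : ℝ) : ℂ) * Complex.I := by
    ext z
    apply Complex.ext <;> simp [klein, -Complex.ofReal_add, -Complex.ofReal_pow]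
  rw [this]
  exact (Complex.continuous_ofReal.comp continuous_re).add
    ((Complex.continuous_ofReal.comp ((continuous_re.pow 2).add (continuous_im.pow 2))).mul
      continuous_const)

theorem range_klein : range klein = {c : ℂ | c.re ^ 2 < c.im} := by
  ext c
  constructor
  · rintro ⟨z, rfl⟩
    exact lt_add_of_pos_right _ (pow_pos z.im_pos 2)
  · intro hc
    refine ⟨⟨⟨c.re, √(c.im - c.re ^ 2)⟩, Real.sqrt_pos.2 (sub_pos.2 hc)⟩, ?_⟩
    apply Complex.ext
    · rfl
    · change c.re ^ 2 + √(c.im - c.re ^ 2) ^ 2 = c.im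
      rw [Real.sq_sqrt (sub_pos.2 hc).le, add_sub_cancel]

theorem convex_range_klein : Convex ℝ (range klein) := by
  have hf : ConvexOn ℝ univ fun c : ℂ => c.re ^ 2 - c.im :=
    ((even_two.convexOn_pow (𝕜 := ℝ)).comp_linearMap Complex.reLm).sub
      (Complex.imLm.concaveOn convex_univ)
  simpa only [range_klein, mem_univ, true_and, sub_neg] using hf.convex_lt 0

theorem isOpenEmbedding_klein : IsOpenEmbedding klein := by
  refine ⟨?_, range_klein ▸ isOpen_lt (by fun_prop) (by fun_prop)⟩
  let g : range klein → ℍ := fun c =>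
    ⟨⟨c.1.re, √(c.1.im - c.1.re ^ 2)⟩, Real.sqrt_pos.2 (sub_pos.2 (range_klein ▸ c.2 :
      c.1 ∈ {c : ℂ | c.re ^ 2 < c.im}))⟩
  have hg : Continuous g := by
    rw [UpperHalfPlane.isOpenEmbedding_coe.isEmbedding.continuous_iff]
    have : UpperHalfPlane.coe ∘ g = fun c : range klein =>
        (c.1.re : ℂ) + (√(c.1.im - c.1.re ^ 2) : ℝ) * Complex.I := by
      ext c
      apply Complex.ext <;> simp [g]
    rw [this]
    fun_prop
  have hleft : Function.LeftInverse g (rangeFactorization klein) := by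
    intro z
    refine UpperHalfPlane.ext_re_im rfl ?_
    change √(z.re ^ 2 + z.im ^ 2 - z.re ^ 2) = z.im
    rw [add_sub_cancel_left, Real.sqrt_sq z.im_pos.le]
  exact IsEmbedding.subtypeVal.comp
    (IsEmbedding.of_leftInverse hleft hg (continuous_klein.subtype_mk _))

theorem klein_injective : Function.Injective klein := isOpenEmbedding_klein.injective

theorem klein_mem_segment_iff {p q r : ℍ} : klein r ∈ segment ℝ (klein p) (klein q) ↔
    ∃ α β : ℝ, 0 ≤ α ∧ 0 ≤ β ∧
      toHyperboloid r = α • toHyperboloid p + β • toHyperboloid q := by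
  have hp := toHyperboloid_two_pos p
  have hq := toHyperboloid_two_pos q
  have hr := toHyperboloid_two_pos r
  constructor
  · rintro ⟨a, b, ha, hb, hab, h⟩
    refine ⟨toHyperboloid r 2 * a / toHyperboloid p 2, toHyperboloid r 2 * b / toHyperboloid q 2,
      by positivity, by positivity, ?_⟩
    have hre := congrArg Complex.re h
    have him := congrArg Complex.im h
    simp only [Complex.add_re, Complex.add_im, Complex.real_smul, Complex.re_ofReal_mul,
      Complex.im_ofReal_mul, klein_eq_toHyperboloid] at hre him
    ext i
    fin_cases i <;> simp
    · field_simp at him ⊢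
      linarith
    · field_simp at hre ⊢
      linarith
    · field_simp
      linarith
  · rintro ⟨α, β, hα, hβ, h⟩
    have h0 := congrFun h 0
    have h1 := congrFun h 1
    have h2 := congrFun h 2
    simp only [Pi.add_apply, Pi.smul_apply, smul_eq_mul] at h0 h1 h2
    refine ⟨α * toHyperboloid p 2 / toHyperboloid r 2, β * toHyperboloid q 2 / toHyperboloid r 2,
      by positivity, by positivity, ?_, ?_⟩
    · rw [← add_div, ← h2, div_self hr.ne']
    · apply Complex.ext
      · simp only [Complex.add_re, Complex.real_smul, Complex.re_ofReal_mul,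
          klein_eq_toHyperboloid]
        rw [h1]
        field_simp
      · simp only [Complex.add_im, Complex.real_smul, Complex.im_ofReal_mul,
          klein_eq_toHyperboloid]
        rw [h0]
        field_simp

theorem dist_add_dist_of_toHyperboloid_eq {p q r : ℍ} {α β : ℝ} (hα : 0 ≤ α) (hβ : 0 ≤ β)
    (h : toHyperboloid r = α • toHyperboloid p + β • toHyperboloid q) :
    dist p r + dist r q = dist p q := by
  have hpr := cosh_dist_eq_lorentzForm p r
  have hrq := cosh_dist_eq_lorentzForm r q
  have hrr := lorentzForm_toHyperboloid_self r
  rw [h, lorentzForm_combo_left, lorentzForm_combo_right, lorentzForm_combo_right,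
    lorentzForm_toHyperboloid_self, lorentzForm_toHyperboloid_self,
    lorentzForm_comm (toHyperboloid q), ← cosh_dist_eq_lorentzForm] at hrr
  rw [h, lorentzForm_combo_right, lorentzForm_toHyperboloid_self,
    ← cosh_dist_eq_lorentzForm] at hpr
  rw [h, lorentzForm_combo_left, lorentzForm_toHyperboloid_self,
    ← cosh_dist_eq_lorentzForm] at hrq
  have hs := Real.cosh_sq (dist p q)
  have hs0 : 0 ≤ Real.sinh (dist p q) := Real.sinh_nonneg_iff.2 dist_nonneg
  have hsinh_pr : Real.sinh (dist p r) = β * Real.sinh (dist p q) := by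
    have hs1 := Real.cosh_sq (dist p r)
    rw [hpr] at hs1
    refine (sq_eq_sq₀ (Real.sinh_nonneg_iff.2 dist_nonneg) (mul_nonneg hβ hs0)).1 ?_
    linear_combination hrr - hs1 + β ^ 2 * hs
  have hsinh_rq : Real.sinh (dist r q) = α * Real.sinh (dist p q) := by
    have hs1 := Real.cosh_sq (dist r q)
    rw [hrq] at hs1
    refine (sq_eq_sq₀ (Real.sinh_nonneg_iff.2 dist_nonneg) (mul_nonneg hα hs0)).1 ?_
    linear_combination hrr - hs1 + α ^ 2 * hs
  have hcosh : Real.cosh (dist p r + dist r q) = Real.cosh (dist p q) := by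
    rw [Real.cosh_add, hpr, hrq, hsinh_pr, hsinh_rq]
    linear_combination Real.cosh (dist p q) * hrr - α * β * hs
  have := le_antisymm (Real.cosh_le_cosh.1 hcosh.le) (Real.cosh_le_cosh.1 hcosh.ge)
  rwa [abs_of_nonneg (add_nonneg dist_nonneg dist_nonneg), abs_of_nonneg dist_nonneg] at this

theorem dist_add_dist_eq_iff {p q r : ℍ} :
    dist p r + dist r q = dist p q ↔ klein r ∈ segment ℝ (klein p) (klein q) := by
  refine ⟨fun h => ?_, fun h => ?_⟩
  · rcases eq_or_ne p q with rfl | hpq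
    · have : dist p r = 0 := by linarith [dist_self p, dist_comm r p]
      rw [dist_eq_zero.1 this]
      exact left_mem_segment ℝ _ _
    have h0 : 0 ≤ dist p r := dist_nonneg
    have h1 : 0 ≤ dist r q := dist_nonneg
    have hr : r = line p q (dist p r) := by
      refine eq_line_of_dist hpq (abs_of_nonneg h0).symm ?_
      rw [← h, dist_comm q r, abs_sub_comm, add_sub_cancel_left, abs_of_nonneg h1]
    refine klein_mem_segment_iff.2 ⟨_, _, ?_, ?_,
      (congrArg toHyperboloid hr).trans (toHyperboloid_line hpq _)⟩
    · exact div_nonneg (Real.sinh_nonneg_iff.2 (by linarith)) (sinh_dist_pos hpq).le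
    · exact div_nonneg (Real.sinh_nonneg_iff.2 h0) (sinh_dist_pos hpq).le
  · obtain ⟨α, β, hα, hβ, h⟩ := klein_mem_segment_iff.1 h
    exact dist_add_dist_of_toHyperboloid_eq hα hβ h

theorem GeodesicallyConvex.convex_klein_image {C : Set ℍ} (hC : GeodesicallyConvex C) :
    Convex ℝ (klein '' C) := by
  rw [convex_iff_segment_subset]
  rintro _ ⟨p, hp, rfl⟩ _ ⟨q, hq, rfl⟩ c hc
  obtain ⟨r, rfl⟩ := convex_range_klein.segment_subset (mem_range_self p) (mem_range_self q) hc
  exact ⟨r, hC p hp q hq r (dist_add_dist_eq_iff.2 hc), rfl⟩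

theorem GeodesicallyConvex.image_isometryEquiv {C : Set ℍ} (hC : GeodesicallyConvex C)
    (g : ℍ ≃ᵢ ℍ) : GeodesicallyConvex (g '' C) := by
  rintro _ ⟨p, hp, rfl⟩ _ ⟨q, hq, rfl⟩ r hr
  refine ⟨g.symm r, hC p hp q hq _ ?_, g.apply_symm_apply r⟩
  rwa [← g.dist_eq, ← g.dist_eq (g.symm r), ← g.dist_eq p q, g.apply_symm_apply]

theorem klein_mem_interior_iff {C : Set ℍ} {z : ℍ} :
    klein z ∈ interior (klein '' C) ↔ z ∈ interior C := by
  rw [← mem_preimage, isOpenEmbedding_klein.isOpenMap.preimage_interior_eq_interior_preimage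
    continuous_klein, klein_injective.preimage_image]

theorem GeodesicallyConvex.interior_inter_ball_nonempty {C : Set ℍ} (hC : GeodesicallyConvex C)
    (hint : (interior C).Nonempty) {p : ℍ} (hp : p ∈ C) {r : ℝ} (hr : 0 < r) :
    (interior (C ∩ Metric.ball p r)).Nonempty := by
  obtain ⟨c, hc⟩ := hint
  have hcl : klein p ∈ closure (interior (klein '' C)) := by
    rw [hC.convex_klein_image.closure_interior_eq_closure_of_nonempty_interior
      ⟨klein c, klein_mem_interior_iff.2 hc⟩]
    exact subset_closure (mem_image_of_mem _ hp)
  have hopen : IsOpen (klein '' Metric.ball p r) :=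
    isOpenEmbedding_klein.isOpenMap _ Metric.isOpen_ball
  obtain ⟨w, ⟨z, hz, rfl⟩, hw⟩ := mem_closure_iff.1 hcl _ hopen
    (mem_image_of_mem _ (Metric.mem_ball_self hr))
  refine ⟨z, ?_⟩
  rw [interior_inter, Metric.isOpen_ball.interior_eq]
  exact ⟨klein_mem_interior_iff.1 hw, hz⟩

/-! ### Isometries of the hyperbolic plane -/

/-- The `3 × 3` matrix whose rows are the hyperboloid vectors of three points; its determinant
vanishes exactly when they lie on a line. -/
noncomputable def hyperboloidMatrix (p : Fin 3 → ℍ) : Matrix (Fin 3) (Fin 3) ℝ :=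
  Matrix.of fun i => toHyperboloid (p i)

theorem exists_det_hyperboloidMatrix_ne_zero {S : Set ℍ} (hS : (interior S).Nonempty) :
    ∃ p : Fin 3 → ℍ, (∀ i, p i ∈ S) ∧ (hyperboloidMatrix p).det ≠ 0 := by
  obtain ⟨z, hz⟩ := hS
  have hopen : IsOpen (UpperHalfPlane.coe '' interior S) :=
    UpperHalfPlane.isOpenEmbedding_coe.isOpenMap _ isOpen_interior
  obtain ⟨ε, hε, hball⟩ := Metric.isOpen_iff.1 hopen z (mem_image_of_mem _ hz)
  have translate : ∀ w : ℂ, ‖w‖ < ε → ∃ q ∈ S, (q : ℂ) = z + w := by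
    intro w hw
    obtain ⟨q, hq, hqw⟩ := hball (show (z : ℂ) + w ∈ _ by simpa using hw)
    exact ⟨q, interior_subset hq, hqw⟩
  have hε2 : ‖((ε / 2 : ℝ) : ℂ)‖ < ε := by
    rw [Complex.norm_real, Real.norm_eq_abs, abs_of_pos] <;> linarith
  obtain ⟨q, hq, hqz⟩ := translate ((ε / 2 : ℝ) : ℂ) hε2
  obtain ⟨r, hr, hrz⟩ := translate ((ε / 2 : ℝ) * Complex.I)
    (by rwa [norm_mul, Complex.norm_I, mul_one])
  have hq_re : q.re = z.re + ε / 2 := by simpa using congrArg Complex.re hqz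
  have hq_im : q.im = z.im := by simpa using congrArg Complex.im hqz
  have hr_re : r.re = z.re := by simpa using congrArg Complex.re hrz
  have hr_im : r.im = z.im + ε / 2 := by simpa using congrArg Complex.im hrz
  refine ⟨![z, q, r], ?_, ?_⟩
  · intro i
    fin_cases i
    exacts [interior_subset hz, hq, hr]
  · have hdet : (hyperboloidMatrix ![z, q, r]).det =
        -(ε / 2 * (2 * z.im * (ε / 2) + (ε / 2) ^ 2) / (z.im * z.im * (z.im + ε / 2))) := by
      have : z.im + ε / 2 ≠ 0 := by positivity
      rw [Matrix.det_fin_three]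
      simp only [hyperboloidMatrix, Matrix.of_apply, toHyperboloid, Matrix.cons_val_zero,
        Matrix.cons_val_one, Matrix.cons_val, hq_re, hq_im, hr_re, hr_im]
      field_simp
      ring
    rw [hdet, neg_ne_zero]
    positivity

theorem det_lorentzMatrix_ne_zero : lorentzMatrix.det ≠ 0 := by
  simp [lorentzMatrix, Matrix.det_fin_three]

theorem lorentzForm_eq_dotProduct (v w : Fin 3 → ℝ) :
    lorentzForm v w = v ⬝ᵥ (lorentzMatrix.mulVec w) :=
  Matrix.toBilin'_apply' _ _ _

theorem eq_of_dist_eq_of_det_ne_zero {p : Fin 3 → ℍ} (hp : (hyperboloidMatrix p).det ≠ 0)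
    {z w : ℍ} (h : ∀ i, dist (p i) z = dist (p i) w) : z = w := by
  refine toHyperboloid_injective <| sub_eq_zero.1 <|
    Matrix.eq_zero_of_mulVec_eq_zero (M := hyperboloidMatrix p * lorentzMatrix) ?_ ?_
  · rw [Matrix.det_mul]
    exact mul_ne_zero hp det_lorentzMatrix_ne_zero
  · funext i
    have hi : lorentzForm (toHyperboloid (p i)) (toHyperboloid z - toHyperboloid w) = 0 := by
      rw [map_sub, ← cosh_dist_eq_lorentzForm, ← cosh_dist_eq_lorentzForm, h, sub_self]
    rw [lorentzForm_eq_dotProduct] at hi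
    rwa [← Matrix.mulVec_mulVec]

theorem isometryEquiv_ext_of_interior {S : Set ℍ} (hS : (interior S).Nonempty) {g h : ℍ ≃ᵢ ℍ}
    (hgh : ∀ z ∈ S, g z = h z) : g = h := by
  obtain ⟨p, hpS, hp⟩ := exists_det_hyperboloidMatrix_ne_zero hS
  ext1 z
  refine (h.symm_apply_eq.1 (eq_of_dist_eq_of_det_ne_zero hp fun i => ?_))
  rw [← h.dist_eq, h.apply_symm_apply, ← hgh _ (hpS i), g.dist_eq]

theorem lorentzForm_vecMul {T : Matrix (Fin 3) (Fin 3) ℝ}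
    (hT : T * lorentzMatrix * T.transpose = lorentzMatrix) (v w : Fin 3 → ℝ) :
    lorentzForm (Matrix.vecMul v T) (Matrix.vecMul w T) = lorentzForm v w := by
  rw [lorentzForm_eq_dotProduct, lorentzForm_eq_dotProduct, ← Matrix.mulVec_transpose T w,
    ← Matrix.dotProduct_mulVec, Matrix.mulVec_mulVec, Matrix.mulVec_mulVec, hT]

theorem exists_isometry_of_vecMul {T : Matrix (Fin 3) (Fin 3) ℝ}
    (hT : T * lorentzMatrix * T.transpose = lorentzMatrix) {p q : ℍ}
    (hpq : Matrix.vecMul (toHyperboloid p) T = toHyperboloid q) :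
    ∃ g : ℍ → ℍ, Isometry g ∧ ∀ z, toHyperboloid (g z) = Matrix.vecMul (toHyperboloid z) T := by
  have : ∀ z, ∃ w : ℍ, toHyperboloid w = Matrix.vecMul (toHyperboloid z) T := fun z => by
    refine exists_toHyperboloid_eq_of_lorentzForm_pos (z := q) ?_ ?_
    · rw [lorentzForm_vecMul hT, lorentzForm_toHyperboloid_self]
    · rw [← hpq, lorentzForm_vecMul hT, ← cosh_dist_eq_lorentzForm]
      exact Real.cosh_pos _
  choose g hg using this
  refine ⟨g, Isometry.of_dist_eq fun z w => ?_, hg⟩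
  rw [dist_eq_abs_of_lorentzForm_eq_cosh (t := dist z w), abs_of_nonneg dist_nonneg]
  rw [hg, hg, lorentzForm_vecMul hT, cosh_dist_eq_lorentzForm]

theorem hyperboloidMatrix_gram_apply (p : Fin 3 → ℍ) (i j : Fin 3) :
    (hyperboloidMatrix p * lorentzMatrix * (hyperboloidMatrix p).transpose) i j =
      Real.cosh (dist (p i) (p j)) := by
  rw [Matrix.mul_assoc, Matrix.mul_apply, cosh_dist_eq_lorentzForm, lorentzForm_eq_dotProduct]
  rfl

theorem inv_mul_congruence {n R : Type*} [Fintype n] [DecidableEq n] [CommRing R]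
    {A B J : Matrix n n R} (hA : IsUnit A.det)
    (h : A * J * A.transpose = B * J * B.transpose) :
    A⁻¹ * B * J * (A⁻¹ * B).transpose = J := by
  have hAt : IsUnit A.transpose.det := by rwa [Matrix.det_transpose]
  calc A⁻¹ * B * J * (A⁻¹ * B).transpose
      = A⁻¹ * (B * J * B.transpose) * A.transpose⁻¹ := by
        rw [Matrix.transpose_mul, Matrix.transpose_nonsing_inv]
        simp only [Matrix.mul_assoc]
    _ = J := by
        rw [← h, Matrix.mul_assoc A, Matrix.nonsing_inv_mul_cancel_left _ _ hA,
          Matrix.mul_nonsing_inv_cancel_right _ _ hAt]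

theorem exists_isometry_of_dist_eq {p q : Fin 3 → ℍ} (hp : (hyperboloidMatrix p).det ≠ 0)
    (hpq : ∀ i j, dist (p i) (p j) = dist (q i) (q j)) :
    ∃ g : ℍ → ℍ, Isometry g ∧ ∀ i, g (p i) = q i := by
  have hunit : IsUnit (hyperboloidMatrix p).det := isUnit_iff_ne_zero.2 hp
  have hT := inv_mul_congruence (B := hyperboloidMatrix q) (J := lorentzMatrix) hunit <| by
    ext i j
    rw [hyperboloidMatrix_gram_apply, hyperboloidMatrix_gram_apply, hpq]
  have hrow : ∀ i, Matrix.vecMul (toHyperboloid (p i))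
      ((hyperboloidMatrix p)⁻¹ * hyperboloidMatrix q) = toHyperboloid (q i) := fun i =>
    congrFun (Matrix.mul_nonsing_inv_cancel_left _ (hyperboloidMatrix q) hunit) i
  obtain ⟨g, hg, hgv⟩ := exists_isometry_of_vecMul hT (hrow 0)
  exact ⟨g, hg, fun i => toHyperboloid_injective ((hgv _).trans (hrow i))⟩

theorem det_hyperboloidMatrix_ne_zero_of_dist_eq {p q : Fin 3 → ℍ}
    (hp : (hyperboloidMatrix p).det ≠ 0) (hpq : ∀ i j, dist (p i) (p j) = dist (q i) (q j)) :
    (hyperboloidMatrix q).det ≠ 0 := by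
  have gram : hyperboloidMatrix p * lorentzMatrix * (hyperboloidMatrix p).transpose =
      hyperboloidMatrix q * lorentzMatrix * (hyperboloidMatrix q).transpose := by
    ext i j
    rw [hyperboloidMatrix_gram_apply, hyperboloidMatrix_gram_apply, hpq]
  intro hq
  have hdet := congrArg Matrix.det gram
  simp only [Matrix.det_mul, Matrix.det_transpose, hq, mul_zero, mul_eq_zero, hp,
    det_lorentzMatrix_ne_zero, or_self] at hdet

/-- Three points in general position determine an isometry of the plane with the required values
on them, and then on all of `S`, since a point is determined by its distances to the three. -/
theorem exists_isometryEquiv_extension {S : Set ℍ} (hS : (interior S).Nonempty) {f : ℍ → ℍ}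
    (hf : ∀ z ∈ S, ∀ w ∈ S, dist (f z) (f w) = dist z w) :
    ∃ g : ℍ ≃ᵢ ℍ, ∀ z ∈ S, g z = f z := by
  obtain ⟨p, hpS, hp⟩ := exists_det_hyperboloidMatrix_ne_zero hS
  have hpf : ∀ i j, dist (p i) (p j) = dist (f (p i)) (f (p j)) := fun i j =>
    (hf _ (hpS i) _ (hpS j)).symm
  have hfp := det_hyperboloidMatrix_ne_zero_of_dist_eq hp hpf
  obtain ⟨g, hg, hgp⟩ := exists_isometry_of_dist_eq hp hpf
  obtain ⟨g', hg', hgp'⟩ := exists_isometry_of_dist_eq hfp fun i j => (hpf i j).symm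
  have left : Function.LeftInverse g' g := fun z =>
    eq_of_dist_eq_of_det_ne_zero hp fun i => by
      rw [← hg.dist_eq (p i) z, hgp, ← hg'.dist_eq (f (p i)), hgp']
  have right : Function.RightInverse g' g := fun z =>
    eq_of_dist_eq_of_det_ne_zero hfp fun i => by
      rw [← hg'.dist_eq (f (p i)) z, hgp', ← hg.dist_eq (p i), hgp]
  refine ⟨⟨⟨g, g', left, right⟩, hg⟩, fun z hz => eq_of_dist_eq_of_det_ne_zero hfp fun i => ?_⟩
  rw [hf _ (hpS i) _ hz, ← hgp i]
  exact hg.dist_eq _ _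

/-! ### Atlases of uniform radius -/

theorem exists_isometryEquiv_comp_eqOn {X : Type*} [PseudoMetricSpace X] {S : Set X} {φ ψ : X → ℍ}
    (hφ : ∀ a ∈ S, ∀ b ∈ S, dist (φ a) (φ b) = dist a b)
    (hψ : ∀ a ∈ S, ∀ b ∈ S, dist (ψ a) (ψ b) = dist a b) (hne : (interior (ψ '' S)).Nonempty) :
    ∃ g : ℍ ≃ᵢ ℍ, ∀ a ∈ S, g (ψ a) = φ a := by
  have : Nonempty X := (hne.mono interior_subset).of_image.nonempty
  have hinv : ∀ {z}, z ∈ ψ '' S → Function.invFunOn ψ S z ∈ S ∧ ψ (Function.invFunOn ψ S z) = z :=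
    fun hz => ⟨Function.invFunOn_mem hz, Function.invFunOn_eq hz⟩
  obtain ⟨g, hg⟩ := exists_isometryEquiv_extension hne (f := fun z => φ (Function.invFunOn ψ S z))
    fun z hz w hw => by
      rw [hφ _ (hinv hz).1 _ (hinv hw).1, ← hψ _ (hinv hz).1 _ (hinv hw).1, (hinv hz).2,
        (hinv hw).2]
  refine ⟨g, fun a ha => ?_⟩
  have hb := hinv (mem_image_of_mem ψ ha)
  rw [hg _ (mem_image_of_mem ψ ha), ← dist_eq_zero, hφ _ hb.1 _ ha, ← hψ _ hb.1 _ ha, hb.2,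
    dist_self]

section

variable {X : Type*} [MetricSpace X]

theorem IsIsometricChart.restrict {C : Set ℍ} {x y : X} {ε δ : ℝ} {φ : X → ℍ}
    (h : IsIsometricChart C x ε φ) (hδ : 0 < δ) (hyx : dist y x + δ ≤ ε) :
    IsIsometricChart C y δ φ := by
  obtain ⟨h1, h2⟩ := h
  have hsub : Metric.ball y δ ⊆ Metric.ball x ε := Metric.ball_subset_ball' (by linarith)
  have hy : y ∈ Metric.ball x ε := hsub (Metric.mem_ball_self hδ)
  have hx : x ∈ Metric.ball x ε := Metric.mem_ball_self
    (lt_of_lt_of_le (add_pos_of_nonneg_of_pos dist_nonneg hδ) hyx)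
  refine ⟨fun a ha b hb => h1 a (hsub ha) b (hsub hb), ?_⟩
  ext c
  constructor
  · rintro ⟨a, ha, rfl⟩
    refine ⟨(h2 ▸ mem_image_of_mem φ (hsub ha) : φ a ∈ C ∩ _).1, ?_⟩
    rw [Metric.mem_ball, h1 a (hsub ha) y hy]
    exact ha
  · rintro ⟨hc, hcb⟩
    have : c ∈ C ∩ Metric.ball (φ x) ε := by
      refine ⟨hc, ?_⟩
      rw [Metric.mem_ball] at hcb ⊢
      have := h1 y hy x hx
      linarith [dist_triangle c (φ y) (φ x)]
    rw [← h2] at this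
    obtain ⟨a, ha, rfl⟩ := this
    refine ⟨a, ?_, rfl⟩
    rwa [Metric.mem_ball, h1 a ha y hy] at hcb

variable (X) in
/-- A choice of charts of one and the same radius about all points of a surface. -/
structure UniformAtlas where
  /-- A small fraction of the common radius `8 ρ`, leaving room for several steps of length `ρ`. -/
  ρ : ℝ
  ρ_pos : 0 < ρ
  C : X → Set ℍ
  convex : ∀ x, GeodesicallyConvex (C x)
  interior_nonempty : ∀ x, (interior (C x)).Nonempty
  ψ : X → X → ℍ
  chart : ∀ x, IsIsometricChart (C x) x (8 * ρ) (ψ x)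

theorem IsConvexHyperbolicSurface.nonempty_uniformAtlas [CompactSpace X]
    (hX : IsConvexHyperbolicSurface X) : Nonempty (UniformAtlas X) := by
  suffices ∃ ε > 0, ∀ x ∈ (univ : Set X), ∃ C : Set ℍ, GeodesicallyConvex C ∧
      (interior C).Nonempty ∧ ∃ φ : X → ℍ, IsIsometricChart C x ε φ by
    obtain ⟨ε, hε, h⟩ := this
    choose C hC hint ψ hψ using fun x => h x (mem_univ x)
    exact ⟨⟨ε / 8, by positivity, C, hC, hint, ψ, fun x => by convert hψ x using 1; ring⟩⟩
  refine isCompact_univ.induction_on (p := fun s => ∃ ε > 0, ∀ x ∈ s, ∃ C : Set ℍ,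
    GeodesicallyConvex C ∧ (interior C).Nonempty ∧ ∃ φ : X → ℍ, IsIsometricChart C x ε φ)
    ?_ ?_ ?_ ?_
  · exact ⟨1, one_pos, by simp⟩
  · rintro s t hst ⟨ε, hε, h⟩
    exact ⟨ε, hε, fun x hx => h x (hst hx)⟩
  · rintro s t ⟨ε, hε, h⟩ ⟨δ, hδ, h'⟩
    refine ⟨min ε δ, lt_min hε hδ, fun x hx => ?_⟩
    rcases hx with hx | hx
    · obtain ⟨C, h1, h2, φ, h3⟩ := h x hx
      exact ⟨C, h1, h2, φ, h3.restrict (lt_min hε hδ) (by simp)⟩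
    · obtain ⟨C, h1, h2, φ, h3⟩ := h' x hx
      exact ⟨C, h1, h2, φ, h3.restrict (lt_min hε hδ) (by simp)⟩
  · intro x _
    obtain ⟨C, -, h1, h2, ε, hε, φ, h3⟩ := hX x
    refine ⟨Metric.ball x (ε / 2),
      mem_nhdsWithin_of_mem_nhds (Metric.ball_mem_nhds x (by positivity)), ε / 2, by positivity,
      fun y hy => ⟨C, h1, h2, φ, h3.restrict (by positivity) ?_⟩⟩
    rw [Metric.mem_ball] at hy
    linarith

namespace UniformAtlas

variable (A : UniformAtlas X)

theorem dist_ψ {x y z : X} (hy : dist y x < 8 * A.ρ) (hz : dist z x < 8 * A.ρ) :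
    dist (A.ψ x y) (A.ψ x z) = dist y z :=
  (A.chart x).1 y hy z hz

theorem ψ_mem {x y : X} (hy : dist y x < 8 * A.ρ) : A.ψ x y ∈ A.C x :=
  ((A.chart x).2 ▸ mem_image_of_mem (A.ψ x) (Metric.mem_ball.2 hy) : A.ψ x y ∈ A.C x ∩ _).1

theorem exists_ψ_eq {x : X} {c : ℍ} (hc : c ∈ A.C x) (hd : dist c (A.ψ x x) < 8 * A.ρ) :
    ∃ y, dist y x = dist c (A.ψ x x) ∧ A.ψ x y = c := by
  have : c ∈ A.C x ∩ Metric.ball (A.ψ x x) (8 * A.ρ) := ⟨hc, hd⟩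
  rw [← (A.chart x).2] at this
  obtain ⟨y, hy, rfl⟩ := this
  exact ⟨y, ((A.chart x).1 y hy x (Metric.mem_ball_self (by linarith [A.ρ_pos]))).symm, rfl⟩

theorem interior_image_ball_nonempty (x : X) {r : ℝ} (hr : 0 < r) (hr' : r ≤ 8 * A.ρ) :
    (interior (A.ψ x '' Metric.ball x r)).Nonempty := by
  rw [((A.chart x).restrict hr (by simpa using hr')).2]
  exact (A.convex x).interior_inter_ball_nonempty (A.interior_nonempty x)
    (A.ψ_mem (by simpa using A.ρ_pos)) hr

theorem exists_transition {x y : X} (hxy : dist x y ≤ 4 * A.ρ) :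
    ∃ g : ℍ ≃ᵢ ℍ, ∀ z, dist z x < 8 * A.ρ → dist z y < 8 * A.ρ → g (A.ψ y z) = A.ψ x z := by
  have hρ := A.ρ_pos
  have hne : (interior
      (A.ψ y '' (Metric.ball x (8 * A.ρ) ∩ Metric.ball y (8 * A.ρ)))).Nonempty := by
    refine (A.interior_image_ball_nonempty y (r := 4 * A.ρ) (by linarith) (by linarith)).mono
      (interior_mono (image_mono (subset_inter ?_ (Metric.ball_subset_ball (by linarith)))))
    exact Metric.ball_subset_ball' (by linarith [dist_comm x y])
  obtain ⟨g, hg⟩ := exists_isometryEquiv_comp_eqOn (fun a ha b hb => A.dist_ψ ha.1 hb.1)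
    (fun a ha b hb => A.dist_ψ ha.2 hb.2) hne
  exact ⟨g, fun z hx hy => hg z ⟨hx, hy⟩⟩

open Classical in
/-- The isometry of the hyperbolic plane carrying the chart about `y` to the chart about `x`. -/
noncomputable def transition (x y : X) : ℍ ≃ᵢ ℍ :=
  if h : dist x y ≤ 4 * A.ρ then (A.exists_transition h).choose else 1

theorem transition_apply {x y z : X} (hxy : dist x y ≤ 4 * A.ρ) (hx : dist z x < 8 * A.ρ)
    (hy : dist z y < 8 * A.ρ) : A.transition x y (A.ψ y z) = A.ψ x z := by
  rw [transition, dif_pos hxy]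
  exact (A.exists_transition hxy).choose_spec z hx hy

theorem transition_mul {x y z : X} (hxy : dist x y ≤ 4 * A.ρ) (hyz : dist y z ≤ 4 * A.ρ)
    (hxz : dist x z ≤ 4 * A.ρ) : A.transition x y * A.transition y z = A.transition x z := by
  have hρ := A.ρ_pos
  refine isometryEquiv_ext_of_interior
    (A.interior_image_ball_nonempty z (r := 4 * A.ρ) (by linarith) (by linarith)) ?_
  rintro _ ⟨w, hw, rfl⟩
  rw [Metric.mem_ball] at hw
  have h1 : dist w x < 8 * A.ρ := by linarith [dist_triangle w z x, dist_comm x z]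
  have h2 : dist w y < 8 * A.ρ := by linarith [dist_triangle w z y, dist_comm y z]
  have h3 : dist w z < 8 * A.ρ := by linarith
  rw [IsometryEquiv.mul_apply, A.transition_apply hyz h2 h3, A.transition_apply hxy h1 h2,
    A.transition_apply hxz h1 h3]

theorem transition_self (x : X) : A.transition x x = 1 := by
  have h : dist x x ≤ 4 * A.ρ := by simpa using A.ρ_pos.le
  have := A.transition_mul h h h
  simpa using this

/-! ### Development along chains -/

/-- A discrete path: consecutive points among `x 0, …, x N` are at distance at most `ρ`. -/
def IsChain (x : ℕ → X) (N : ℕ) : Prop := ∀ i < N, dist (x i) (x (i + 1)) ≤ A.ρ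

/-- The composition of the transition isometries along a chain: the isometry carrying the chart
about its last point to the continuation, along the chain, of the chart about its first point. -/
noncomputable def holonomy (x : ℕ → X) : ℕ → ℍ ≃ᵢ ℍ
  | 0 => 1
  | n + 1 => holonomy x n * A.transition (x n) (x (n + 1))

theorem holonomy_congr {x y : ℕ → X} {n : ℕ} (h : ∀ i ≤ n, x i = y i) :
    A.holonomy x n = A.holonomy y n := by
  induction n with
  | zero => rfl
  | succ n ih =>
    rw [holonomy, holonomy, ih fun i hi => h i (by omega), h n (by omega), h (n + 1) le_rfl]

theorem holonomy_eq_mul_transition {x y : ℕ → X} {N : ℕ} (hx : A.IsChain x N) (hy : A.IsChain y N)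
    (h0 : x 0 = y 0) (hxy : ∀ i ≤ N, dist (x i) (y i) ≤ 2 * A.ρ) :
    ∀ n ≤ N, A.holonomy y n = A.holonomy x n * A.transition (x n) (y n) := by
  have hρ := A.ρ_pos
  intro n
  induction n with
  | zero => intro _; rw [holonomy, holonomy, h0, transition_self, one_mul]
  | succ n ih =>
    intro hn
    have d1 := hxy n (by omega)
    have d2 := hxy (n + 1) hn
    have d3 := hx n hn
    have d4 := hy n hn
    have d5 := dist_triangle (x n) (y n) (y (n + 1))
    rw [holonomy, holonomy, ih (by omega), mul_assoc, mul_assoc,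
      A.transition_mul (by linarith) (by linarith) (by linarith),
      A.transition_mul (by linarith) (by linarith) (by linarith)]

theorem holonomy_eq_of_near {x y : ℕ → X} {N : ℕ} (hx : A.IsChain x N) (hy : A.IsChain y N)
    (h0 : x 0 = y 0) (hN : x N = y N) (hxy : ∀ i ≤ N, dist (x i) (y i) ≤ 2 * A.ρ) :
    A.holonomy y N = A.holonomy x N := by
  rw [A.holonomy_eq_mul_transition hx hy h0 hxy N le_rfl, hN, transition_self, mul_one]

/-- The energy of the first `N` steps of a discrete path. -/
noncomputable def chainEnergy (x : ℕ → X) (N : ℕ) : ℝ :=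
  ∑ i ∈ Finset.range N, dist (x i) (x (i + 1)) ^ 2

/-- The chains of `N` steps with the endpoints and the holonomy of `x`: a discrete substitute for
the homotopy class of a path. -/
def chainClass (x : ℕ → X) (N : ℕ) : Set (ℕ → X) :=
  {y | A.IsChain y N ∧ y 0 = x 0 ∧ y N = x N ∧ A.holonomy y N = A.holonomy x N}

theorem chainClass_eq_of_mem {x y : ℕ → X} {N : ℕ} (hy : y ∈ A.chainClass x N) :
    A.chainClass y N = A.chainClass x N := by
  obtain ⟨-, h0, hN, hhol⟩ := hy
  simp only [chainClass, h0, hN, hhol]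

theorem mem_chainClass_of_near {x y : ℕ → X} {N : ℕ} (hx : A.IsChain x N) (hy : A.IsChain y N)
    (h0 : y 0 = x 0) (hN : y N = x N) (hxy : ∀ i ≤ N, dist (x i) (y i) ≤ 2 * A.ρ) :
    y ∈ A.chainClass x N :=
  ⟨hy, h0, hN, A.holonomy_eq_of_near hx hy h0.symm hN.symm hxy⟩

theorem isClosed_setOf_isChain (N : ℕ) : IsClosed {y : ℕ → X | A.IsChain y N} := by
  simp only [IsChain, ofPred_forall]
  exact isClosed_biInter fun i _ => isClosed_le (by fun_prop) continuous_const

theorem isClosed_chainClass (x : ℕ → X) (N : ℕ) : IsClosed (A.chainClass x N) := by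
  have hρ := A.ρ_pos
  have hclosed : IsClosed {y : ℕ → X | A.IsChain y N ∧ y 0 = x 0 ∧ y N = x N} :=
    (A.isClosed_setOf_isChain N).inter
      ((isClosed_eq (by fun_prop) continuous_const).inter
        (isClosed_eq (by fun_prop) continuous_const))
  refine isClosed_of_closure_subset fun y hy => ?_
  obtain ⟨hyc, hy0, hyN⟩ : A.IsChain y N ∧ y 0 = x 0 ∧ y N = x N :=
    hclosed.closure_subset_iff.2 (fun z hz => ⟨hz.1, hz.2.1, hz.2.2.1⟩) hy
  have hopen : IsOpen (⋂ i ∈ Iic N, {z : ℕ → X | dist (y i) (z i) < A.ρ}) :=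
    (finite_Iic N).isOpen_biInter fun i _ => isOpen_lt (by fun_prop) continuous_const
  obtain ⟨z, hz, hzx⟩ := mem_closure_iff.1 hy _ hopen (by simp [hρ])
  rw [← A.chainClass_eq_of_mem hzx]
  refine A.mem_chainClass_of_near hzx.1 hyc (hy0.trans hzx.2.1.symm) (hyN.trans hzx.2.2.1.symm)
    fun i hi => ?_
  have : dist (y i) (z i) < A.ρ := mem_iInter₂.1 hz i hi
  linarith [dist_comm (y i) (z i)]

theorem exists_isMinOn_chainEnergy [CompactSpace X] {x : ℕ → X} {N : ℕ} (hx : A.IsChain x N) :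
    ∃ y ∈ A.chainClass x N, IsMinOn (chainEnergy · N) (A.chainClass y N) y := by
  obtain ⟨y, hy, hmin⟩ := (A.isClosed_chainClass x N).isCompact.exists_isMinOn
    ⟨x, hx, rfl, rfl, rfl⟩ (f := (chainEnergy · N)) (by unfold chainEnergy; fun_prop)
  exact ⟨y, hy, by rwa [A.chainClass_eq_of_mem hy]⟩

theorem exists_midpoint {x y : X} (hxy : dist x y < 8 * A.ρ) :
    ∃ m, dist x m = dist x y / 2 ∧ dist m y = dist x y / 2 := by
  have hρ := A.ρ_pos
  have hx : dist x x < 8 * A.ρ := by simpa using hρ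
  have hy : dist y x < 8 * A.ρ := by rwa [dist_comm]
  obtain ⟨c, hc, h1, h2⟩ := (A.convex x).exists_midpoint (A.ψ_mem hx) (A.ψ_mem hy)
  rw [A.dist_ψ hx hy] at h1 h2
  have hd : dist c (A.ψ x x) < 8 * A.ρ := by rw [dist_comm, h1]; linarith
  obtain ⟨m, hm, rfl⟩ := A.exists_ψ_eq hc hd
  have hm' : dist m x < 8 * A.ρ := by rw [hm]; exact hd
  rw [A.dist_ψ hx hm'] at h1
  rw [A.dist_ψ hm' hy] at h2
  exact ⟨m, h1, h2⟩

theorem update_mem_chainClass {y : ℕ → X} {N : ℕ} (hy : A.IsChain y N) {i : ℕ} (hi : i + 1 < N)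
    {m : X} (h1 : dist (y i) m ≤ A.ρ) (h2 : dist m (y (i + 2)) ≤ A.ρ) :
    Function.update y (i + 1) m ∈ A.chainClass y N := by
  have hne : ∀ j, j ≠ i + 1 → Function.update y (i + 1) m j = y j :=
    fun j hj => Function.update_of_ne hj _ _
  have hchain : A.IsChain (Function.update y (i + 1) m) N := by
    intro j hj
    rcases eq_or_ne j i with rfl | hji
    · rwa [Function.update_self, hne _ (by omega)]
    rcases eq_or_ne j (i + 1) with rfl | hji'
    · rwa [Function.update_self, hne _ (by omega)]
    · rw [hne _ hji', hne _ (by omega)]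
      exact hy j hj
  refine A.mem_chainClass_of_near hy hchain (hne 0 (by omega)) (hne N (by omega)) fun j _ => ?_
  rcases eq_or_ne j (i + 1) with rfl | hj
  · rw [Function.update_self]
    linarith [dist_triangle_left (y (i + 1)) m (y i), hy i (by omega)]
  · rw [hne j hj, dist_self]
    linarith [A.ρ_pos]

theorem chainEnergy_update (y : ℕ → X) {N i : ℕ} (hi : i + 1 < N) (m : X) :
    chainEnergy (Function.update y (i + 1) m) N +
        (dist (y i) (y (i + 1)) ^ 2 + dist (y (i + 1)) (y (i + 2)) ^ 2) =
      chainEnergy y N + (dist (y i) m ^ 2 + dist m (y (i + 2)) ^ 2) := by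
  have hne : ∀ j, j ≠ i + 1 → Function.update y (i + 1) m j = y j :=
    fun j hj => Function.update_of_ne hj _ _
  have hsplit : ∀ x : ℕ → X, chainEnergy x N = dist (x i) (x (i + 1)) ^ 2 +
      (dist (x (i + 1)) (x (i + 2)) ^ 2 +
        ∑ j ∈ ((Finset.range N).erase i).erase (i + 1), dist (x j) (x (j + 1)) ^ 2) := fun x => by
    rw [chainEnergy, ← Finset.add_sum_erase _ _ (Finset.mem_range.2 (by omega : i < N)),
      ← Finset.add_sum_erase _ _ (Finset.mem_erase.2 ⟨by omega, Finset.mem_range.2 hi⟩)]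
  have hrest : ∑ j ∈ ((Finset.range N).erase i).erase (i + 1),
        dist (Function.update y (i + 1) m j) (Function.update y (i + 1) m (j + 1)) ^ 2 =
      ∑ j ∈ ((Finset.range N).erase i).erase (i + 1), dist (y j) (y (j + 1)) ^ 2 := by
    refine Finset.sum_congr rfl fun j hj => ?_
    simp only [Finset.mem_erase] at hj
    rw [hne j hj.1, hne (j + 1) (by omega)]
  rw [hsplit, hsplit y, hrest, Function.update_self, hne i (by omega), hne (i + 2) (by omega)]
  ring

theorem midpoint_of_isMinOn_chainEnergy {y : ℕ → X} {N : ℕ} (hy : A.IsChain y N)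
    (hmin : IsMinOn (chainEnergy · N) (A.chainClass y N) y) {i : ℕ} (hi : i + 1 < N) :
    dist (y i) (y (i + 1)) = dist (y (i + 1)) (y (i + 2)) ∧
      dist (y i) (y (i + 2)) = 2 * dist (y i) (y (i + 1)) := by
  have hρ := A.ρ_pos
  have ha := hy i (by omega)
  have hb : dist (y (i + 1)) (y (i + 2)) ≤ A.ρ := hy (i + 1) hi
  have hd := dist_triangle (y i) (y (i + 1)) (y (i + 2))
  obtain ⟨m, h1, h2⟩ := A.exists_midpoint (x := y i) (y := y (i + 2)) (by linarith)
  have hE : chainEnergy y N ≤ chainEnergy (Function.update y (i + 1) m) N :=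
    hmin (A.update_mem_chainClass hy hi (by linarith) (by linarith))
  have hupd := chainEnergy_update y hi m
  rw [h1, h2] at hupd
  set a := dist (y i) (y (i + 1))
  set b := dist (y (i + 1)) (y (i + 2))
  set d := dist (y i) (y (i + 2))
  have ha0 : 0 ≤ a := dist_nonneg
  have hd0 : 0 ≤ d := dist_nonneg
  -- `2 (a² + b²) ≤ d² ≤ (a + b)²`
  have hab : a = b := by
    have hdsq : d ^ 2 ≤ (a + b) ^ 2 := by gcongr
    have : (a - b) ^ 2 ≤ 0 := by nlinarith
    exact sub_eq_zero.1 (pow_eq_zero_iff two_ne_zero |>.1 (le_antisymm this (sq_nonneg _)))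
  rw [← hab] at hupd hd
  exact ⟨hab, le_antisymm (by linarith) (abs_le_of_sq_le_sq' (by linarith) hd0).2⟩

end UniformAtlas

end

/-! ### The developed surface -/

section

variable {X : Type*}

/-- A framed point `(x, g)` of a surface with a uniform atlas `A` stands for the chart `g ∘ A.ψ x`
about `x`; the framed points reachable from a given one by continuation form the universal cover. -/
abbrev FramedPoint (X : Type*) := X × (ℍ ≃ᵢ ℍ)

variable [MetricSpace X]

namespace UniformAtlas

variable (A : UniformAtlas X)

/-- Continuation of a framed point to a nearby point. -/
def Step (w₁ w₂ : FramedPoint X) : Prop :=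
  dist w₁.1 w₂.1 ≤ A.ρ ∧ w₂.2 = w₁.2 * A.transition w₁.1 w₂.1

/-- Continuation of a framed point in finitely many steps. -/
def Reach : FramedPoint X → FramedPoint X → Prop := Relation.ReflTransGen A.Step

/-- The developing map: the position of a framed point in the hyperbolic plane. -/
noncomputable def develop (w : FramedPoint X) : ℍ := w.2 (A.ψ w.1 w.1)

variable {A} in
theorem Step.symm {w w' : FramedPoint X} (h : A.Step w w') : A.Step w' w := by
  have hρ := A.ρ_pos
  refine ⟨by rw [dist_comm]; exact h.1, ?_⟩
  rw [h.2, mul_assoc, A.transition_mul (by linarith [h.1]) (by linarith [h.1, dist_comm w.1 w'.1])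
    (by simpa using hρ.le), transition_self, mul_one]

variable {A} in
theorem Reach.symm {w w' : FramedPoint X} (h : A.Reach w w') : A.Reach w' w := by
  have : Std.Symm A.Step := ⟨fun _ _ h => h.symm⟩
  exact Relation.ReflTransGen.stdSymm.symm _ _ h

theorem develop_transition {x y : X} (g : ℍ ≃ᵢ ℍ) (hxy : dist x y ≤ 4 * A.ρ) :
    A.develop (y, g * A.transition x y) = g (A.ψ x y) := by
  have hρ := A.ρ_pos
  simp only [develop, IsometryEquiv.mul_apply]
  rw [A.transition_apply hxy (by rw [dist_comm]; linarith) (by simpa using hρ)]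

theorem dist_develop_transition {x y : X} (g : ℍ ≃ᵢ ℍ) (hxy : dist x y ≤ 4 * A.ρ) :
    dist (A.develop (x, g)) (A.develop (y, g * A.transition x y)) = dist x y := by
  have hρ := A.ρ_pos
  rw [A.develop_transition g hxy, develop, g.dist_eq,
    A.dist_ψ (by simpa using hρ) (by rw [dist_comm]; linarith)]

/-! ### Straight chains -/

/-- The continuation along a discrete path of the chart `g ∘ A.ψ (x 0)`. -/
noncomputable def continuation (g : ℍ ≃ᵢ ℍ) (x : ℕ → X) (i : ℕ) : FramedPoint X :=
  (x i, g * A.holonomy x i)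

theorem continuation_succ (g : ℍ ≃ᵢ ℍ) (x : ℕ → X) (i : ℕ) :
    A.continuation g x (i + 1) =
      (x (i + 1), (A.continuation g x i).2 * A.transition (x i) (x (i + 1))) := by
  rw [continuation, continuation, holonomy, mul_assoc]

theorem step_continuation (g : ℍ ≃ᵢ ℍ) {x : ℕ → X} {N : ℕ} (hx : A.IsChain x N) {i : ℕ}
    (hi : i < N) : A.Step (A.continuation g x i) (A.continuation g x (i + 1)) := by
  rw [continuation_succ]
  exact ⟨hx i hi, rfl⟩

theorem continuation_congr (g : ℍ ≃ᵢ ℍ) {x y : ℕ → X} {n : ℕ} (h : ∀ i ≤ n, x i = y i) :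
    A.continuation g x n = A.continuation g y n := by
  rw [continuation, continuation, A.holonomy_congr h, h n le_rfl]

theorem exists_continuation_eq {w w' : FramedPoint X} (h : A.Reach w w') :
    ∃ (N : ℕ) (x : ℕ → X), A.IsChain x N ∧ A.continuation w.2 x 0 = w ∧
      A.continuation w.2 x N = w' := by
  induction h with
  | refl => exact ⟨0, fun _ => w.1, fun i hi => by omega, by simp [continuation, holonomy],
      by simp [continuation, holonomy]⟩
  | @tail b c _ hbc ih =>
    obtain ⟨N, x, hx, h0, rfl⟩ := ih
    set x' : ℕ → X := Function.update x (N + 1) c.1 with hx'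
    have hold : ∀ i ≤ N, x' i = x i := fun i hi => Function.update_of_ne (by omega) _ _
    have hlast : x' (N + 1) = c.1 := Function.update_self ..
    refine ⟨N + 1, x', fun i hi => ?_, ?_, ?_⟩
    · rcases (Nat.lt_succ_iff.1 hi).lt_or_eq with h | rfl
      · rw [hold i (by omega), hold _ h]
        exact hx i h
      · rw [hold i le_rfl, hlast]
        exact hbc.1
    · rw [A.continuation_congr _ fun i hi => hold i (by omega), h0]
    · rw [continuation_succ, hlast, hold N le_rfl, A.continuation_congr _ hold]
      exact Prod.ext rfl hbc.2.symm

theorem dist_develop_continuation (g : ℍ ≃ᵢ ℍ) {x : ℕ → X} {N : ℕ} (hx : A.IsChain x N) {i : ℕ}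
    (hi : i < N) :
    dist (A.develop (A.continuation g x i)) (A.develop (A.continuation g x (i + 1))) =
      dist (x i) (x (i + 1)) := by
  rw [continuation_succ]
  exact A.dist_develop_transition _ (by linarith [hx i hi, A.ρ_pos])

theorem dist_develop_continuation_add_two (g : ℍ ≃ᵢ ℍ) {x : ℕ → X} {N : ℕ} (hx : A.IsChain x N)
    {i : ℕ} (hi : i + 1 < N) :
    dist (A.develop (A.continuation g x i)) (A.develop (A.continuation g x (i + 2))) =
      dist (x i) (x (i + 2)) := by
  have hρ := A.ρ_pos
  have h1 := hx i (by omega)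
  have h2 : dist (x (i + 1)) (x (i + 2)) ≤ A.ρ := hx (i + 1) hi
  have h3 := dist_triangle (x i) (x (i + 1)) (x (i + 2))
  rw [continuation_succ, continuation_succ, mul_assoc,
    A.transition_mul (by linarith) (by linarith) (by linarith)]
  exact A.dist_develop_transition _ (by linarith)

/-- An equally spaced sequence of continuations from `w` to `w'` whose developments lie on a line:
the discrete substitute for the geodesic between two points of the universal cover. -/
structure StraightChain (w w' : FramedPoint X) where
  N : ℕ
  ℓ : ℝ
  W : ℕ → FramedPoint X
  γ : ℝ → ℍ
  N_pos : 0 < N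
  ℓ_pos : 0 < ℓ
  ℓ_le : ℓ ≤ A.ρ
  W_zero : W 0 = w
  W_last : W N = w'
  step : ∀ i < N, A.Step (W i) (W (i + 1))
  dist_W : ∀ i < N, dist (W i).1 (W (i + 1)).1 = ℓ
  isometry_γ : Isometry γ
  develop_W : ∀ i ≤ N, A.develop (W i) = γ (i * ℓ)

theorem dist_eq_of_isMinOn_chainEnergy {y : ℕ → X} {N : ℕ} (hy : A.IsChain y N)
    (hmin : IsMinOn (chainEnergy · N) (A.chainClass y N) y) :
    ∀ i < N, dist (y i) (y (i + 1)) = dist (y 0) (y 1) := by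
  intro i
  induction i with
  | zero => exact fun _ => rfl
  | succ i ih =>
    intro hi
    rw [← ih (by omega), (A.midpoint_of_isMinOn_chainEnergy hy hmin hi).1]

theorem continuation_eq_of_dist_eq_zero (g : ℍ ≃ᵢ ℍ) {y : ℕ → X} {N : ℕ}
    (hy : ∀ i < N, dist (y i) (y (i + 1)) = 0) :
    A.continuation g y N = A.continuation g y 0 := by
  induction N with
  | zero => rfl
  | succ n ih =>
    rw [← ih fun i hi => hy i (by omega), continuation_succ, ← dist_eq_zero.1 (hy n (by omega)),
      transition_self, mul_one]
    rfl

theorem nonempty_straightChain [CompactSpace X] {w w' : FramedPoint X} (h : A.Reach w w')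
    (hne : w ≠ w') : Nonempty (A.StraightChain w w') := by
  obtain ⟨N, x, hx, hx0, hxN⟩ := A.exists_continuation_eq h
  obtain ⟨y, ⟨hy, hy0, hyN, hyh⟩, hmin⟩ := A.exists_isMinOn_chainEnergy hx
  have hspacing := A.dist_eq_of_isMinOn_chainEnergy hy hmin
  have hW0 : A.continuation w.2 y 0 = w :=
    (A.continuation_congr _ fun i hi => by rwa [Nat.le_zero.1 hi]).trans hx0
  have hWN : A.continuation w.2 y N = w' := by
    rw [← hxN, continuation, continuation, hyN, hyh]
  have hN : 0 < N := Nat.pos_of_ne_zero fun h0 => hne (by rw [← hW0, ← hWN, h0])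
  have hℓ : 0 < dist (y 0) (y 1) := dist_nonneg.lt_of_ne fun h0 => hne <| by
    rw [← hW0, ← hWN, A.continuation_eq_of_dist_eq_zero _ fun i hi => (hspacing i hi).trans h0.symm]
  obtain ⟨γ, hγ, hγW⟩ := exists_line_of_midpoint_chain
    (P := fun i => A.develop (A.continuation w.2 y i)) hℓ hN
    (fun i hi => (A.dist_develop_continuation _ hy hi).trans (hspacing i hi))
    (fun i hi => by
      rw [A.dist_develop_continuation_add_two _ hy hi,
        (A.midpoint_of_isMinOn_chainEnergy hy hmin hi).2, hspacing i (by omega)])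
  exact ⟨⟨N, dist (y 0) (y 1), A.continuation w.2 y, γ, hN, hℓ, hy 0 hN, hW0, hWN,
    fun i hi => A.step_continuation _ hy hi, hspacing, hγ, hγW⟩⟩

namespace StraightChain

variable {A} {w w' : FramedPoint X} (S : A.StraightChain w w')

theorem develop_left : A.develop w = S.γ 0 := by
  simpa [S.W_zero] using S.develop_W 0 (by omega)

theorem develop_right : A.develop w' = S.γ (S.N * S.ℓ) := by
  simpa [S.W_last] using S.develop_W S.N le_rfl

theorem length_pos : 0 < S.N * S.ℓ := mul_pos (Nat.cast_pos.2 S.N_pos) S.ℓ_pos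

theorem dist_develop : dist (A.develop w) (A.develop w') = S.N * S.ℓ := by
  rw [S.develop_left, S.develop_right, dist_line_of_le S.isometry_γ S.length_pos.le, sub_zero]

theorem reach_W {i : ℕ} (hi : i ≤ S.N) : A.Reach w (S.W i) := by
  induction i with
  | zero => rw [S.W_zero]; exact Relation.ReflTransGen.refl
  | succ i ih => exact (ih (by omega)).tail (S.step i hi)

theorem eq_transition_of_length_lt (hS : S.N * S.ℓ < A.ρ) : ∀ i ≤ S.N,
    dist w.1 (S.W i).1 ≤ i * S.ℓ ∧ (S.W i).2 = w.2 * A.transition w.1 (S.W i).1 := by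
  have hρ := A.ρ_pos
  have hℓ := S.ℓ_pos
  have hℓρ := S.ℓ_le
  intro i
  induction i with
  | zero => simp [S.W_zero, transition_self]
  | succ i ih =>
    intro hi
    obtain ⟨h1, h2⟩ := ih (by omega)
    have h3 := S.dist_W i hi
    have h4 := dist_triangle w.1 (S.W i).1 (S.W (i + 1)).1
    have h5 : ((i + 1 : ℕ) : ℝ) * S.ℓ ≤ S.N * S.ℓ :=
      mul_le_mul_of_nonneg_right (by exact_mod_cast hi) hℓ.le
    have h6 : ((i + 1 : ℕ) : ℝ) * S.ℓ = i * S.ℓ + S.ℓ := by push_cast; ring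
    refine ⟨by linarith, ?_⟩
    rw [(S.step i hi).2, h2, mul_assoc, A.transition_mul (by linarith) (by linarith) (by linarith)]

end StraightChain

theorem eq_of_develop_eq [CompactSpace X] {w w' : FramedPoint X} (h : A.Reach w w')
    (hdev : A.develop w = A.develop w') : w = w' := by
  by_contra hne
  obtain ⟨S⟩ := A.nonempty_straightChain h hne
  have := S.dist_develop
  rw [hdev, dist_self] at this
  exact S.length_pos.ne this

theorem step_of_dist_develop_lt [CompactSpace X] {w w' : FramedPoint X} (h : A.Reach w w')
    (hd : dist (A.develop w) (A.develop w') < A.ρ) :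
    dist w.1 w'.1 < A.ρ ∧ w'.2 = w.2 * A.transition w.1 w'.1 := by
  rcases eq_or_ne w w' with rfl | hne
  · rw [dist_self, transition_self, mul_one]
    exact ⟨A.ρ_pos, rfl⟩
  obtain ⟨S⟩ := A.nonempty_straightChain h hne
  rw [S.dist_develop] at hd
  obtain ⟨h1, h2⟩ := S.eq_transition_of_length_lt hd S.N le_rfl
  rw [S.W_last] at h1 h2
  exact ⟨h1.trans_lt hd, h2⟩

/-- The image of the developing map on the universal cover. -/
def developedSet (w : FramedPoint X) : Set ℍ := {p | ∃ w', A.Reach w w' ∧ A.develop w' = p}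

variable {A} in
theorem Step.mem_developedSet {w w' : FramedPoint X} (h : A.Step w w') {r : ℍ}
    (hr : dist (A.develop w) r + dist r (A.develop w') = dist (A.develop w) (A.develop w')) :
    r ∈ A.developedSet w := by
  have hρ := A.ρ_pos
  obtain ⟨x, g⟩ := w
  obtain ⟨y, g'⟩ := w'
  obtain ⟨hxy, rfl⟩ : dist x y ≤ A.ρ ∧ g' = g * A.transition x y := h
  have hd : dist (A.develop (x, g)) r ≤ A.ρ := by
    have := A.dist_develop_transition g (x := x) (y := y) (by linarith)
    linarith [dist_nonneg (x := r) (y := A.develop (y, g * A.transition x y))]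
  rw [A.develop_transition g (by linarith)] at hr
  obtain ⟨c, hc, rfl⟩ : r ∈ g '' A.C x :=
    (A.convex x).image_isometryEquiv g _ (mem_image_of_mem _ (A.ψ_mem (by simpa using hρ)))
      _ (mem_image_of_mem _ (A.ψ_mem (by rw [dist_comm]; linarith))) r hr
  rw [develop, g.dist_eq, dist_comm] at hd
  obtain ⟨z, hz, rfl⟩ := A.exists_ψ_eq hc (by dsimp only at hd; linarith)
  have hxz : dist x z ≤ A.ρ := by rw [dist_comm, hz]; exact hd
  exact ⟨(z, g * A.transition x z), .single ⟨hxz, rfl⟩, A.develop_transition g (by linarith)⟩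

variable {A} in
theorem Reach.developedSet_subset {w w' : FramedPoint X} (h : A.Reach w w') :
    A.developedSet w' ⊆ A.developedSet w :=
  fun _ ⟨v, hv, hvp⟩ => ⟨v, h.trans hv, hvp⟩

theorem StraightChain.γ_mem_developedSet {A : UniformAtlas X} {w w' : FramedPoint X}
    (S : A.StraightChain w w') {t : ℝ} (ht0 : 0 ≤ t) (ht : t < S.N * S.ℓ) :
    S.γ t ∈ A.developedSet w := by
  have hℓ := S.ℓ_pos
  set i := ⌊t / S.ℓ⌋₊
  have hi : i * S.ℓ ≤ t := (le_div_iff₀ hℓ).1 (Nat.floor_le (by positivity))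
  have hi' : t < ((i + 1 : ℕ) : ℝ) * S.ℓ := by
    push_cast
    exact (div_lt_iff₀ hℓ).1 (Nat.lt_floor_add_one _)
  have hiN : i < S.N := by exact_mod_cast lt_of_mul_lt_mul_right (hi.trans_lt ht) hℓ.le
  refine (S.reach_W hiN.le).developedSet_subset ((S.step i hiN).mem_developedSet ?_)
  rw [S.develop_W i hiN.le, S.develop_W (i + 1) hiN, dist_line_of_le S.isometry_γ hi,
    dist_line_of_le S.isometry_γ hi'.le, dist_line_of_le S.isometry_γ (hi.trans hi'.le)]
  ring

theorem geodesicallyConvex_developedSet [CompactSpace X] (w : FramedPoint X) :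
    GeodesicallyConvex (A.developedSet w) := by
  rintro p ⟨w₁, hw₁, rfl⟩ q ⟨w₂, hw₂, rfl⟩ r hr
  rcases eq_or_ne w₁ w₂ with rfl | hne
  · rw [dist_self, dist_comm r] at hr
    exact ⟨w₁, hw₁, dist_eq_zero.1 (by linarith [dist_nonneg (x := A.develop w₁) (y := r)])⟩
  obtain ⟨S⟩ := A.nonempty_straightChain (hw₁.symm.trans hw₂) hne
  have hrq : 0 ≤ dist r (A.develop w₂) := dist_nonneg
  rw [S.dist_develop] at hr
  obtain ⟨t, ht⟩ : ∃ t, t = dist (A.develop w₁) r := ⟨_, rfl⟩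
  have ht0 : 0 ≤ t := ht ▸ dist_nonneg
  have hrγ : r = S.γ t := by
    refine eq_of_isometry_line S.isometry_γ S.length_pos.ne ?_ ?_
    · rw [← S.develop_left, sub_zero, abs_of_nonneg ht0, ht]
    · rw [← S.develop_right, dist_comm, abs_sub_comm, abs_of_nonneg (by linarith)]
      linarith
  rcases (show t ≤ S.N * S.ℓ by linarith).lt_or_eq with htN | htN
  · rw [hrγ]
    exact hw₁.developedSet_subset (S.γ_mem_developedSet ht0 htN)
  · exact ⟨w₂, hw₂, by rw [hrγ, htN, S.develop_right]⟩

end UniformAtlas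

end

/-! ### Locally isometric coverings -/

section

variable {E X : Type*} [MetricSpace E] [MetricSpace X] {p : E → X} {ρ : ℝ}

theorem continuous_of_dist_eq (hρ : 0 < ρ)
    (hiso : ∀ a b, dist a b < ρ → dist (p a) (p b) = dist a b) : Continuous p := by
  refine Metric.continuous_iff.2 fun e ε hε => ⟨min ε ρ, lt_min hε hρ, fun a ha => ?_⟩
  rw [hiso a e (ha.trans_le (min_le_right _ _))]
  exact ha.trans_le (min_le_left _ _)

theorem isOpenMap_of_ball_subset_image (hρ : 0 < ρ)
    (hiso : ∀ a b, dist a b < ρ → dist (p a) (p b) = dist a b)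
    (hball : ∀ e, Metric.ball (p e) ρ ⊆ p '' Metric.ball e ρ) : IsOpenMap p := by
  intro U hU
  refine Metric.isOpen_iff.2 ?_
  rintro _ ⟨e, he, rfl⟩
  obtain ⟨ε, hε, hεU⟩ := Metric.isOpen_iff.1 hU e he
  refine ⟨min ε ρ, lt_min hε hρ, fun x hx => ?_⟩
  obtain ⟨a, ha, rfl⟩ := hball e (Metric.ball_subset_ball (min_le_right _ _) hx)
  rw [Metric.mem_ball, hiso a e ha] at hx
  exact ⟨a, hεU (hx.trans_le (min_le_left _ _)), rfl⟩

theorem eq_of_apply_eq_of_dist_lt (hiso : ∀ a b, dist a b < ρ → dist (p a) (p b) = dist a b)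
    {a b : E} (h : p a = p b) (hd : dist a b < ρ) : a = b := by
  rw [← dist_eq_zero, ← hiso a b hd, h, dist_self]

theorem discreteTopology_fiber (hρ : 0 < ρ)
    (hiso : ∀ a b, dist a b < ρ → dist (p a) (p b) = dist a b) (x : X) :
    DiscreteTopology (p ⁻¹' {x}) := by
  refine discreteTopology_iff_isOpen_singleton.2 fun e => Metric.isOpen_iff.2 ?_
  intro e' he'
  rw [mem_singleton_iff.1 he']
  exact ⟨ρ, hρ, fun a ha => Subtype.ext
    (eq_of_apply_eq_of_dist_lt hiso (a.2.trans e.2.symm) ha)⟩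

/-- The sheets over the ball of radius `ρ / 4` about `x` are the balls of the same radius about the
points of the fibre of `x`. -/
theorem isCoveringMap_of_ball_subset_image (hρ : 0 < ρ)
    (hiso : ∀ a b, dist a b < ρ → dist (p a) (p b) = dist a b)
    (hball : ∀ e, Metric.ball (p e) ρ ⊆ p '' Metric.ball e ρ) : IsCoveringMap p := by
  have hcont := continuous_of_dist_eq hρ hiso
  have hopen := isOpenMap_of_ball_subset_image hρ hiso hball
  have hlift : ∀ e x, dist x (p e) < ρ / 4 → ∃ a, dist a e < ρ / 4 ∧ p a = x := by
    intro e x hx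
    obtain ⟨a, ha, rfl⟩ := hball e (show dist x (p e) < ρ by linarith)
    exact ⟨a, by rwa [← hiso a e ha], rfl⟩
  intro x
  have hdisc := discreteTopology_fiber hρ hiso x
  have hfiber : ∀ e, dist (p e) x < ρ / 4 → ∃ i : p ⁻¹' {x}, dist e i < ρ / 4 := fun e he => by
    obtain ⟨i, hi, hix⟩ := hlift e x (by rwa [dist_comm])
    exact ⟨⟨i, hix⟩, by rwa [dist_comm]⟩
  rcases isEmpty_or_nonempty (p ⁻¹' {x}) with hempty | hne
  · have h0 : p ⁻¹' Metric.ball x (ρ / 4) = ∅ :=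
      eq_empty_of_forall_notMem fun e he => hempty.elim (hfiber e he).choose
    exact IsEvenlyCovered.to_isEvenlyCovered_preimage (I := Empty)
      (.of_preimage_eq_empty (I := Empty) (Metric.ball_mem_nhds x (by positivity)) h0)
  have : Nonempty (X → E) := ⟨fun _ => hne.some⟩
  refine (IsEvenlyCovered.of_trivialization (t := IsOpen.trivializationDiscrete
    (fun i : p ⁻¹' {x} => Metric.ball (i : E) (ρ / 4)) (Metric.ball x (ρ / 4)) Metric.isOpen_ball
    ?open_iff ?inj ?surj ?disjoint ?exhaustive)
    (Metric.mem_ball_self (by positivity))).to_isEvenlyCovered_preimage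
  case open_iff =>
    refine fun i W hW => ⟨fun h => (h.preimage hcont).inter Metric.isOpen_ball, fun h => ?_⟩
    convert hopen _ h using 1
    refine subset_antisymm (fun y hy => ?_) (by rintro _ ⟨e, he, rfl⟩; exact he.1)
    obtain ⟨e, he, rfl⟩ := hlift i y (by rw [i.2]; exact hW hy)
    exact ⟨e, ⟨hy, he⟩, rfl⟩
  case inj =>
    intro i a ha b hb h
    refine eq_of_apply_eq_of_dist_lt hiso h ?_
    linarith [dist_triangle_right a b i, Metric.mem_ball.1 ha, Metric.mem_ball.1 hb]
  case surj =>
    intro i y hy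
    exact hlift i y (by rw [i.2]; exact hy)
  case disjoint =>
    intro i j hij
    refine Set.disjoint_left.2 fun e hi hj => hij (Subtype.ext
      (eq_of_apply_eq_of_dist_lt hiso (i.2.trans j.2.symm) ?_))
    linarith [dist_triangle_left (i : E) j e, Metric.mem_ball.1 hi, Metric.mem_ball.1 hj]
  case exhaustive =>
    intro e he
    obtain ⟨i, hi⟩ := hfiber e he
    exact mem_iUnion.2 ⟨i, hi⟩

end

section

variable (X : Type*) [MetricSpace X]

/-- A locally isometric covering of an open part of `X` by a convex subset of the hyperbolic plane.
The covering map is a total function on `ℍ` with irrelevant values off `K`. -/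
structure DevelopedCover where
  /-- The covering convex set. -/
  K : Set ℍ
  convex : GeodesicallyConvex K
  interior_nonempty : (interior K).Nonempty
  /-- The covering map. -/
  π : ℍ → X
  /-- The radius of the balls on which the covering map is isometric. -/
  ρ : ℝ
  ρ_pos : 0 < ρ
  isometric : ∀ p ∈ K, ∀ q ∈ K ∩ Metric.ball p ρ, ∀ r ∈ K ∩ Metric.ball p ρ,
    dist (π q) (π r) = dist q r
  image_ball : ∀ p ∈ K, π '' (K ∩ Metric.ball p ρ) = Metric.ball (π p) ρ

variable {X}

namespace UniformAtlas

variable (A : UniformAtlas X) (w₀ : FramedPoint X)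

open Classical in
/-- The inverse of the developing map on the set developed from `w₀`; the value off that set is
irrelevant. -/
noncomputable def undevelop (p : ℍ) : X :=
  if h : ∃ w, A.Reach w₀ w ∧ A.develop w = p then h.choose.1 else w₀.1

variable [CompactSpace X] {w₀} {w : FramedPoint X}

theorem undevelop_develop (hw : A.Reach w₀ w) : A.undevelop w₀ (A.develop w) = w.1 := by
  have h : ∃ w', A.Reach w₀ w' ∧ A.develop w' = A.develop w := ⟨w, hw, rfl⟩
  rw [undevelop, dif_pos h,
    A.eq_of_develop_eq (h.choose_spec.1.symm.trans hw) h.choose_spec.2]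

theorem chart_mem_developedSet (hw : A.Reach w₀ w) {y : X} (hy : dist y w.1 < A.ρ) :
    w.2 (A.ψ w.1 y) ∈ A.developedSet w₀ ∧ A.undevelop w₀ (w.2 (A.ψ w.1 y)) = y := by
  have hy' : dist w.1 y ≤ A.ρ := by rw [dist_comm]; exact hy.le
  have hr : A.Reach w₀ (y, w.2 * A.transition w.1 y) := hw.tail ⟨hy', rfl⟩
  rw [← A.develop_transition w.2 (by linarith [A.ρ_pos])]
  exact ⟨⟨_, hr, rfl⟩, A.undevelop_develop hr⟩

theorem chart_undevelop (hw : A.Reach w₀ w) {q : ℍ}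
    (hq : q ∈ A.developedSet w₀ ∩ Metric.ball (A.develop w) A.ρ) :
    dist (A.undevelop w₀ q) w.1 < A.ρ ∧ w.2 (A.ψ w.1 (A.undevelop w₀ q)) = q := by
  obtain ⟨⟨w', hw', rfl⟩, hq⟩ := hq
  rw [Metric.mem_ball, dist_comm] at hq
  obtain ⟨hdist, htransition⟩ := A.step_of_dist_develop_lt (hw.symm.trans hw') hq
  rw [A.undevelop_develop hw', ← A.develop_transition w.2 (by linarith [A.ρ_pos]), ← htransition]
  exact ⟨by rwa [dist_comm], rfl⟩

theorem image_undevelop (hw : A.Reach w₀ w) :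
    A.undevelop w₀ '' (A.developedSet w₀ ∩ Metric.ball (A.develop w) A.ρ) =
      Metric.ball w.1 A.ρ := by
  refine subset_antisymm (by rintro _ ⟨q, hq, rfl⟩; exact (A.chart_undevelop hw hq).1) ?_
  intro y hy
  obtain ⟨hmem, heq⟩ := A.chart_mem_developedSet hw hy
  refine ⟨_, ⟨hmem, ?_⟩, heq⟩
  rw [Metric.mem_ball, UniformAtlas.develop, w.2.dist_eq,
    A.dist_ψ (by linarith [A.ρ_pos, Metric.mem_ball.1 hy]) (by simpa using A.ρ_pos)]
  exact hy

variable (w₀) in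
/-- The developed set of `w₀` as a covering of the part of `X` that can be reached from `w₀`. -/
noncomputable def developedCover : DevelopedCover X where
  K := A.developedSet w₀
  convex := A.geodesicallyConvex_developedSet w₀
  interior_nonempty := by
    refine ((A.interior_image_ball_nonempty w₀.1 A.ρ_pos
      (by linarith [A.ρ_pos])).image w₀.2).mono ?_
    rw [← IsometryEquiv.coe_toHomeomorph, Homeomorph.image_interior]
    refine interior_mono ?_
    rintro _ ⟨_, ⟨y, hy, rfl⟩, rfl⟩
    exact (A.chart_mem_developedSet .refl hy).1
  π := A.undevelop w₀
  ρ := A.ρ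
  ρ_pos := A.ρ_pos
  isometric := by
    rintro _ ⟨w, hw, rfl⟩ q hq r hr
    obtain ⟨hqd, hqw⟩ := A.chart_undevelop hw hq
    obtain ⟨hrd, hrw⟩ := A.chart_undevelop hw hr
    have hρ := A.ρ_pos
    rw [← A.dist_ψ (x := w.1) (by linarith) (by linarith), ← w.2.dist_eq, hqw, hrw]
  image_ball := by
    rintro _ ⟨w, hw, rfl⟩
    rw [A.image_undevelop hw, A.undevelop_develop hw]

end UniformAtlas

theorem IsConvexHyperbolicSurface.exists_developedCover [CompactSpace X]
    (hX : IsConvexHyperbolicSurface X) (x₀ : X) :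
    ∃ D : DevelopedCover X, ∃ p ∈ D.K, D.π p = x₀ := by
  obtain ⟨A⟩ := hX.nonempty_uniformAtlas
  exact ⟨A.developedCover (x₀, 1), A.develop (x₀, 1), ⟨_, .refl, rfl⟩, A.undevelop_develop .refl⟩

namespace DevelopedCover

variable (D : DevelopedCover X)

theorem isCoveringMap : IsCoveringMap fun p : D.K => D.π p := by
  refine isCoveringMap_of_ball_subset_image D.ρ_pos (fun a b hab =>
    D.isometric b b.2 a ⟨a.2, hab⟩ b ⟨b.2, Metric.mem_ball_self D.ρ_pos⟩) fun e => ?_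
  rw [← D.image_ball e e.2]
  rintro _ ⟨a, ⟨ha, hae⟩, rfl⟩
  exact ⟨⟨a, ha⟩, hae, rfl⟩

theorem exists_chart {p : ℍ} (hp : p ∈ D.K) : ∃ φ : X → ℍ,
    LeftInvOn φ D.π (D.K ∩ Metric.ball p D.ρ) ∧ IsIsometricChart D.K (D.π p) D.ρ φ := by
  set S := D.K ∩ Metric.ball p D.ρ
  have hinj : InjOn D.π S := fun q hq r hr h => by
    rw [← dist_eq_zero, ← D.isometric p hp q hq r hr, h, dist_self]
  have hleft := hinj.leftInvOn_invFunOn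
  have hpS : p ∈ S := ⟨hp, Metric.mem_ball_self D.ρ_pos⟩
  refine ⟨Function.invFunOn D.π S, hleft, ?_, ?_⟩
  · rw [← D.image_ball p hp]
    rintro _ ⟨q, hq, rfl⟩ _ ⟨r, hr, rfl⟩
    rw [hleft hq, hleft hr, D.isometric p hp q hq r hr]
  · rw [hleft hpS, ← D.image_ball p hp, hleft.image_image]

theorem notMem_surfaceBoundary_iff {p : ℍ} (hp : p ∈ D.K) :
    D.π p ∉ surfaceBoundary X ↔ p ∈ interior D.K := by
  obtain ⟨φ, hφl, hφ⟩ := D.exists_chart hp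
  have hφp : φ (D.π p) = p := hφl ⟨hp, Metric.mem_ball_self D.ρ_pos⟩
  rw [surfaceBoundary, mem_ofPred_eq, not_not]
  constructor
  · rintro ⟨ε, hε, χ, hχ⟩
    set r := min ε D.ρ with hr
    have hr0 : 0 < r := lt_min hε D.ρ_pos
    have hφr := hφ.restrict (y := D.π p) hr0 (by simp [hr])
    have hχr := hχ.restrict (y := D.π p) hr0 (by simp [hr])
    have hχball : χ '' Metric.ball (D.π p) r = Metric.ball (χ (D.π p)) r := by
      rw [hχr.2, univ_inter]
    obtain ⟨g, hg⟩ := exists_isometryEquiv_comp_eqOn hφr.1 hχr.1 (by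
      rw [hχball, Metric.isOpen_ball.interior_eq]
      exact Metric.nonempty_ball.2 hr0)
    have hgp : g (χ (D.π p)) = p := by rw [hg _ (Metric.mem_ball_self hr0), hφp]
    refine mem_interior.2 ⟨Metric.ball p r, ?_, Metric.isOpen_ball, Metric.mem_ball_self hr0⟩
    calc Metric.ball p r = g '' Metric.ball (χ (D.π p)) r := by rw [g.image_ball, hgp]
      _ = φ '' Metric.ball (D.π p) r := by rw [← hχball, image_image, image_congr hg]
      _ ⊆ D.K := by rw [hφr.2]; exact inter_subset_left
  · intro hint
    obtain ⟨ε, hε, hball⟩ := Metric.isOpen_iff.1 isOpen_interior p hint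
    have hr0 : 0 < min ε D.ρ := lt_min hε D.ρ_pos
    have hφr := hφ.restrict (y := D.π p) hr0 (by simp)
    refine ⟨min ε D.ρ, hr0, φ, hφr.1, ?_⟩
    rw [hφr.2, univ_inter, inter_eq_right, hφp]
    exact (Metric.ball_subset_ball (min_le_left _ _)).trans (hball.trans interior_subset)

theorem mem_surfaceBoundary_iff {p : ℍ} (hp : p ∈ D.K) :
    D.π p ∈ surfaceBoundary X ↔ p ∉ interior D.K :=
  not_iff_comm.1 (D.notMem_surfaceBoundary_iff hp) |>.symm

theorem exists_line_of_lift {s : ℝ → X} {a b : ℝ} (hs : IsGeodesicPath s a b) {σ : ℝ → ℍ}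
    (hσ : ContinuousOn σ (Icc a b)) (hK : ∀ τ ∈ Icc a b, σ τ ∈ D.K)
    (hπ : ∀ τ ∈ Icc a b, D.π (σ τ) = s τ) :
    ∃ γ : ℝ → ℍ, Isometry γ ∧ ∀ τ ∈ Icc a b, σ τ = γ τ := by
  refine IsGeodesicPath.exists_line ⟨hs.1, fun τ hτ => ?_⟩
  obtain ⟨δ, hδ, hiso⟩ := hs.2 τ hτ
  obtain ⟨η, hη, hcont⟩ := Metric.continuousWithinAt_iff.1 (hσ τ hτ) D.ρ D.ρ_pos
  refine ⟨min δ η, lt_min hδ hη, fun u hu v hv huτ hvτ => ?_⟩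
  rw [← hiso u hu v hv (huτ.trans_le (min_le_left _ _)) (hvτ.trans_le (min_le_left _ _)),
    ← hπ u hu, ← hπ v hv]
  exact (D.isometric (σ τ) (hK τ hτ) (σ u) ⟨hK u hu, hcont hu
    (by rw [Real.dist_eq]; exact huτ.trans_le (min_le_right _ _))⟩ (σ v) ⟨hK v hv, hcont hv
    (by rw [Real.dist_eq]; exact hvτ.trans_le (min_le_right _ _))⟩).symm

end DevelopedCover

end

/-! ### Crossing paths in planar sets -/

theorem exists_continuous_log {F : ℝ × ℝ → ℂ} (hF : Continuous F) (h0 : ∀ z, F z ≠ 0) :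
    ∃ L : ℝ × ℝ → ℂ, Continuous L ∧ ∀ z, Complex.exp (L z) = F z := by
  obtain ⟨L, ⟨-, hL⟩, -⟩ := Complex.isCoveringMapOn_exp.existsUnique_continuousMap_lifts
    (A := ℝ × ℝ) ⟨F, hF⟩ (a₀ := 0) (e₀ := Complex.log (F 0)) (Complex.exp_log (h0 0)) h0
  exact ⟨L, L.continuous, fun z => congrFun hL z⟩

theorem sub_eq_sub_of_exp_eq {A : Type*} [TopologicalSpace A] [PreconnectedSpace A] {L M : A → ℂ}
    (hL : Continuous L) (hM : Continuous M) (h : ∀ a, Complex.exp (L a) = Complex.exp (M a))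
    (a b : A) : L a - M a = L b - M b := by
  have hc : Complex.exp (L b - M b) = 1 := by
    rw [Complex.exp_sub, h, div_self (Complex.exp_ne_zero _)]
  have key : L = fun a => M a + (L b - M b) := by
    refine Complex.isCoveringMap_exp.eq_of_comp_eq hL (hM.add continuous_const) ?_ b (by ring)
    ext a
    simp only [Function.comp_apply]
    rw [Complex.exp_add, hc, mul_one, h]
  have := congrFun key a
  rw [this]
  ring

theorem log_im_sub_of_half_plane {L : ℝ → ℂ} (hL : Continuous L) {n : ℂ} (hn : n ≠ 0)
    (h : ∀ t, 0 ≤ (conj n * Complex.exp (L t)).re) (s t : ℝ) :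
    (L t).im - (L s).im =
      (conj n * Complex.exp (L t)).arg - (conj n * Complex.exp (L s)).arg := by
  have hn' : conj n ≠ 0 := by simpa using hn
  have h0 : ∀ t, conj n * Complex.exp (L t) ≠ 0 := fun t => mul_ne_zero hn' (Complex.exp_ne_zero _)
  have hslit : ∀ t, conj n * Complex.exp (L t) ∈ Complex.slitPlane := by
    intro t
    rw [Complex.mem_slitPlane_iff]
    rcases (h t).lt_or_eq with h1 | h1
    · exact Or.inl h1
    · exact Or.inr fun h2 => h0 t (Complex.ext h1.symm h2)
  have hc : Continuous fun t => Complex.log (conj n * Complex.exp (L t)) :=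
    Continuous.clog (by fun_prop) hslit
  have := sub_eq_sub_of_exp_eq (L := fun t => L t + Complex.log (conj n)) (by fun_prop) hc
    (fun t => by rw [Complex.exp_add, Complex.exp_log hn', Complex.exp_log (h0 t), mul_comm]) t s
  have him := congrArg Complex.im this
  simp only [Complex.sub_im, Complex.add_im, Complex.log_im] at him
  linarith

theorem im_conj_mul_eq_sin (z w : ℂ) :
    (conj z * w).im = ‖z‖ * ‖w‖ * Real.sin (w.arg - z.arg) := by
  nth_rw 1 [← Complex.norm_mul_cos_add_sin_mul_I z, ← Complex.norm_mul_cos_add_sin_mul_I w]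
  rw [Real.sin_sub]
  simp only [map_mul, map_add, Complex.conj_ofReal, Complex.conj_I, Complex.mul_im, Complex.mul_re,
    Complex.add_re, Complex.add_im, Complex.ofReal_re, Complex.ofReal_im, Complex.I_re,
    Complex.I_im, ← Complex.ofReal_cos, ← Complex.ofReal_sin, Complex.neg_re, Complex.neg_im]
  ring

/-- A nonzero outer normal of a planar set at one of its points, in complex notation: the real part
of `conj n * z` is the Euclidean inner product of `n` and `z`. -/
def IsOuterNormal (K : Set ℂ) (p n : ℂ) : Prop :=
  n ≠ 0 ∧ ∀ z ∈ K, 0 ≤ (conj n * (p - z)).re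

/-- The oriented angle from `x` to `y` as seen from `p`, both points being on the side of `p`
opposite to the outer normal `n`. -/
noncomputable def boundaryAngle (n p x y : ℂ) : ℝ :=
  (conj n * (p - y)).arg - (conj n * (p - x)).arg

theorem exists_isOuterNormal {K : Set ℂ} (hK : Convex ℝ K) (hint : (interior K).Nonempty) {p : ℂ}
    (hp : p ∉ interior K) : ∃ n, IsOuterNormal K p n := by
  obtain ⟨f, hf⟩ := geometric_hahn_banach_open_point hK.interior isOpen_interior hp
  have hfn : ∀ z : ℂ, f z = (conj (⟨f 1, f Complex.I⟩ : ℂ) * z).re := by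
    intro z
    have : z = z.re • (1 : ℂ) + z.im • Complex.I := by simp
    conv_lhs => rw [this, map_add, map_smul, map_smul]
    simp only [smul_eq_mul, Complex.mul_re, Complex.conj_re, Complex.conj_im, neg_mul,
      sub_neg_eq_add]
    ring
  refine ⟨⟨f 1, f Complex.I⟩, fun h0 => ?_, fun z hz => ?_⟩
  · obtain ⟨c, hc⟩ := hint
    have := hf c hc
    rw [hfn c, hfn p, h0] at this
    simp at this
  · rw [← hfn, map_sub, sub_nonneg]
    have hcl : z ∈ closure (interior K) := by
      rw [hK.closure_interior_eq_closure_of_nonempty_interior hint]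
      exact subset_closure hz
    exact closure_minimal (fun y hy => (hf y hy).le)
      (isClosed_le f.continuous continuous_const) hcl

section

variable {K : Set ℂ} {p n : ℂ}

theorem IsOuterNormal.log_im_sub (h : IsOuterNormal K p n) {L k : ℝ → ℂ} (hL : Continuous L)
    (hk : ∀ t, k t ∈ K) (hexp : ∀ t, Complex.exp (L t) = p - k t) (s t : ℝ) :
    (L t).im - (L s).im = boundaryAngle n p (k s) (k t) := by
  rw [log_im_sub_of_half_plane hL h.1 (fun t => by rw [hexp]; exact h.2 _ (hk t)), hexp, hexp,
    boundaryAngle]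

theorem IsOuterNormal.log_im_sub' (h : IsOuterNormal K p n) {L k : ℝ → ℂ} (hL : Continuous L)
    (hk : ∀ t, k t ∈ K) (hexp : ∀ t, Complex.exp (L t) = k t - p) (s t : ℝ) :
    (L t).im - (L s).im = boundaryAngle n p (k s) (k t) := by
  rw [← h.log_im_sub (L := fun t => L t + Real.pi * Complex.I) (by fun_prop) hk
    (fun t => by rw [Complex.exp_add, Complex.exp_pi_mul_I, hexp]; ring)]
  simp

theorem IsOuterNormal.boundaryAngle_pos (h : IsOuterNormal K p n) {x y : ℂ} (hx : x ∈ K)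
    (hy : y ∈ K) (hpos : 0 < (conj (p - x) * (p - y)).im) : 0 < boundaryAngle n p x y := by
  set z := conj n * (p - x) with hz
  set w := conj n * (p - y) with hw
  have hzw : 0 < (conj z * w).im := by
    have : conj z * w = (Complex.normSq n : ℂ) * (conj (p - x) * (p - y)) := by
      rw [hz, hw, map_mul, Complex.conj_conj, Complex.normSq_eq_conj_mul_self]
      ring
    rw [this, Complex.im_ofReal_mul]
    exact mul_pos (Complex.normSq_pos.2 h.1) hpos
  rw [im_conj_mul_eq_sin] at hzw
  have hsin : 0 < Real.sin (w.arg - z.arg) := pos_of_mul_pos_right hzw (by positivity)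
  have hzarg := abs_le.1 (Complex.abs_arg_le_pi_div_two_iff.2 (h.2 x hx))
  have hwarg := abs_le.1 (Complex.abs_arg_le_pi_div_two_iff.2 (h.2 y hy))
  by_contra! hle
  exact hsin.not_ge (Real.sin_nonpos_of_nonpos_of_neg_pi_le hle (by linarith))

/-- The four angles add up to the change of the argument of `f x - g y` along the boundary of a
square, which is trivial because `f x - g y` has no zero in the square. -/
theorem sum_boundaryAngle_eq_zero {f g : ℝ → ℂ} (hf : Continuous f) (hg : Continuous g)
    (hfK : ∀ t, f t ∈ K) (hgK : ∀ t, g t ∈ K) (hne : ∀ x y, f x ≠ g y) {n₁ n₂ n₃ n₄ : ℂ}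
    (h₁ : IsOuterNormal K (f 0) n₁) (h₂ : IsOuterNormal K (g 1) n₂)
    (h₃ : IsOuterNormal K (f 1) n₃) (h₄ : IsOuterNormal K (g 0) n₄) :
    boundaryAngle n₁ (f 0) (g 0) (g 1) + boundaryAngle n₂ (g 1) (f 0) (f 1) +
      boundaryAngle n₃ (f 1) (g 1) (g 0) + boundaryAngle n₄ (g 0) (f 1) (f 0) = 0 := by
  obtain ⟨L, hL, hexp⟩ := exists_continuous_log (F := fun z => f z.1 - g z.2) (by fun_prop)
    fun z => sub_ne_zero.2 (hne z.1 z.2)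
  rw [← h₁.log_im_sub (L := fun t => L (0, t)) (by fun_prop) hgK (fun t => hexp _) 0 1,
    ← h₂.log_im_sub' (L := fun t => L (t, 1)) (by fun_prop) hfK (fun t => hexp _) 0 1,
    ← h₃.log_im_sub (L := fun t => L (1, t)) (by fun_prop) hgK (fun t => hexp _) 1 0,
    ← h₄.log_im_sub' (L := fun t => L (t, 0)) (by fun_prop) hfK (fun t => hexp _) 1 0]
  ring

theorem im_conj_mul (z w : ℂ) : (conj z * w).im = z.re * w.im - z.im * w.re := by
  rw [Complex.mul_im, Complex.conj_re, Complex.conj_im]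
  ring

theorem im_conj_sub_mul_sub_of_crossing {p q x y : ℂ} {l m : ℝ}
    (h : p + l * (q - p) = x + m * (y - x)) :
    (conj (p - x) * (p - y)).im = l * (conj (q - p) * (y - x)).im := by
  have hre := congrArg Complex.re h
  have him := congrArg Complex.im h
  simp only [Complex.add_re, Complex.add_im, Complex.mul_re, Complex.mul_im, Complex.ofReal_re,
    Complex.ofReal_im, zero_mul, sub_zero, add_zero, Complex.sub_re, Complex.sub_im] at hre him
  simp only [im_conj_mul, Complex.sub_re, Complex.sub_im]
  linear_combination (-1 : ℝ) * (y.im - x.im) * hre + (y.re - x.re) * him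

/-- The segments from `a` to `b` and from `a'` to `b'` cross transversally in their relative
interiors. -/
def SegmentsCross (a b a' b' : ℂ) : Prop :=
  ∃ l ∈ Ioo (0 : ℝ) 1, ∃ m ∈ Ioo (0 : ℝ) 1,
    a + l * (b - a) = a' + m * (b' - a') ∧ (conj (b - a) * (b' - a')).im ≠ 0

theorem im_conj_mul_comm (z w : ℂ) : (conj w * z).im = -(conj z * w).im := by
  rw [← Complex.conj_im, map_mul, Complex.conj_conj, mul_comm]

theorem SegmentsCross.symm {a b a' b' : ℂ} (h : SegmentsCross a b a' b') :
    SegmentsCross a' b' a b := by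
  obtain ⟨l, hl, m, hm, hlm, hdet⟩ := h
  exact ⟨m, hm, l, hl, hlm.symm, by rwa [im_conj_mul_comm, neg_ne_zero]⟩

theorem SegmentsCross.paths_meet {f g : ℝ → ℂ} (hcross : SegmentsCross (f 0) (f 1) (g 0) (g 1))
    (hK : Convex ℝ K) (hint : (interior K).Nonempty) (hf : Continuous f) (hg : Continuous g)
    (hfK : ∀ t, f t ∈ K) (hgK : ∀ t, g t ∈ K) (hf0 : f 0 ∉ interior K) (hf1 : f 1 ∉ interior K)
    (hg0 : g 0 ∉ interior K) (hg1 : g 1 ∉ interior K) : ∃ x y, f x = g y := by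
  wlog hpos : 0 < (conj (f 1 - f 0) * (g 1 - g 0)).im generalizing f g
  · obtain ⟨y, x, h⟩ := this hcross.symm hg hf hgK hfK hg0 hg1 hf0 hf1 (by
      obtain ⟨-, -, -, -, -, hdet⟩ := hcross
      rw [im_conj_mul_comm, neg_pos]
      exact lt_of_le_of_ne (not_lt.1 hpos) hdet)
    exact ⟨x, y, h.symm⟩
  obtain ⟨l, hl, m, hm, hlm, -⟩ := hcross
  by_contra! hne
  obtain ⟨n₁, h₁⟩ := exists_isOuterNormal hK hint hf0
  obtain ⟨n₂, h₂⟩ := exists_isOuterNormal hK hint hg1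
  obtain ⟨n₃, h₃⟩ := exists_isOuterNormal hK hint hf1
  obtain ⟨n₄, h₄⟩ := exists_isOuterNormal hK hint hg0
  have hsum := sum_boundaryAngle_eq_zero hf hg hfK hgK hne h₁ h₂ h₃ h₄
  have angle_pos : ∀ {p q x y n : ℂ} {l m : ℝ}, IsOuterNormal K p n → x ∈ K → y ∈ K → 0 < l →
      p + l * (q - p) = x + m * (y - x) →
      (conj (q - p) * (y - x)).im = (conj (f 1 - f 0) * (g 1 - g 0)).im →
      0 < boundaryAngle n p x y := fun hn hx hy hl hcross hdet =>
    hn.boundaryAngle_pos hx hy (by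
      rw [im_conj_sub_mul_sub_of_crossing hcross, hdet]; exact mul_pos hl hpos)
  have a₁ := angle_pos h₁ (hgK 0) (hgK 1) hl.1 hlm rfl
  have a₂ := angle_pos (q := g 0) (l := 1 - m) (m := l) h₂ (hfK 0) (hfK 1) (sub_pos.2 hm.2)
    (by push_cast; linear_combination -hlm)
    (by simp only [im_conj_mul, Complex.sub_re, Complex.sub_im]; ring)
  have a₃ := angle_pos (q := f 0) (l := 1 - l) (m := 1 - m) h₃ (hgK 1) (hgK 0) (sub_pos.2 hl.2)
    (by push_cast; linear_combination hlm)
    (by simp only [im_conj_mul, Complex.sub_re, Complex.sub_im]; ring)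
  have a₄ := angle_pos (q := g 1) (l := m) (m := 1 - l) h₄ (hfK 1) (hfK 0) hm.1
    (by push_cast; linear_combination -hlm)
    (by simp only [im_conj_mul, Complex.sub_re, Complex.sub_im]; ring)
  linarith

theorem IsOuterNormal.add_of_re_eq_zero (h : IsOuterNormal K p n) {e : ℂ}
    (he : (conj n * e).re = 0) (r : ℝ) : IsOuterNormal K (p + r * e) n := by
  refine ⟨h.1, fun z hz => ?_⟩
  have : conj n * (p + r * e - z) = conj n * (p - z) + r * (conj n * e) := by ring
  rw [this, Complex.add_re, Complex.re_ofReal_mul, he, mul_zero, add_zero]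
  exact h.2 z hz

theorem paths_meet_of_interlacing {e a : ℂ} (hn : IsOuterNormal K a n) (he : e ≠ 0)
    (hne : (conj n * e).re = 0) {f g : ℝ → ℂ} (hf : Continuous f) (hg : Continuous g)
    (hfK : ∀ t, f t ∈ K) (hgK : ∀ t, g t ∈ K) {α β : ℝ} (hα : 0 < α) (hαβ : α < β) (hβ : β < 1)
    (hg0 : g 0 = a) (hf0 : f 0 = a + α * e) (hg1 : g 1 = a + β * e) (hf1 : f 1 = a + e) :
    ∃ x y, f x = g y := by
  by_contra! hcon
  set w := conj n * e
  have hw : w ≠ 0 := mul_ne_zero (by simpa using hn.1) he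
  have hsum := sum_boundaryAngle_eq_zero hf hg hfK hgK hcon (n₁ := n) (n₂ := n) (n₃ := n) (n₄ := n)
    (hf0 ▸ hn.add_of_re_eq_zero hne α) (hg1 ▸ hn.add_of_re_eq_zero hne β)
    (by simpa [hf1] using hn.add_of_re_eq_zero hne 1) (hg0 ▸ hn)
  have arg_neg_w : (-w).arg = -w.arg := by
    rw [show -w = conj w from Complex.ext (by simp [hne]) (by simp), Complex.arg_conj,
      if_neg fun h => hne.not_lt (Complex.arg_eq_pi_iff.1 h).1]
  have arg_pos : ∀ (z : ℂ) (r : ℝ), 0 < r → z = r * e → (conj n * z).arg = w.arg := by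
    rintro _ r hr rfl
    rw [mul_left_comm, Complex.arg_real_mul _ hr]
  have arg_neg : ∀ (z : ℂ) (r : ℝ), 0 < r → z = -(r * e) → (conj n * z).arg = -w.arg := by
    rintro _ r hr rfl
    rw [mul_neg, mul_left_comm, ← mul_neg, Complex.arg_real_mul _ hr, arg_neg_w]
  -- the four angles add up to `-4 * w.arg`, whereas `w` is purely imaginary
  simp only [boundaryAngle] at hsum
  rw [arg_neg (f 0 - g 1) (β - α) (by linarith) (by rw [hf0, hg1]; push_cast; ring),
    arg_pos (f 0 - g 0) α hα (by rw [hf0, hg0]; ring),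
    arg_neg (g 1 - f 1) (1 - β) (by linarith) (by rw [hg1, hf1]; push_cast; ring),
    arg_pos (g 1 - f 0) (β - α) (by linarith) (by rw [hg1, hf0]; push_cast; ring),
    arg_pos (f 1 - g 0) 1 one_pos (by rw [hf1, hg0]; push_cast; ring),
    arg_pos (f 1 - g 1) (1 - β) (by linarith) (by rw [hf1, hg1]; push_cast; ring),
    arg_neg (g 0 - f 0) α hα (by rw [hg0, hf0]; ring),
    arg_neg (g 0 - f 1) 1 one_pos (by rw [hg0, hf1]; push_cast; ring)] at hsum
  have harg : w.arg = 0 := by linarith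
  exact hw (Complex.ext hne (Complex.arg_eq_zero_iff.1 harg).2)

end

/-! ### Chords of planar convex sets -/

theorem mem_segment_iff_exists_ofReal {a b z : ℂ} :
    z ∈ segment ℝ a b ↔ ∃ l ∈ Icc (0 : ℝ) 1, z = a + l * (b - a) := by
  simp only [segment_eq_image', Complex.real_smul, mem_image, eq_comm]

theorem mem_openSegment_iff_exists_ofReal {a b z : ℂ} :
    z ∈ openSegment ℝ a b ↔ ∃ l ∈ Ioo (0 : ℝ) 1, z = a + l * (b - a) := by
  simp only [openSegment_eq_image', Complex.real_smul, mem_image, eq_comm]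

theorem add_ofReal_mul_mem_segment_iff {a v : ℂ} (hv : v ≠ 0) {r x y : ℝ} :
    a + r * v ∈ segment ℝ (a + x * v) (a + y * v) ↔ r ∈ uIcc x y := by
  rw [← segment_eq_uIcc]
  refine exists₂_congr fun s t => and_congr_right' (and_congr_right' (and_congr_right fun h => ?_))
  have hst : (s : ℂ) + t = 1 := by exact_mod_cast h
  simp only [Complex.real_smul, smul_eq_mul]
  rw [← sub_eq_zero, show (s : ℂ) * (a + x * v) + t * (a + y * v) - (a + r * v) =
    ((s * x + t * y - r : ℝ) : ℂ) * v by push_cast; linear_combination a * hst, mul_eq_zero,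
    or_iff_left hv, Complex.ofReal_eq_zero, sub_eq_zero]

theorem exists_eq_ofReal_mul_of_im_conj_mul_eq_zero {v w : ℂ} (hv : v ≠ 0)
    (h : (conj v * w).im = 0) : ∃ r : ℝ, w = r * v := by
  have him : (w / v).im = 0 := by
    simp only [Complex.mul_im, Complex.conj_re, Complex.conj_im] at h
    rw [Complex.div_im, ← sub_div, div_eq_zero_iff]
    exact Or.inl (by linear_combination h)
  have hre : ((w / v).re : ℂ) = w / v := Complex.ext rfl (him.symm ▸ rfl)
  exact ⟨(w / v).re, by rw [hre, div_mul_cancel₀ w hv]⟩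

theorem notMem_interior_of_mem_segment {E : Type*} [AddCommGroup E] [Module ℝ E]
    [TopologicalSpace E] [IsTopologicalAddGroup E] [ContinuousConstSMul ℝ E] {K : Set E}
    (hK : Convex ℝ K) {a b z w : E} (ha : a ∈ K) (hb : b ∈ K) (hz : z ∈ openSegment ℝ a b)
    (hzi : z ∉ interior K) (hw : w ∈ segment ℝ a b) : w ∉ interior K := by
  intro hwi
  rw [segment_eq_image_lineMap] at hw
  rcases openSegment_subset_union a b (image_subset_range _ _ hw) hz with rfl | h | h
  · exact hzi hwi
  · exact hzi (hK.openSegment_self_interior_subset_interior ha hwi h)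
  · exact hzi (hK.openSegment_interior_self_subset_interior hwi hb h)

theorem left_mem_segment_of_collinear {a b a' b' z : ℂ} (hab : a ≠ b)
    (hcol : (conj (b - a) * (b' - a')).im = 0) (hz : z ∈ openSegment ℝ a b)
    (hz' : z ∈ openSegment ℝ a' b') (ha' : a' ∉ segment ℝ a b) (hb' : b' ∉ segment ℝ a b) :
    a ∈ segment ℝ a' b' := by
  obtain ⟨l, hl, rfl⟩ := mem_openSegment_iff_exists_ofReal.1 hz
  obtain ⟨m, -, hlm⟩ := mem_openSegment_iff_exists_ofReal.1 hz'
  have hv : b - a ≠ 0 := sub_ne_zero.2 hab.symm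
  obtain ⟨r, hr⟩ := exists_eq_ofReal_mul_of_im_conj_mul_eq_zero hv hcol
  obtain ⟨x, hx⟩ : ∃ x : ℝ, a' = a + x * (b - a) :=
    ⟨l - m * r, by push_cast; linear_combination -hlm - m * hr⟩
  obtain ⟨y, hy⟩ : ∃ y : ℝ, b' = a + y * (b - a) :=
    ⟨x + r, by push_cast; linear_combination hr + hx⟩
  have mem_iff : ∀ t : ℝ, a + t * (b - a) ∈ segment ℝ a b ↔ t ∈ uIcc (0 : ℝ) 1 := fun t => by
    simpa using add_ofReal_mul_mem_segment_iff hv (a := a) (r := t) (x := 0) (y := 1)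
  have hlxy : l ∈ uIcc x y := by
    rw [← add_ofReal_mul_mem_segment_iff hv, ← hx, ← hy]
    exact openSegment_subset_segment ℝ _ _ hz'
  rw [hx, mem_iff, uIcc_of_le zero_le_one] at ha'
  rw [hy, mem_iff, uIcc_of_le zero_le_one] at hb'
  suffices h : (0 : ℝ) ∈ uIcc x y by
    simpa [← hx, ← hy] using (add_ofReal_mul_mem_segment_iff hv (a := a)).2 h
  rw [mem_uIcc] at hlxy ⊢
  rw [mem_Icc] at ha' hb'
  grind

theorem SegmentsCross.of_mem_segment {K : Set ℂ} {a b a' b' z : ℂ} (ha : a ∉ interior K)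
    (hb : b ∉ interior K) (ha' : a' ∉ interior K) (hb' : b' ∉ interior K)
    (hab : openSegment ℝ a b ⊆ interior K) (hab' : openSegment ℝ a' b' ⊆ interior K)
    (h₁ : a ≠ a') (h₂ : a ≠ b') (h₃ : b ≠ a') (h₄ : b ≠ b') (hz : z ∈ segment ℝ a b)
    (hz' : z ∈ segment ℝ a' b') : SegmentsCross a b a' b' := by
  have notMem_segment : ∀ {p q r : ℂ}, r ∉ interior K → p ≠ r → q ≠ r →
      openSegment ℝ p q ⊆ interior K → r ∉ segment ℝ p q := fun hr hp hq hpq hmem =>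
    hr (hpq (mem_openSegment_of_ne_left_right hp hq hmem))
  have ha_notMem := notMem_segment ha h₁.symm h₂.symm hab'
  have hb_notMem := notMem_segment hb h₃.symm h₄.symm hab'
  have ha'_notMem := notMem_segment ha' h₁ h₃ hab
  have hb'_notMem := notMem_segment hb' h₂ h₄ hab
  have hzo : z ∈ openSegment ℝ a b :=
    mem_openSegment_of_ne_left_right (fun h => ha_notMem (h ▸ hz')) (fun h => hb_notMem (h ▸ hz'))
      hz
  have hzo' : z ∈ openSegment ℝ a' b' :=
    mem_openSegment_of_ne_left_right (fun h => ha'_notMem (h ▸ hz)) (fun h => hb'_notMem (h ▸ hz))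
      hz'
  have hne : a ≠ b := by
    rintro rfl
    exact ha (hab (by rw [openSegment_same]; rfl))
  obtain ⟨l, hl, hlz⟩ := mem_openSegment_iff_exists_ofReal.1 hzo
  obtain ⟨m, hm, hmz⟩ := mem_openSegment_iff_exists_ofReal.1 hzo'
  exact ⟨l, hl, m, hm, hlz.symm.trans hmz, fun hcol =>
    ha_notMem (left_mem_segment_of_collinear hne hcol hzo hzo' ha'_notMem hb'_notMem)⟩

theorem cramer (u v w : ℂ) :
    ((conj v * w).im : ℂ) * u = (conj u * w).im * v - (conj u * v).im * w := by
  apply Complex.ext <;> simp <;> ring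

theorem segmentsCross_iff {a b a' b' : ℂ} : SegmentsCross a b a' b' ↔
    (conj (b - a) * (b' - a')).im ≠ 0 ∧
      (conj (a' - a) * (b' - a')).im / (conj (b - a) * (b' - a')).im ∈ Ioo (0 : ℝ) 1 ∧
      (conj (a' - a) * (b - a)).im / (conj (b - a) * (b' - a')).im ∈ Ioo (0 : ℝ) 1 := by
  constructor
  · rintro ⟨l, hl, m, hm, hlm, hdet⟩
    have hu : a' - a = l * (b - a) - m * (b' - a') := by linear_combination -hlm
    refine ⟨hdet, ?_, ?_⟩
    · convert hl using 1
      rw [div_eq_iff hdet, hu]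
      simp only [im_conj_mul, Complex.sub_re, Complex.sub_im, Complex.re_ofReal_mul,
        Complex.im_ofReal_mul]
      ring
    · convert hm using 1
      rw [div_eq_iff hdet, hu]
      simp only [im_conj_mul, Complex.sub_re, Complex.sub_im, Complex.re_ofReal_mul,
        Complex.im_ofReal_mul]
      ring
  · rintro ⟨hdet, hl, hm⟩
    refine ⟨_, hl, _, hm, ?_, hdet⟩
    have hcramer := cramer (a' - a) (b - a) (b' - a')
    have hdet' : ((conj (b - a) * (b' - a')).im : ℂ) ≠ 0 := Complex.ofReal_ne_zero.2 hdet
    rw [Complex.ofReal_div, Complex.ofReal_div]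
    generalize ((conj (b - a) * (b' - a')).im : ℂ) = r at hcramer hdet' ⊢
    field_simp
    linear_combination -hcramer

section

variable {A : Type*} [TopologicalSpace A] {a b a' b' : A → ℂ}

theorem SegmentsCross.eventually {u : A} (h : SegmentsCross (a u) (b u) (a' u) (b' u))
    (ha : Continuous a) (hb : Continuous b) (ha' : Continuous a') (hb' : Continuous b') :
    ∀ᶠ v in 𝓝 u, SegmentsCross (a v) (b v) (a' v) (b' v) := by
  have continuous_det : ∀ {f g : A → ℂ}, Continuous f → Continuous g →
      Continuous fun v => (conj (f v) * g v).im := fun hf hg =>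
    Complex.continuous_im.comp ((Complex.continuous_conj.comp hf).mul hg)
  simp only [segmentsCross_iff] at h ⊢
  have hdet := (continuous_det (hb.sub ha) (hb'.sub ha')).continuousAt (x := u)
  exact (hdet.eventually_ne h.1).and
    ((((continuous_det (ha'.sub ha) (hb'.sub ha')).continuousAt.div hdet h.1).eventually_mem
      (isOpen_Ioo.mem_nhds h.2.1)).and
    (((continuous_det (ha'.sub ha) (hb.sub ha)).continuousAt.div hdet h.1).eventually_mem
      (isOpen_Ioo.mem_nhds h.2.2)))

theorem SegmentsCross.nonempty_inter {a b a' b' : ℂ} (h : SegmentsCross a b a' b') :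
    (segment ℝ a b ∩ segment ℝ a' b').Nonempty := by
  obtain ⟨l, hl, m, hm, hlm, -⟩ := h
  exact ⟨_, mem_segment_iff_exists_ofReal.2 ⟨l, Ioo_subset_Icc_self hl, rfl⟩,
    mem_segment_iff_exists_ofReal.2 ⟨m, Ioo_subset_Icc_self hm, hlm⟩⟩

theorem isClosed_setOf_segments_meet (ha : Continuous a) (hb : Continuous b) (ha' : Continuous a')
    (hb' : Continuous b') :
    IsClosed {u | (segment ℝ (a u) (b u) ∩ segment ℝ (a' u) (b' u)).Nonempty} := by
  have : {u | (segment ℝ (a u) (b u) ∩ segment ℝ (a' u) (b' u)).Nonempty} =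
      Prod.fst '' {z : A × unitInterval × unitInterval |
        a z.1 + ((z.2.1 : ℝ) : ℂ) * (b z.1 - a z.1) =
          a' z.1 + ((z.2.2 : ℝ) : ℂ) * (b' z.1 - a' z.1)} := by
    ext u
    constructor
    · rintro ⟨z, hz, hz'⟩
      obtain ⟨l, hl, rfl⟩ := mem_segment_iff_exists_ofReal.1 hz
      obtain ⟨m, hm, hlm⟩ := mem_segment_iff_exists_ofReal.1 hz'
      exact ⟨(u, ⟨l, hl⟩, ⟨m, hm⟩), hlm, rfl⟩
    · rintro ⟨⟨u', l, m⟩, hlm, rfl⟩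
      exact ⟨_, mem_segment_iff_exists_ofReal.2 ⟨l, l.2, rfl⟩,
        mem_segment_iff_exists_ofReal.2 ⟨m, m.2, hlm⟩⟩
  rw [this]
  exact isClosedMap_fst_of_compactSpace _ (isClosed_eq (by fun_prop) (by fun_prop))

theorem segments_meet_of_continuous [PreconnectedSpace A] (ha : Continuous a) (hb : Continuous b)
    (ha' : Continuous a') (hb' : Continuous b')
    (hcross : ∀ u, (segment ℝ (a u) (b u) ∩ segment ℝ (a' u) (b' u)).Nonempty →
      SegmentsCross (a u) (b u) (a' u) (b' u)) {u₀ : A}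
    (h0 : (segment ℝ (a u₀) (b u₀) ∩ segment ℝ (a' u₀) (b' u₀)).Nonempty) (u : A) :
    (segment ℝ (a u) (b u) ∩ segment ℝ (a' u) (b' u)).Nonempty := by
  have hclosed := isClosed_setOf_segments_meet ha hb ha' hb'
  have hopen : IsOpen {u | (segment ℝ (a u) (b u) ∩ segment ℝ (a' u) (b' u)).Nonempty} :=
    isOpen_iff_mem_nhds.2 fun u hu =>
      ((hcross u hu).eventually ha hb ha' hb').mono fun _ h => h.nonempty_inter
  exact eq_univ_iff_forall.1 (IsClopen.eq_univ ⟨hclosed, hopen⟩ ⟨u₀, h0⟩) u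

end

theorem klein_line_mem_segment {γ : ℝ → ℍ} (hγ : Isometry γ) {r s t : ℝ} (hrs : r ≤ s)
    (hst : s ≤ t) : klein (γ s) ∈ segment ℝ (klein (γ r)) (klein (γ t)) := by
  rw [← dist_add_dist_eq_iff, dist_line_of_le hγ hrs, dist_line_of_le hγ hst,
    dist_line_of_le hγ (hrs.trans hst)]
  ring

theorem klein_line_mem_openSegment {γ : ℝ → ℍ} (hγ : Isometry γ) {r s t : ℝ} (hrs : r < s)
    (hst : s < t) : klein (γ s) ∈ openSegment ℝ (klein (γ r)) (klein (γ t)) :=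
  mem_openSegment_of_ne_left_right (fun h => hrs.ne (hγ.injective (klein_injective h)))
    (fun h => hst.ne' (hγ.injective (klein_injective h)))
    (klein_line_mem_segment hγ hrs.le hst.le)

theorem exists_eq_line_of_collinear {γ : ℝ → ℍ} (hγ : Isometry γ) {s t : ℝ} (hst : s < t) {p : ℍ}
    {r : ℝ} (h : klein p = klein (γ s) + r * (klein (γ t) - klein (γ s))) : ∃ u, p = γ u := by
  have hd := dist_line_of_le hγ hst.le
  have hv : klein (γ t) - klein (γ s) ≠ 0 :=
    sub_ne_zero.2 fun h => hst.ne' (hγ.injective (klein_injective h))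
  rcases lt_or_ge r 0 with h0 | h0
  · have hbtw : klein (γ s) ∈ segment ℝ (klein p) (klein (γ t)) := by
      rw [h]
      simpa using (add_ofReal_mul_mem_segment_iff hv (a := klein (γ s)) (y := 1)).2
        (Icc_subset_uIcc ⟨h0.le, zero_le_one⟩)
    rw [← dist_add_dist_eq_iff, hd] at hbtw
    refine ⟨s - dist p (γ s), eq_of_isometry_line hγ hst.ne ?_ ?_⟩
    · rw [sub_sub_cancel_left, abs_neg, abs_of_nonneg dist_nonneg, dist_comm]
    · rw [abs_sub_comm, abs_of_nonneg (by linarith [dist_nonneg (x := p) (y := γ s)]), dist_comm]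
      linarith
  rcases le_or_gt r 1 with h1 | h1
  · have hbtw : klein p ∈ segment ℝ (klein (γ s)) (klein (γ t)) :=
      mem_segment_iff_exists_ofReal.2 ⟨r, ⟨h0, h1⟩, h⟩
    rw [← dist_add_dist_eq_iff, hd] at hbtw
    refine ⟨s + dist (γ s) p, eq_of_isometry_line hγ hst.ne ?_ ?_⟩
    · rw [add_sub_cancel_left, abs_of_nonneg dist_nonneg]
    · rw [abs_sub_comm, abs_of_nonneg (by linarith [dist_nonneg (x := p) (y := γ t)]), dist_comm]
      linarith
  · have hbtw : klein (γ t) ∈ segment ℝ (klein (γ s)) (klein p) := by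
      rw [h]
      simpa using (add_ofReal_mul_mem_segment_iff hv (a := klein (γ s)) (x := 0)).2
        (Icc_subset_uIcc ⟨zero_le_one, h1.le⟩)
    rw [← dist_add_dist_eq_iff, hd] at hbtw
    refine ⟨t + dist (γ t) p, eq_of_isometry_line hγ hst.ne ?_ ?_⟩
    · rw [abs_of_nonneg (by linarith [dist_nonneg (x := γ t) (y := p)])]
      linarith
    · rw [add_sub_cancel_left, abs_of_nonneg dist_nonneg]

/-! ### Lifted homotopies -/

theorem connectedComponentIn_eq_of_continuous {A Y : Type*} [TopologicalSpace A]
    [PreconnectedSpace A] [TopologicalSpace Y] {S : Set Y} {c : A → Y} (hc : Continuous c)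
    (hS : ∀ t, c t ∈ S) (u v : A) :
    connectedComponentIn S (c u) = connectedComponentIn S (c v) :=
  connectedComponentIn_eq ((isPreconnected_range hc).subset_connectedComponentIn
    (mem_range_self u) (range_subset_iff.2 hS) (mem_range_self v))

section

variable {X : Type*} [MetricSpace X]

theorem IsGeodesicPath.continuousOn {s : ℝ → X} {a b : ℝ} (hs : IsGeodesicPath s a b) :
    ContinuousOn s (Icc a b) := by
  intro u hu
  obtain ⟨δ, hδ, hiso⟩ := hs.2 u hu
  refine Metric.continuousWithinAt_iff.2 fun ε hε => ⟨min δ ε, lt_min hδ hε, fun v hv hvu => ?_⟩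
  rw [Real.dist_eq] at hvu
  rw [hiso v hv u hu (hvu.trans_le (min_le_left _ _)) (by simpa)]
  exact hvu.trans_le (min_le_right _ _)

/-- `H` restricts on the unit square to a homotopy from the path `s` on `[a, b]` to the path `t` on
`[c, d]` through paths with endpoints in `S`. It is defined on the whole plane, which is simply
connected, so that it can be lifted to coverings. -/
structure IsSquareHomotopy (H : ℝ × ℝ → X) (S : Set X) (s : ℝ → X) (a b : ℝ) (t : ℝ → X)
    (c d : ℝ) : Prop where
  continuous : Continuous H
  bottom : ∀ x ∈ Icc (0 : ℝ) 1, H (x, 0) = s (a + x * (b - a))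
  top : ∀ x ∈ Icc (0 : ℝ) 1, H (x, 1) = t (c + x * (d - c))
  left_mem : ∀ y, H (0, y) ∈ S
  right_mem : ∀ y, H (1, y) ∈ S

theorem exists_isSquareHomotopy {S : Set X} {s : ℝ → X} {a b : ℝ} {t : ℝ → X} {c d : ℝ}
    {H : unitInterval × unitInterval → X} (hH : Continuous H)
    (hs : ∀ τ : unitInterval, H (τ, 0) = s (a + τ * (b - a)))
    (ht : ∀ τ : unitInterval, H (τ, 1) = t (c + τ * (d - c)))
    (hS : ∀ u : unitInterval, H (0, u) ∈ S ∧ H (1, u) ∈ S) :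
    ∃ H' : ℝ × ℝ → X, IsSquareHomotopy H' S s a b t c d := by
  let P : ℝ → unitInterval := projIcc 0 1 zero_le_one
  have hP : Continuous P := continuous_projIcc
  have P0 : P 0 = 0 := projIcc_left _
  have P1 : P 1 = 1 := projIcc_right _
  have hPx : ∀ x ∈ Icc (0 : ℝ) 1, (P x : ℝ) = x := fun x hx =>
    congrArg Subtype.val (projIcc_of_mem _ hx)
  refine ⟨fun z => H (P z.1, P z.2), by fun_prop, fun x hx => ?_, fun x hx => ?_, fun y => ?_,
    fun y => ?_⟩ <;> dsimp only
  · rw [P0, hs, hPx x hx]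
  · rw [P1, ht, hPx x hx]
  · exact P0 ▸ (hS _).1
  · exact P1 ▸ (hS _).2

namespace IsSquareHomotopy

variable {H : ℝ × ℝ → X} {S : Set X} {s : ℝ → X} {a b : ℝ} {t : ℝ → X} {c d : ℝ}

theorem apply_bottom (h : IsSquareHomotopy H S s a b t c d) (hab : a < b) {τ : ℝ}
    (hτ : τ ∈ Icc a b) : H ((τ - a) / (b - a), 0) = s τ := by
  have hab' : 0 < b - a := sub_pos.2 hab
  rw [h.bottom _ ⟨div_nonneg (sub_nonneg.2 hτ.1) hab'.le,
    (div_le_one hab').2 (sub_le_sub_right hτ.2 a)⟩, div_mul_cancel₀ _ hab'.ne', add_sub_cancel]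

theorem component_ne (h : IsSquareHomotopy H (surfaceBoundary X) s a b t c d)
    (hjoin : JoinsDifferentBoundaryComponents s a b) (y y' : ℝ) :
    connectedComponentIn (surfaceBoundary X) (H (0, y)) ≠
      connectedComponentIn (surfaceBoundary X) (H (1, y')) := by
  have hH := h.continuous
  rw [connectedComponentIn_eq_of_continuous (c := fun y => H (0, y)) (by fun_prop) h.left_mem y 0,
    connectedComponentIn_eq_of_continuous (c := fun y => H (1, y)) (by fun_prop) h.right_mem y' 0,
    h.bottom 0 (left_mem_Icc.2 zero_le_one), h.bottom 1 (right_mem_Icc.2 zero_le_one)]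
  simpa using hjoin.2.2

theorem joinsDifferentBoundaryComponents (h : IsSquareHomotopy H (surfaceBoundary X) s a b t c d)
    (hjoin : JoinsDifferentBoundaryComponents s a b) : JoinsDifferentBoundaryComponents t c d := by
  have h0 : H (0, 1) = t c := by simpa using h.top 0 (left_mem_Icc.2 zero_le_one)
  have h1 : H (1, 1) = t d := by simpa using h.top 1 (right_mem_Icc.2 zero_le_one)
  exact ⟨h0 ▸ h.left_mem 1, h1 ▸ h.right_mem 1, h0 ▸ h1 ▸ h.component_ne hjoin 1 1⟩

end IsSquareHomotopy

namespace DevelopedCover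

variable (D : DevelopedCover X)

theorem exists_lift {F : ℝ × ℝ → X} (hF : Continuous F) {z₀ : ℝ × ℝ} {p : ℍ} (hp : p ∈ D.K)
    (hpz : D.π p = F z₀) : ∃ G : ℝ × ℝ → ℍ, Continuous G ∧ (∀ z, G z ∈ D.K) ∧
      (∀ z, D.π (G z) = F z) ∧ G z₀ = p := by
  obtain ⟨G, ⟨hG₀, hGF⟩, -⟩ := D.isCoveringMap.existsUnique_continuousMap_lifts
    (⟨F, hF⟩ : C(ℝ × ℝ, X)) z₀ ⟨p, hp⟩ hpz
  exact ⟨fun z => G z, by fun_prop, fun z => (G z).2, congrFun hGF, congrArg Subtype.val hG₀⟩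

theorem eq_of_lift {A : Type*} [TopologicalSpace A] [PreconnectedSpace A] {F G : A → ℍ}
    (hF : Continuous F) (hG : Continuous G) (hFK : ∀ z, F z ∈ D.K) (hGK : ∀ z, G z ∈ D.K)
    (h : ∀ z, D.π (F z) = D.π (G z)) {z₀ : A} (h₀ : F z₀ = G z₀) : F = G := by
  have hFG := D.isCoveringMap.eq_of_comp_eq (g₁ := fun z => (⟨F z, hFK z⟩ : D.K))
    (g₂ := fun z => ⟨G z, hGK z⟩) (by fun_prop) (by fun_prop) (funext h) z₀ (Subtype.ext h₀)
  exact funext fun z => congrArg Subtype.val (congrFun hFG z)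

theorem klein_notMem_interior {p : ℍ} (hp : p ∈ D.K) (h : D.π p ∈ surfaceBoundary X) :
    klein p ∉ interior (klein '' D.K) := by
  rwa [klein_mem_interior_iff, ← D.mem_surfaceBoundary_iff hp]

theorem continuousOn_π : ContinuousOn D.π D.K :=
  continuousOn_iff_continuous_domRestrict.2 D.isCoveringMap.continuous

theorem klein_interior_nonempty : (interior (klein '' D.K)).Nonempty :=
  D.interior_nonempty.imp' klein fun _ h => klein_mem_interior_iff.2 h

theorem line_mem {γ : ℝ → ℍ} (hγ : Isometry γ) {u v τ : ℝ} (hu : γ u ∈ D.K) (hv : γ v ∈ D.K)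
    (hτ : τ ∈ Icc u v) : γ τ ∈ D.K :=
  D.convex _ hu _ hv _ (dist_add_dist_eq_iff.2 (klein_line_mem_segment hγ hτ.1 hτ.2))

theorem openSegment_subset_interior {γ : ℝ → ℍ} (hγ : Isometry γ) {u v τ : ℝ} (hu : γ u ∈ D.K)
    (hv : γ v ∈ D.K) (hτ : τ ∈ Icc u v) (h : D.π (γ τ) ∉ surfaceBoundary X) :
    openSegment ℝ (klein (γ u)) (klein (γ v)) ⊆ interior (klein '' D.K) := by
  intro z hz
  by_contra hzi
  refine notMem_interior_of_mem_segment D.convex.convex_klein_image (mem_image_of_mem _ hu)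
    (mem_image_of_mem _ hv) hz hzi (klein_line_mem_segment hγ hτ.1 hτ.2) ?_
  rwa [klein_mem_interior_iff, ← not_not (a := γ τ ∈ _),
    ← D.mem_surfaceBoundary_iff (D.line_mem hγ hu hv hτ)]

theorem openSegment_subset_interior_of_component_ne {p q : ℍ} (hp : p ∈ D.K) (hq : q ∈ D.K)
    (hne : connectedComponentIn (surfaceBoundary X) (D.π p) ≠
      connectedComponentIn (surfaceBoundary X) (D.π q)) :
    openSegment ℝ (klein p) (klein q) ⊆ interior (klein '' D.K) := by
  obtain ⟨l, hl, γ, hγ, rfl, rfl⟩ : ∃ l ≥ 0, ∃ γ : ℝ → ℍ, Isometry γ ∧ γ 0 = p ∧ γ l = q :=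
    ⟨_, dist_nonneg, exists_isometry_line fun h => hne (h ▸ rfl)⟩
  obtain ⟨τ, hτ, hτb⟩ : ∃ τ ∈ Icc 0 l, D.π (γ τ) ∉ surfaceBoundary X := by
    by_contra! hbd
    have : PreconnectedSpace (Icc 0 l) := Subtype.preconnectedSpace isPreconnected_Icc
    have hcont : Continuous fun τ : Icc 0 l => D.π (γ τ) :=
      D.continuousOn_π.comp_continuous (hγ.continuous.comp continuous_subtype_val) fun τ =>
        D.line_mem hγ hp hq τ.2
    exact hne (connectedComponentIn_eq_of_continuous hcont (fun τ => hbd τ τ.2)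
      ⟨0, left_mem_Icc.2 hl⟩ ⟨l, right_mem_Icc.2 hl⟩)
  exact D.openSegment_subset_interior hγ hp hq hτ hτb

/-- A lift of the homotopy `H` to the developed cover whose bottom side, reparametrized by `[a, b]`,
runs along the line `line`. -/
structure LineLift (H : ℝ × ℝ → X) (a b : ℝ) where
  /-- The lifted homotopy. -/
  lift : ℝ × ℝ → ℍ
  /-- The line containing the bottom side. -/
  line : ℝ → ℍ
  continuous_lift : Continuous lift
  lift_mem : ∀ z, lift z ∈ D.K
  π_lift : ∀ z, D.π (lift z) = H z
  isometry_line : Isometry line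
  lift_bottom : ∀ τ ∈ Icc a b, lift ((τ - a) / (b - a), 0) = line τ

variable {D} {H : ℝ × ℝ → X} {S : Set X} {s : ℝ → X} {a b : ℝ} {t : ℝ → X} {c d : ℝ}

theorem exists_lineLift (hs : IsGeodesicPath s a b) (hH : IsSquareHomotopy H S s a b t c d)
    {z₀ : ℝ × ℝ} {p : ℍ} (hp : p ∈ D.K) (hpz : D.π p = H z₀) :
    ∃ F : D.LineLift H a b, F.lift z₀ = p := by
  obtain ⟨F, hF, hFK, hFπ, hFp⟩ := D.exists_lift hH.continuous hp hpz
  obtain ⟨γ, hγ, hFγ⟩ := D.exists_line_of_lift hs (σ := fun τ => F ((τ - a) / (b - a), 0))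
    (Continuous.continuousOn (by fun_prop)) (fun τ _ => hFK _) fun τ hτ => by
      rw [hFπ, hH.apply_bottom hs.1 hτ]
  exact ⟨⟨F, γ, hF, hFK, hFπ, hγ, hFγ⟩, hFp⟩

namespace LineLift

variable (F G : D.LineLift H a b)

/-- The top side of the lifted square in the Klein model, extended to the real line by constants. -/
noncomputable def top (x : ℝ) : ℂ :=
  klein (F.lift (projIcc (0 : ℝ) 1 zero_le_one x, 1))

theorem continuous_top : Continuous F.top :=
  continuous_klein.comp (F.continuous_lift.comp
    ((continuous_subtype_val.comp continuous_projIcc).prodMk continuous_const))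

theorem top_mem (x : ℝ) : F.top x ∈ klein '' D.K :=
  mem_image_of_mem _ (F.lift_mem _)

theorem top_zero : F.top 0 = klein (F.lift (0, 1)) := by
  rw [top, projIcc_left]

theorem top_one : F.top 1 = klein (F.lift (1, 1)) := by
  rw [top, projIcc_right]

theorem lift_left (hab : a ≤ b) : F.lift (0, 0) = F.line a := by
  rw [← F.lift_bottom a (left_mem_Icc.2 hab), sub_self, zero_div]

theorem lift_right (hab : a < b) : F.lift (1, 0) = F.line b := by
  rw [← F.lift_bottom b (right_mem_Icc.2 hab.le), div_self (sub_pos.2 hab).ne']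

variable {F G}

theorem π_line (hH : IsSquareHomotopy H S s a b t c d) (hab : a < b) {τ : ℝ} (hτ : τ ∈ Icc a b) :
    D.π (F.line τ) = s τ := by
  rw [← F.lift_bottom τ hτ, F.π_lift, hH.apply_bottom hab hτ]

theorem line_mem {τ : ℝ} (hτ : τ ∈ Icc a b) : F.line τ ∈ D.K :=
  F.lift_bottom τ hτ ▸ F.lift_mem _

theorem line_ne_line (hFG : ∀ z, F.lift z ≠ G.lift z) {τ : ℝ} (hτ : τ ∈ Icc a b) :
    F.line τ ≠ G.line τ := by
  rw [← F.lift_bottom τ hτ, ← G.lift_bottom τ hτ]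
  exact hFG _

theorem exists_eq_of_top_eq (hH : IsSquareHomotopy H S s a b t c d) {x y : ℝ}
    (h : F.top x = G.top y) : ∃ x' ∈ Icc (0 : ℝ) 1, ∃ y' ∈ Icc (0 : ℝ) 1,
      F.lift (x', 1) = G.lift (y', 1) ∧ t (c + x' * (d - c)) = t (c + y' * (d - c)) := by
  have hlift := klein_injective h
  refine ⟨_, Subtype.coe_prop _, _, Subtype.coe_prop _, hlift, ?_⟩
  rw [← hH.top _ (Subtype.coe_prop _), ← hH.top _ (Subtype.coe_prop _), ← F.π_lift, hlift, G.π_lift]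

end LineLift

end DevelopedCover

theorem IsConvexHyperbolicSurface.exists_lineLifts [CompactSpace X]
    (hX : IsConvexHyperbolicSurface X) {H : ℝ × ℝ → X} {S : Set X} {s : ℝ → X} {a b : ℝ}
    {t : ℝ → X} {c d : ℝ} (hs : IsGeodesicPath s a b) (hH : IsSquareHomotopy H S s a b t c d)
    {u v : ℝ} (hu : u ∈ Icc a b) (hv : v ∈ Icc a b) (huv : u ≠ v) (hsuv : s u = s v) :
    ∃ (D : DevelopedCover X) (F G : D.LineLift H a b),
      (∀ z, F.lift z ≠ G.lift z) ∧ F.line u = G.line v := by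
  obtain ⟨D, p, hp, hpu⟩ := hX.exists_developedCover (s u)
  obtain ⟨F, hF⟩ := DevelopedCover.exists_lineLift hs hH hp
    (hpu.trans (hH.apply_bottom hs.1 hu).symm)
  obtain ⟨G, hG⟩ := DevelopedCover.exists_lineLift hs hH hp
    ((hpu.trans hsuv).trans (hH.apply_bottom hs.1 hv).symm)
  rw [F.lift_bottom u hu] at hF
  rw [G.lift_bottom v hv] at hG
  refine ⟨D, F, G, fun z hz => huv (F.isometry_line.injective ?_), hF.trans hG.symm⟩
  have hFG : F.lift = G.lift := D.eq_of_lift F.continuous_lift G.continuous_lift F.lift_mem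
    G.lift_mem (fun z => (F.π_lift z).trans (G.π_lift z).symm) hz
  rw [hF, ← F.lift_bottom v hv, hFG, G.lift_bottom v hv, hG]

end

/-! ### Paths between different boundary components -/

section

variable {X : Type*} [MetricSpace X]

namespace DevelopedCover.LineLift

variable {D : DevelopedCover X} {H : ℝ × ℝ → X} {s : ℝ → X} {a b : ℝ} {t : ℝ → X} {c d : ℝ}
  {F G : D.LineLift H a b}

theorem left_notMem_interior {S : Set X} (hS : S ⊆ surfaceBoundary X)
    (hH : IsSquareHomotopy H S s a b t c d) (y : ℝ) :
    klein (F.lift (0, y)) ∉ interior (klein '' D.K) :=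
  D.klein_notMem_interior (F.lift_mem _) (F.π_lift _ ▸ hS (hH.left_mem y))

theorem right_notMem_interior {S : Set X} (hS : S ⊆ surfaceBoundary X)
    (hH : IsSquareHomotopy H S s a b t c d) (y : ℝ) :
    klein (F.lift (1, y)) ∉ interior (klein '' D.K) :=
  D.klein_notMem_interior (F.lift_mem _) (F.π_lift _ ▸ hS (hH.right_mem y))

theorem exists_top_eq_top {S : Set X} (hS : S ⊆ surfaceBoundary X)
    (hH : IsSquareHomotopy H S s a b t c d) (hcross : SegmentsCross (klein (F.lift (0, 1)))
      (klein (F.lift (1, 1))) (klein (G.lift (0, 1))) (klein (G.lift (1, 1)))) :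
    ∃ x y, F.top x = G.top y := by
  simp only [← top_zero, ← top_one] at hcross
  apply hcross.paths_meet D.convex.convex_klein_image D.klein_interior_nonempty F.continuous_top
    G.continuous_top F.top_mem G.top_mem
  · exact F.top_zero ▸ left_notMem_interior hS hH 1
  · exact F.top_one ▸ right_notMem_interior hS hH 1
  · exact G.top_zero ▸ left_notMem_interior hS hH 1
  · exact G.top_one ▸ right_notMem_interior hS hH 1

theorem segmentsCross_of_meet (hH : IsSquareHomotopy H (surfaceBoundary X) s a b t c d)
    (hjoin : JoinsDifferentBoundaryComponents s a b) (hFG : ∀ z, F.lift z ≠ G.lift z) (y : ℝ)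
    (hmeet : (segment ℝ (klein (F.lift (0, y))) (klein (F.lift (1, y))) ∩
      segment ℝ (klein (G.lift (0, y))) (klein (G.lift (1, y)))).Nonempty) :
    SegmentsCross (klein (F.lift (0, y))) (klein (F.lift (1, y))) (klein (G.lift (0, y)))
      (klein (G.lift (1, y))) := by
  have openSegment_subset : ∀ F : D.LineLift H a b,
      openSegment ℝ (klein (F.lift (0, y))) (klein (F.lift (1, y))) ⊆ interior (klein '' D.K) :=
    fun F => D.openSegment_subset_interior_of_component_ne (F.lift_mem _) (F.lift_mem _)
      (by simpa only [F.π_lift] using hH.component_ne hjoin y y)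
  have left_ne_right : ∀ F G : D.LineLift H a b, klein (F.lift (0, y)) ≠ klein (G.lift (1, y)) :=
    fun F G h => hH.component_ne hjoin y y (by rw [← F.π_lift, klein_injective h, G.π_lift])
  obtain ⟨z, hz, hz'⟩ := hmeet
  exact SegmentsCross.of_mem_segment (left_notMem_interior subset_rfl hH y)
    (right_notMem_interior subset_rfl hH y) (left_notMem_interior subset_rfl hH y)
    (right_notMem_interior subset_rfl hH y) (openSegment_subset F) (openSegment_subset G)
    (fun h => hFG _ (klein_injective h)) (left_ne_right F G) (left_ne_right G F).symm
    (fun h => hFG _ (klein_injective h)) hz hz'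

theorem line_mem_segment (hab : a < b) {τ : ℝ} (hτ : τ ∈ Icc a b) :
    klein (F.line τ) ∈ segment ℝ (klein (F.lift (0, 0))) (klein (F.lift (1, 0))) := by
  rw [F.lift_left hab.le, F.lift_right hab]
  exact klein_line_mem_segment F.isometry_line hτ.1 hτ.2

theorem top_ne_top (hH : IsSquareHomotopy H (surfaceBoundary X) s a b t c d) (hcd : c < d)
    (ht : InjOn t (Icc c d)) (hFG : ∀ z, F.lift z ≠ G.lift z) (x y : ℝ) : F.top x ≠ G.top y := by
  intro hxy
  obtain ⟨x, hx, y, hy, hlift, htxy⟩ := exists_eq_of_top_eq hH hxy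
  have hmem : ∀ x ∈ Icc (0 : ℝ) 1, c + x * (d - c) ∈ Icc c d := fun x hx =>
    ⟨by nlinarith [hx.1], by nlinarith [hx.2]⟩
  have hxy : x = y :=
    mul_right_cancel₀ (sub_pos.2 hcd).ne' (add_left_cancel (ht (hmem x hx) (hmem y hy) htxy))
  exact hFG _ (hxy ▸ hlift)

end DevelopedCover.LineLift

open DevelopedCover

theorem isSimple_of_pathsHomotopic [CompactSpace X] (hX : IsConvexHyperbolicSurface X)
    {s : ℝ → X} {a b : ℝ} {t : ℝ → X} {c d : ℝ} (hs : IsGeodesicPath s a b)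
    (hjoin : JoinsDifferentBoundaryComponents s a b) (hcd : c < d)
    (hst : PathsHomotopic s a b t c d) (ht : InjOn t (Icc c d)) : IsSimple s a b := by
  obtain ⟨_, hH₀, hHs, hHt, hHb⟩ := hst
  obtain ⟨H, hH⟩ := exists_isSquareHomotopy hH₀ hHs hHt hHb
  intro u hu v hv hsuv
  by_contra huv
  obtain ⟨D, F, G, hFG, hline⟩ :=
    hX.exists_lineLifts hs hH (Ioo_subset_Icc_self hu) (Ioo_subset_Icc_self hv) huv hsuv
  have continuous_side : ∀ (F : D.LineLift H a b) (x : ℝ),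
      Continuous fun y => klein (F.lift (x, y)) := fun F x =>
    continuous_klein.comp (F.continuous_lift.comp (by fun_prop))
  have hcross := LineLift.segmentsCross_of_meet hH hjoin hFG
  have hmeet := segments_meet_of_continuous (continuous_side F 0) (continuous_side F 1)
    (continuous_side G 0) (continuous_side G 1) hcross (u₀ := 0)
    ⟨klein (F.line u), LineLift.line_mem_segment hs.1 (Ioo_subset_Icc_self hu),
      hline ▸ LineLift.line_mem_segment hs.1 (Ioo_subset_Icc_self hv)⟩
  obtain ⟨x, y, hxy⟩ := LineLift.exists_top_eq_top subset_rfl hH (hcross 1 (hmeet 1))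
  exact LineLift.top_ne_top hH hcd ht hFG x y hxy

theorem notMem_surfaceBoundary_of_joins [CompactSpace X] (hX : IsConvexHyperbolicSurface X)
    {t : ℝ → X} {c d : ℝ} (ht : IsGeodesicPath t c d)
    (hjoin : JoinsDifferentBoundaryComponents t c d) {τ : ℝ} (hτ : τ ∈ Ioo c d) :
    t τ ∉ surfaceBoundary X := by
  have hcont : Continuous fun z : unitInterval × unitInterval => t (c + z.1 * (d - c)) :=
    ht.continuousOn.comp_continuous (by fun_prop) fun z => by
      constructor <;> nlinarith [z.1.2.1, z.1.2.2, ht.1]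
  obtain ⟨H, hH⟩ := exists_isSquareHomotopy (S := surfaceBoundary X) (s := t) (t := t) hcont
    (fun _ => rfl) (fun _ => rfl) (fun _ => by simpa using ⟨hjoin.1, hjoin.2.1⟩)
  obtain ⟨D, p, hp, hpc⟩ := hX.exists_developedCover (H (0, 0))
  obtain ⟨F, -⟩ := exists_lineLift ht hH hp hpc
  have hπ := fun {τ} => F.π_line hH ht.1 (τ := τ)
  have hc := left_mem_Icc.2 ht.1.le
  have hd := right_mem_Icc.2 ht.1.le
  have hτ' := Ioo_subset_Icc_self hτ
  have hsub := D.openSegment_subset_interior_of_component_ne (F.line_mem hc) (F.line_mem hd)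
    (by rw [hπ hc, hπ hd]; exact hjoin.2.2)
  rw [← hπ hτ', D.notMem_surfaceBoundary_iff (F.line_mem hτ'), ← klein_mem_interior_iff]
  exact hsub (klein_line_mem_openSegment F.isometry_line hτ.1 hτ.2)

theorem IsSimple.injOn_Icc [CompactSpace X] (hX : IsConvexHyperbolicSurface X)
    {t : ℝ → X} {c d : ℝ} (ht : IsGeodesicPath t c d)
    (hjoin : JoinsDifferentBoundaryComponents t c d) (hsimple : IsSimple t c d) :
    InjOn t (Icc c d) := by
  have hne : t c ≠ t d := fun h => hjoin.2.2 (by rw [h])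
  have hends : ∀ x ∈ ({c, d} : Set ℝ), t x ∈ surfaceBoundary X := by
    simpa using ⟨hjoin.1, hjoin.2.1⟩
  have hdisj : Disjoint (Ioo c d) {c, d} :=
    disjoint_left.2 fun x hx h => by rcases h with rfl | rfl <;> simp at hx
  rw [← Ioo_union_both ht.1.le, injOn_union hdisj]
  refine ⟨hsimple, ?_, fun x hx y hy hxy =>
    notMem_surfaceBoundary_of_joins hX ht hjoin hx (hxy ▸ hends y hy)⟩
  rw [injOn_pair]
  exact fun h => absurd h hne

theorem isSimple_of_pathsHomotopic_geodesic [CompactSpace X] (hX : IsConvexHyperbolicSurface X)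
    {s : ℝ → X} {a b : ℝ} {t : ℝ → X} {c d : ℝ} (hs : IsGeodesicPath s a b)
    (hjoin : JoinsDifferentBoundaryComponents s a b) (ht : IsGeodesicPath t c d)
    (hst : PathsHomotopic s a b t c d) (hsimple : IsSimple t c d) : IsSimple s a b := by
  obtain ⟨_, hH₀, hHs, hHt, hHb⟩ := id hst
  obtain ⟨H, hH⟩ := exists_isSquareHomotopy hH₀ hHs hHt hHb
  exact isSimple_of_pathsHomotopic hX hs hjoin ht.1 hst
    (hsimple.injOn_Icc hX ht (hH.joinsDifferentBoundaryComponents hjoin))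

end

/-! ### Loops at a boundary point -/

theorem line_eq_translate_or_reflect {γ δ : ℝ → ℍ} (hγ : Isometry γ) (hδ : Isometry δ)
    {u v x y : ℝ} (huv : γ u = δ v) (hxy : γ x = δ y) (hvy : v ≠ y) :
    (∀ τ, δ τ = γ (τ + (u - v))) ∨ ∀ τ, δ τ = γ (u + v - τ) := by
  have hux : u ≠ x := fun h => hvy (hδ.injective (by rw [← huv, ← hxy, h]))
  have hdist : |u - x| = |v - y| := by
    rw [← Real.dist_eq, ← Real.dist_eq, ← hγ.dist_eq, ← hδ.dist_eq, huv, hxy]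
  refine (abs_eq_abs.1 hdist).imp (fun h τ => ?_) fun h τ => ?_ <;>
    refine eq_of_isometry_line hγ hux ?_ ?_
  · rw [huv, hδ.dist_eq, dist_comm, Real.dist_eq]
    congr 1
    ring
  · rw [hxy, hδ.dist_eq, dist_comm, Real.dist_eq]
    congr 1
    linarith
  · rw [huv, hδ.dist_eq, Real.dist_eq]
    congr 1
    ring
  · rw [hxy, hδ.dist_eq, Real.dist_eq]
    congr 1
    linarith

theorem exists_eq_ofReal_mul_of_re_conj_mul_eq_zero {n e w : ℂ} (hn : n ≠ 0) (he : e ≠ 0)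
    (hne : (conj n * e).re = 0) (hnw : (conj n * w).re = 0) : ∃ r : ℝ, w = r * e := by
  obtain ⟨r, hr⟩ := exists_eq_ofReal_mul_of_im_conj_mul_eq_zero he (w := w) (by
    refine (mul_eq_zero.1 (?_ : Complex.normSq n * (conj e * w).im = 0)).resolve_left
      (Complex.normSq_pos.2 hn).ne'
    have : Complex.normSq n * (conj e * w).im =
        (conj n * e).re * (conj n * w).im - (conj n * e).im * (conj n * w).re := by
      simp only [Complex.normSq_apply, Complex.mul_re, Complex.mul_im, Complex.conj_re,
        Complex.conj_im]
      ring
    rw [this, hne, hnw, zero_mul, mul_zero, sub_zero])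
  exact ⟨r, hr⟩

namespace IsOuterNormal

variable {K : Set ℂ} {p q n : ℂ}

theorem re_eq_zero (hp : IsOuterNormal K p n) (hq : IsOuterNormal K q n) (hpK : p ∈ K)
    (hqK : q ∈ K) : (conj n * (q - p)).re = 0 := by
  have hpq := hp.2 q hqK
  rw [← neg_sub, mul_neg, Complex.neg_re, neg_nonneg] at hpq
  exact hpq.antisymm (hq.2 p hpK)

theorem of_mem_openSegment {z : ℂ} (h : IsOuterNormal K z n) (hp : p ∈ K) (hq : q ∈ K)
    (hz : z ∈ openSegment ℝ p q) : IsOuterNormal K p n := by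
  obtain ⟨l, hl, rfl⟩ := mem_openSegment_iff_exists_ofReal.1 hz
  have hpz := h.2 p hp
  have hqz := h.2 q hq
  rw [add_sub_cancel_left, mul_left_comm, Complex.re_ofReal_mul] at hpz
  rw [show p + l * (q - p) - q = ((-(1 - l) : ℝ) : ℂ) * (q - p) by push_cast; ring,
    mul_left_comm, Complex.re_ofReal_mul] at hqz
  have hpq : (conj n * (q - p)).re = 0 := le_antisymm
    (by nlinarith [hl.2]) (nonneg_of_mul_nonneg_right hpz hl.1)
  simpa using h.add_of_re_eq_zero hpq (-l)

end IsOuterNormal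

theorem IsSimpleLoop.eq_or_of_apply_eq {X : Type*} {t : ℝ → X} {c d : ℝ} {p : X}
    (ht : IsSimpleLoop t c d p) (hcd : c < d) {x y : ℝ} (hx : x ∈ Icc (0 : ℝ) 1)
    (hy : y ∈ Icc (0 : ℝ) 1) (h : t (c + x * (d - c)) = t (c + y * (d - c))) :
    x = y ∨ x = 0 ∧ y = 1 ∨ x = 1 ∧ y = 0 := by
  have hcd' := sub_pos.2 hcd
  have inj : ∀ {x y}, x ∈ Ico (0 : ℝ) 1 → y ∈ Ico (0 : ℝ) 1 →
      t (c + x * (d - c)) = t (c + y * (d - c)) → x = y := fun hx hy h =>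
    mul_right_cancel₀ hcd'.ne' (add_left_cancel (ht.2.2
      ⟨by nlinarith [hx.1], by nlinarith [hx.2]⟩ ⟨by nlinarith [hy.1], by nlinarith [hy.2]⟩ h))
  have apply_one : t (c + 1 * (d - c)) = t (c + 0 * (d - c)) := by
    simp [ht.1, ht.2.1]
  have h0 : (0 : ℝ) ∈ Ico 0 1 := left_mem_Ico.2 one_pos
  obtain rfl | hx1 := hx.2.eq_or_lt <;> obtain rfl | hy1 := hy.2.eq_or_lt
  · exact .inl rfl
  · exact .inr (.inr ⟨rfl, inj ⟨hy.1, hy1⟩ h0 (h.symm.trans apply_one)⟩)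
  · exact .inr (.inl ⟨inj ⟨hx.1, hx1⟩ h0 (h.trans apply_one), rfl⟩)
  · exact .inl (inj ⟨hx.1, hx1⟩ ⟨hy.1, hy1⟩ h)

section

variable {X : Type*} [MetricSpace X]

namespace DevelopedCover.LineLift

variable {D : DevelopedCover X} {H : ℝ × ℝ → X} {s : ℝ → X} {a b : ℝ} {t : ℝ → X} {c d : ℝ}
  {p : X} {F G : D.LineLift H a b} {u v : ℝ}

theorem lift_eq_of_forall_eq (F : D.LineLift H a b) {x : ℝ} (h : ∀ y, H (x, y) = p) (y : ℝ) :
    F.lift (x, y) = F.lift (x, 0) := by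
  have hF := F.continuous_lift
  exact congrFun (D.eq_of_lift (F := fun y => F.lift (x, y)) (G := fun _ => F.lift (x, 0))
    (by fun_prop) (by fun_prop) (fun _ => F.lift_mem _) (fun _ => F.lift_mem _)
    (fun y => by rw [F.π_lift, F.π_lift, h, h]) (z₀ := 0) rfl) y

theorem lift_left_of_loop (hH : IsSquareHomotopy H {p} s a b t c d) (hab : a < b) (y : ℝ) :
    F.lift (0, y) = F.line a := by
  rw [F.lift_eq_of_forall_eq hH.left_mem, F.lift_left hab.le]

theorem lift_right_of_loop (hH : IsSquareHomotopy H {p} s a b t c d) (hab : a < b) (y : ℝ) :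
    F.lift (1, y) = F.line b := by
  rw [F.lift_eq_of_forall_eq hH.right_mem, F.lift_right hab]

/-- A reflection would fix the point at parameter `(u + v) / 2`, where the lines are disjoint. -/
theorem line_eq_translate (hFG : ∀ z, F.lift z ≠ G.lift z) (hu : u ∈ Icc a b) (hv : v ∈ Icc a b)
    (huv : F.line u = G.line v) {x y : ℝ} (hxy : F.line x = G.line y) (hvy : v ≠ y) (τ : ℝ) :
    G.line τ = F.line (τ + (u - v)) := by
  refine (line_eq_translate_or_reflect F.isometry_line G.isometry_line huv hxy hvy).resolve_right
    (fun h => line_ne_line hFG (τ := (u + v) / 2)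
      ⟨by linarith [hu.1, hv.1], by linarith [hu.2, hv.2]⟩ ?_) τ
  rw [h]
  congr 1
  ring

theorem line_left_ne_line_right (hFG : ∀ z, F.lift z ≠ G.lift z) (hu : u ∈ Ico a b)
    (hv : v ∈ Ico a b) (huv : F.line u = G.line v) : F.line a ≠ G.line b := by
  intro h
  have htrans := line_eq_translate hFG (Ico_subset_Icc_self hu) (Ico_subset_Icc_self hv) huv h
    hv.2.ne b
  linarith [F.isometry_line.injective (h.trans htrans), hu.1, hv.2]

theorem line_right_ne_line_left (hFG : ∀ z, F.lift z ≠ G.lift z) (hu : u ∈ Ico a b)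
    (hv : v ∈ Ioo a b) (huv : F.line u = G.line v) : F.line b ≠ G.line a := by
  intro h
  have htrans := line_eq_translate hFG (Ico_subset_Icc_self hu) (Ioo_subset_Icc_self hv) huv h
    hv.1.ne' a
  linarith [F.isometry_line.injective (h.trans htrans), hu.2, hv.1]

theorem top_ne_top_of_loop (hH : IsSquareHomotopy H {p} s a b t c d) (hab : a < b) (hcd : c < d)
    (ht : IsSimpleLoop t c d p) (hFG : ∀ z, F.lift z ≠ G.lift z) (hu : u ∈ Ico a b)
    (hv : v ∈ Ioo a b) (huv : F.line u = G.line v) (x y : ℝ) : F.top x ≠ G.top y := by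
  intro hxy
  obtain ⟨x, hx, y, hy, hlift, htxy⟩ := exists_eq_of_top_eq hH hxy
  obtain rfl | ⟨rfl, rfl⟩ | ⟨rfl, rfl⟩ := ht.eq_or_of_apply_eq hcd hx hy htxy
  · exact hFG _ hlift
  · rw [lift_left_of_loop hH hab, lift_right_of_loop hH hab] at hlift
    exact line_left_ne_line_right hFG hu (Ioo_subset_Ico_self hv) huv hlift
  · rw [lift_left_of_loop hH hab, lift_right_of_loop hH hab] at hlift
    exact line_right_ne_line_left hFG hu hv huv hlift

theorem exists_top_eq_top_of_notMem_surfaceBoundary (hp : p ∈ surfaceBoundary X)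
    (hH : IsSquareHomotopy H {p} s a b t c d) (hab : a < b) (hFG : ∀ z, F.lift z ≠ G.lift z)
    (hu : u ∈ Ico a b) (hv : v ∈ Ioo a b) (huv : F.line u = G.line v) {τ : ℝ}
    (hτ : τ ∈ Icc a b) (hτb : s τ ∉ surfaceBoundary X) : ∃ x y, F.top x = G.top y := by
  have hS : {p} ⊆ surfaceBoundary X := singleton_subset_iff.2 hp
  have ha := left_mem_Icc.2 hab.le
  have hb := right_mem_Icc.2 hab.le
  have left_notMem : ∀ F : D.LineLift H a b, klein (F.line a) ∉ interior (klein '' D.K) := fun F =>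
    lift_left_of_loop hH hab 1 ▸ F.left_notMem_interior hS hH 1
  have right_notMem : ∀ F : D.LineLift H a b, klein (F.line b) ∉ interior (klein '' D.K) := fun F =>
    lift_right_of_loop hH hab 1 ▸ F.right_notMem_interior hS hH 1
  have openSegment_subset : ∀ F : D.LineLift H a b,
      openSegment ℝ (klein (F.line a)) (klein (F.line b)) ⊆ interior (klein '' D.K) := fun F =>
    D.openSegment_subset_interior F.isometry_line (F.line_mem ha) (F.line_mem hb) hτ
      (F.π_line hH hab hτ ▸ hτb)
  apply exists_top_eq_top hS hH
  simp only [lift_left_of_loop hH hab, lift_right_of_loop hH hab]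
  exact SegmentsCross.of_mem_segment (left_notMem F) (right_notMem F) (left_notMem G)
    (right_notMem G) (openSegment_subset F) (openSegment_subset G)
    (klein_injective.ne (line_ne_line hFG ha))
    (klein_injective.ne (line_left_ne_line_right hFG hu (Ioo_subset_Ico_self hv) huv))
    (klein_injective.ne (line_right_ne_line_left hFG hu hv huv))
    (klein_injective.ne (line_ne_line hFG hb))
    (klein_line_mem_segment F.isometry_line hu.1 hu.2.le)
    (huv ▸ klein_line_mem_segment G.isometry_line hv.1.le hv.2.le)

theorem exists_isOuterNormal_of_forall_mem_surfaceBoundary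
    (hH : IsSquareHomotopy H {p} s a b t c d) (hab : a < b) (hFG : ∀ z, F.lift z ≠ G.lift z)
    (hu : u ∈ Icc a b) (hv : v ∈ Ioo a b) (huv : F.line u = G.line v)
    (hs : ∀ τ ∈ Icc a b, s τ ∈ surfaceBoundary X) :
    ∃ n, IsOuterNormal (klein '' D.K) (klein (F.line b)) n ∧
      IsOuterNormal (klein '' D.K) (klein (G.line a)) n ∧
      ∀ τ, G.line τ = F.line (τ + (u - v)) := by
  have mem : ∀ (F : D.LineLift H a b) {τ}, τ ∈ Icc a b → klein (F.line τ) ∈ klein '' D.K :=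
    fun F _ hτ => mem_image_of_mem _ (F.line_mem hτ)
  have ha := left_mem_Icc.2 hab.le
  have hb := right_mem_Icc.2 hab.le
  obtain ⟨m, hm⟩ := nonempty_Ioo.2 hab
  have hm' := Ioo_subset_Icc_self hm
  obtain ⟨n, normal_m⟩ := exists_isOuterNormal D.convex.convex_klein_image
    D.klein_interior_nonempty
    (D.klein_notMem_interior (F.line_mem hm') (F.π_line hH hab hm' ▸ hs m hm'))
  have hseg := klein_line_mem_openSegment F.isometry_line hm.1 hm.2
  have normal_Fa := normal_m.of_mem_openSegment (mem F ha) (mem F hb) hseg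
  have normal_Fb := normal_m.of_mem_openSegment (mem F hb) (mem F ha)
    (openSegment_symm ℝ (klein (F.line a)) _ ▸ hseg)
  have hdir := normal_Fa.re_eq_zero normal_Fb (mem F ha) (mem F hb)
  have normal_Gv : IsOuterNormal (klein '' D.K) (klein (G.line v)) n := by
    obtain ⟨l, -, hl⟩ := mem_segment_iff_exists_ofReal.1
      (klein_line_mem_segment F.isometry_line hu.1 hu.2)
    rw [← huv, hl]
    exact normal_Fa.add_of_re_eq_zero hdir l
  have normal_Ga := normal_Gv.of_mem_openSegment (mem G ha) (mem G hb)
    (klein_line_mem_openSegment G.isometry_line hv.1 hv.2)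
  obtain ⟨r, hr⟩ := exists_eq_ofReal_mul_of_re_conj_mul_eq_zero normal_m.1
    (sub_ne_zero.2 (klein_injective.ne (F.isometry_line.injective.ne hab.ne'))) hdir
    (normal_Fa.re_eq_zero normal_Ga (mem F ha) (mem G ha))
  obtain ⟨x, hx⟩ := exists_eq_line_of_collinear F.isometry_line hab (sub_eq_iff_eq_add'.1 hr)
  exact ⟨n, normal_Fb, normal_Ga,
    line_eq_translate hFG hu (Ioo_subset_Icc_self hv) huv hx.symm hv.1.ne'⟩

theorem exists_top_eq_top_of_forall_mem_surfaceBoundary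
    (hH : IsSquareHomotopy H {p} s a b t c d) (hab : a < b) (hFG : ∀ z, F.lift z ≠ G.lift z)
    (hu : u ∈ Ico a b) (hv : v ∈ Ioo a b) (hlt : u < v) (huv : F.line u = G.line v)
    (hs : ∀ τ ∈ Icc a b, s τ ∈ surfaceBoundary X) : ∃ x y, F.top x = G.top y := by
  obtain ⟨n, normal_Fb, normal_Ga, htrans⟩ := exists_isOuterNormal_of_forall_mem_surfaceBoundary
    hH hab hFG (Ico_subset_Icc_self hu) hv huv hs
  have hb : b + (u - v) < b := by linarith
  have hab' : a < b + (u - v) := by linarith [hu.1, hv.2]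
  have ha : a + (u - v) < a := by linarith
  obtain ⟨β, hβ, hβb⟩ := mem_openSegment_iff_exists_ofReal.1
    (klein_line_mem_openSegment F.isometry_line (ha.trans hab') hb)
  obtain ⟨θ, hθ, hθa⟩ := mem_openSegment_iff_exists_ofReal.1
    (klein_line_mem_openSegment F.isometry_line ha hab')
  have mem : ∀ (F : D.LineLift H a b) {τ}, τ ∈ Icc a b → klein (F.line τ) ∈ klein '' D.K :=
    fun F _ hτ => mem_image_of_mem _ (F.line_mem hτ)
  have hdir := normal_Ga.re_eq_zero normal_Fb (mem G (left_mem_Icc.2 hab.le))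
    (mem F (right_mem_Icc.2 hab.le))
  refine paths_meet_of_interlacing normal_Ga (e := klein (F.line b) - klein (G.line a)) ?_ hdir
    F.continuous_top G.continuous_top F.top_mem G.top_mem (mul_pos hθ.1 hβ.1)
    (mul_lt_of_lt_one_left hβ.1 hθ.2) hβ.2 ?_ ?_ ?_ ?_
  · rw [htrans, sub_ne_zero]
    exact klein_injective.ne (F.isometry_line.injective.ne (ha.trans hab).ne')
  · rw [G.top_zero, lift_left_of_loop hH hab]
  · rw [F.top_zero, lift_left_of_loop hH hab, hθa, hβb, htrans]
    push_cast
    ring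
  · rw [G.top_one, lift_right_of_loop hH hab, htrans b, hβb, htrans]
  · rw [F.top_one, lift_right_of_loop hH hab, add_sub_cancel]

end DevelopedCover.LineLift

open DevelopedCover

theorem isSimpleLoop_of_loopsHomotopicRel [CompactSpace X] (hX : IsConvexHyperbolicSurface X)
    {p : X} (hp : p ∈ surfaceBoundary X) {s : ℝ → X} {a b : ℝ} {t : ℝ → X} {c d : ℝ}
    (hs : IsGeodesicPath s a b) (hsa : s a = p) (hsb : s b = p) (hcd : c < d)
    (hst : LoopsHomotopicRel p s a b t c d) (ht : IsSimpleLoop t c d p) :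
    IsSimpleLoop s a b p := by
  refine ⟨hsa, hsb, ?_⟩
  obtain ⟨_, hH₀, hHs, hHt, hHp⟩ := hst
  obtain ⟨H, hH⟩ := exists_isSquareHomotopy (S := {p}) hH₀ hHs hHt hHp
  have key : ∀ u ∈ Ico a b, ∀ v ∈ Ico a b, u < v → s u ≠ s v := by
    intro u hu v hv hlt hsuv
    obtain ⟨D, F, G, hFG, huv⟩ := hX.exists_lineLifts hs hH (Ico_subset_Icc_self hu)
      (Ico_subset_Icc_self hv) hlt.ne hsuv
    have hv' : v ∈ Ioo a b := ⟨hu.1.trans_lt hlt, hv.2⟩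
    obtain ⟨x, y, hxy⟩ : ∃ x y, F.top x = G.top y := by
      by_cases! h : ∃ τ ∈ Icc a b, s τ ∉ surfaceBoundary X
      · obtain ⟨τ, hτ, hτb⟩ := h
        exact LineLift.exists_top_eq_top_of_notMem_surfaceBoundary hp hH hs.1 hFG hu hv' huv hτ hτb
      · exact LineLift.exists_top_eq_top_of_forall_mem_surfaceBoundary hH hs.1 hFG hu hv' hlt huv h
    exact LineLift.top_ne_top_of_loop hH hs.1 hcd ht hFG hu hv' huv x y hxy
  intro u hu v hv hsuv
  exact le_antisymm (not_lt.1 fun h => key v hv u hu h hsuv.symm)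
    (not_lt.1 fun h => key u hu v hv h hsuv)

end

/-! ### The annulus -/

theorem exists_eq_of_contracted_circle {m : ℝ × ℝ → ℂ} (hm : Continuous m) {p : ℂ} {r : ℝ}
    (hr : r ≠ 0) (hloop : ∀ y, m (2 * Real.pi, y) = m (0, y)) (h0 : ∀ x, m (x, 0) = circleMap p r x)
    (h1 : ∀ x, m (x, 1) = m (0, 1)) : ∃ z, m z = p := by
  by_contra! hne
  obtain ⟨L, hL, hexp⟩ := exists_continuous_log (F := fun z => m z - p) (by fun_prop)
    fun z => sub_ne_zero.2 (hne z)
  have sides := sub_eq_sub_of_exp_eq (L := fun y : ℝ => L (2 * Real.pi, y)) (M := fun y => L (0, y))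
    (by fun_prop) (by fun_prop) (fun y => by simp only [hexp, hloop]) 0 1
  have top := sub_eq_sub_of_exp_eq (L := fun x : ℝ => L (x, 1)) (M := fun _ => L (0, 1))
    (by fun_prop) (by fun_prop) (fun x => by simp only [hexp, h1 x]) 0 (2 * Real.pi)
  have bottom := sub_eq_sub_of_exp_eq (L := fun x : ℝ => L (x, 0))
    (M := fun x => Complex.log r + x * Complex.I) (by fun_prop) (by fun_prop) (fun x => by
      simp only [hexp, h0, circleMap, Complex.exp_add,
        Complex.exp_log (Complex.ofReal_ne_zero.2 hr), add_sub_cancel_left]) 0 (2 * Real.pi)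
  push_cast at bottom
  exact Complex.two_pi_I_ne_zero (by linear_combination sides - top + bottom)

theorem exists_circle_subset_of_mem_nhds {C : Set ℂ} {x : C} (hx : (x : ℂ) ∈ interior C)
    {U : Set C} (hU : U ∈ 𝓝 x) :
    ∃ r > 0, ∃ l : ℝ → C, Continuous l ∧ (∀ θ, (l θ : ℂ) = circleMap x r θ) ∧ ∀ θ, l θ ∈ U := by
  obtain ⟨r, hr, hrC⟩ := Metric.nhds_basis_closedBall.mem_iff.1 (mem_interior_iff_mem_nhds.1 hx)
  obtain ⟨r', hr', hrU⟩ := Metric.nhds_basis_closedBall.mem_iff.1 hU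
  have hmem : ∀ θ {R}, min r r' ≤ R →
      circleMap (x : ℂ) (min r r') θ ∈ Metric.closedBall (x : ℂ) R := fun θ _ h =>
    Metric.closedBall_subset_closedBall h (circleMap_mem_closedBall _ (lt_min hr hr').le θ)
  exact ⟨min r r', lt_min hr hr', fun θ => ⟨_, hrC (hmem θ (min_le_left _ _))⟩,
    (continuous_circleMap _ _).subtype_mk _, fun _ => rfl, fun θ => hrU (hmem θ (min_le_right _ _))⟩

theorem lineMap_ne_of_notMem_interior {E : Type*} [AddCommGroup E] [Module ℝ E]
    [TopologicalSpace E] [IsTopologicalAddGroup E] [ContinuousConstSMul ℝ E] {C : Set E}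
    (hC : Convex ℝ C) {p a c : E} (hp : p ∉ interior C) (ha : a ∈ C) (hc : c ∈ interior C)
    (hap : a ≠ p) {k : ℝ} (hk : k ∈ Icc (0 : ℝ) 1) : AffineMap.lineMap a c k ≠ p := by
  rcases hk.1.eq_or_lt with rfl | hk0
  · rwa [AffineMap.lineMap_apply_zero]
  · rw [AffineMap.lineMap_apply_module]
    exact ne_of_mem_of_not_mem
      (hC.combo_self_interior_mem_interior ha hc (sub_nonneg.2 hk.2) hk0 (by ring)) hp

/-- If `e x` were a boundary point of `C'`, a small circle around `x` could be contracted in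
`C \ {x}`: its image in `C'` can be pushed into the interior of `C'`, away from `e x`. -/
theorem mem_interior_of_openPartialHomeomorph {C C' : Set ℂ} (hC' : Convex ℝ C')
    (hint : (interior C').Nonempty) (e : OpenPartialHomeomorph C C') {x : C} (hx : x ∈ e.source)
    (hxC : (x : ℂ) ∈ interior C) : (e x : ℂ) ∈ interior C' := by
  by_contra hex
  obtain ⟨ε, hε, hεe⟩ := Metric.isOpen_iff.1 e.open_target (e x) (e.map_source hx)
  obtain ⟨c, hcε, hc⟩ : (Metric.ball (e x : ℂ) ε ∩ interior C').Nonempty :=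
    mem_closure_iff.1 ((hC'.closure_interior_eq_closure_of_nonempty_interior hint).ge
      (subset_closure (e x).2)) _ Metric.isOpen_ball (Metric.mem_ball_self hε)
  obtain ⟨r, hr, l, hl, hlr, hle⟩ := exists_circle_subset_of_mem_nhds hxC (inter_mem
    (e.open_source.mem_nhds hx) ((e.continuousAt hx).preimage_mem_nhds (Metric.ball_mem_nhds _ hε)))
  let m : ℝ × ℝ → C' := fun z =>
    ⟨AffineMap.lineMap (e (l z.1) : ℂ) c (projIcc 0 1 zero_le_one z.2 : ℝ),
      hC'.lineMap_mem (e (l z.1)).2 (interior_subset hc) (Subtype.coe_prop _)⟩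
  have hm : Continuous m := by
    have hel : Continuous (e ∘ l) := e.continuousOn.comp_continuous hl fun θ => (hle θ).1
    have hk : Continuous fun z : ℝ × ℝ => (projIcc (0 : ℝ) 1 zero_le_one z.2 : ℝ) :=
      continuous_subtype_val.comp (continuous_projIcc.comp continuous_snd)
    refine Continuous.subtype_mk ?_ _
    simp only [AffineMap.lineMap_apply_module]
    exact ((continuous_const.sub hk).smul
      (continuous_subtype_val.comp (hel.comp continuous_fst))).add (hk.smul continuous_const)
  have hmt : ∀ z, m z ∈ e.target := fun z => hεe <|
    (convex_ball (e x : ℂ) ε).lineMap_mem (hle z.1).2 hcε (Subtype.coe_prop _)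
  have hperiod : l (2 * Real.pi) = l 0 := Subtype.ext <| by
    rw [hlr, hlr]; simpa using periodic_circleMap (x : ℂ) r 0
  have hlx : ∀ θ, (e (l θ) : ℂ) ≠ e x := fun θ hθ => circleMap_ne_center (c := (x : ℂ)) hr.ne'
    (by rw [← hlr, e.injOn (hle θ).1 hx (Subtype.ext hθ)])
  obtain ⟨z, hz⟩ := exists_eq_of_contracted_circle (m := fun z => (e.symm (m z) : ℂ)) (p := x)
    (continuous_subtype_val.comp (e.symm.continuousOn.comp_continuous hm hmt)) hr.ne'
    (fun y => by simp only [m, hperiod])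
    (fun θ => by simp [m, e.left_inv (hle θ).1, hlr]) (fun θ => by simp [m])
  refine lineMap_ne_of_notMem_interior hC' hex (e (l z.1)).2 hc (hlx z.1)
    (Subtype.coe_prop (projIcc 0 1 zero_le_one z.2)) (congrArg Subtype.val (?_ : m z = e x))
  rw [← e.right_inv (hmt z), Subtype.ext hz]

theorem mem_interior_of_isLocalHomeomorph {Y : Type*} [TopologicalSpace Y] {C C' : Set ℂ}
    (hC' : Convex ℝ C') (hint : (interior C').Nonempty) {f : C → Y} {f' : C' → Y}
    (hf : IsLocalHomeomorph f) (hf' : IsLocalHomeomorph f') {x : C} {x' : C'} (h : f x = f' x')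
    (hx : (x : ℂ) ∈ interior C) : (x' : ℂ) ∈ interior C' := by
  obtain ⟨e, he, rfl⟩ := hf x
  obtain ⟨e', he', rfl⟩ := hf' x'
  have hx' : x' = e.trans e'.symm x := by
    rw [OpenPartialHomeomorph.coe_trans, Function.comp_apply, h, e'.left_inv he']
  rw [hx']
  refine mem_interior_of_openPartialHomeomorph hC' hint _ ?_ hx
  rw [OpenPartialHomeomorph.trans_source]
  exact ⟨he, by rw [mem_preimage, h]; exact e'.map_source he'⟩

theorem isLocalHomeomorph_annulus_cover : IsLocalHomeomorph
    fun w : Complex.im ⁻¹' Icc 0 1 =>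
      ((Circle.exp (w : ℂ).re, ⟨_, w.2⟩) : Circle × unitInterval) := by
  intro w
  obtain ⟨e, he, hexp⟩ := isLocalHomeomorph_circleExp (w : ℂ).re
  let φ : Complex.im ⁻¹' Icc (0 : ℝ) 1 ≃ₜ ℝ × unitInterval :=
    { toFun := fun z => ((z : ℂ).re, ⟨_, z.2⟩)
      invFun := fun z => ⟨⟨z.1, z.2⟩, z.2.2⟩
      left_inv := fun _ => rfl
      right_inv := fun _ => rfl
      continuous_toFun := by fun_prop
      continuous_invFun := by
        refine Continuous.subtype_mk ?_ _
        simpa only [Complex.mk_eq_add_mul_I] using by fun_prop }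
  refine ⟨φ.transOpenPartialHomeomorph (e.prod (OpenPartialHomeomorph.refl _)), ⟨he, trivial⟩, ?_⟩
  rw [hexp]
  rfl

variable {X : Type*} [MetricSpace X]

theorem DevelopedCover.isLocalHomeomorph_klein (D : DevelopedCover X) : IsLocalHomeomorph
    fun w : klein '' D.K => D.π ((isOpenEmbedding_klein.isEmbedding.homeomorphImage D.K).symm w) :=
  D.isCoveringMap.isLocalHomeomorph.comp (Homeomorph.isLocalHomeomorph _)

theorem mem_surfaceBoundary_iff_of_annulus [CompactSpace X] (hX : IsConvexHyperbolicSurface X)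
    (h : X ≃ₜ Circle × unitInterval) (x : X) :
    x ∈ surfaceBoundary X ↔ ((h x).2 : ℝ) ∉ Ioo (0 : ℝ) 1 := by
  obtain ⟨D, p, hp, rfl⟩ := hX.exists_developedCover x
  let w : Complex.im ⁻¹' Icc (0 : ℝ) 1 :=
    ⟨⟨Complex.arg (h (D.π p)).1, (h (D.π p)).2⟩, (h (D.π p)).2.2⟩
  have hstrip : interior (Complex.im ⁻¹' Icc (0 : ℝ) 1) = Complex.im ⁻¹' Ioo 0 1 := by
    rw [Complex.interior_preimage_im, interior_Icc]
  have hw : ((h (D.π p)).2 : ℝ) ∈ Ioo (0 : ℝ) 1 ↔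
      (w : ℂ) ∈ interior (Complex.im ⁻¹' Icc (0 : ℝ) 1) := by rw [hstrip]; rfl
  let q : klein '' D.K := ⟨klein p, mem_image_of_mem _ hp⟩
  have hq : (isOpenEmbedding_klein.isEmbedding.homeomorphImage D.K).symm q = ⟨p, hp⟩ :=
    (Homeomorph.symm_apply_eq _).2 rfl
  have local_strip := h.symm.isLocalHomeomorph.comp isLocalHomeomorph_annulus_cover
  have hqw : D.π ((isOpenEmbedding_klein.isEmbedding.homeomorphImage D.K).symm q) =
      h.symm (Circle.exp (w : ℂ).re, ⟨_, w.2⟩) := by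
    rw [hq, h.eq_symm_apply]
    exact Prod.ext (Circle.exp_arg _).symm rfl
  rw [D.mem_surfaceBoundary_iff hp, not_iff_not, ← klein_mem_interior_iff, hw]
  refine ⟨mem_interior_of_isLocalHomeomorph ?_ ?_ D.isLocalHomeomorph_klein local_strip hqw,
    mem_interior_of_isLocalHomeomorph D.convex.convex_klein_image D.klein_interior_nonempty
      local_strip D.isLocalHomeomorph_klein hqw.symm⟩
  · exact (convex_Icc (0 : ℝ) 1).linear_preimage Complex.imLm
  · rw [hstrip]
    exact ⟨⟨0, 1 / 2⟩, by norm_num⟩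

theorem height_ne_of_joins [CompactSpace X] (hX : IsConvexHyperbolicSurface X)
    (h : X ≃ₜ Circle × unitInterval) {s : ℝ → X} {a b : ℝ}
    (hjoin : JoinsDifferentBoundaryComponents s a b) : (h (s a)).2 ≠ (h (s b)).2 := by
  intro heq
  have hcomp := connectedComponentIn_eq_of_continuous (S := surfaceBoundary X)
    (c := fun θ : Circle => h.symm (θ, (h (s a)).2)) (by fun_prop) (fun θ => by
      have ha := hjoin.1
      rw [mem_surfaceBoundary_iff_of_annulus hX h] at ha ⊢
      rwa [h.apply_symm_apply]) (h (s a)).1 (h (s b)).1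
  refine hjoin.2.2 ?_
  rwa [Prod.mk.eta, h.symm_apply_apply, heq, Prod.mk.eta, h.symm_apply_apply] at hcomp

theorem pathsHomotopic_lineMap_of_lift {E : Type*} [AddCommGroup E] [Module ℝ E]
    [TopologicalSpace E] [IsTopologicalAddGroup E] [ContinuousSMul ℝ E] {P : E → X}
    (hP : Continuous P) {σ : unitInterval → E} (hσ : Continuous σ) {s : ℝ → X} {a b : ℝ}
    (hs : ∀ τ : unitInterval, P (σ τ) = s (a + τ * (b - a))) (ha : s a ∈ surfaceBoundary X)
    (hb : s b ∈ surfaceBoundary X) :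
    PathsHomotopic s a b (fun x => P (AffineMap.lineMap (σ 0) (σ 1) x)) 0 1 := by
  refine ⟨fun z =>
    P (AffineMap.lineMap (σ z.1) (AffineMap.lineMap (σ 0) (σ 1) (z.1 : ℝ)) (z.2 : ℝ)), ?_,
    fun τ => by simpa using hs τ, fun τ => by simp, fun u => ?_⟩
  · simp only [AffineMap.lineMap_apply_module]
    fun_prop
  · have h0 := hs 0
    have h1 := hs 1
    simp only [Icc.coe_zero, Icc.coe_one, zero_mul, add_zero, one_mul, add_sub_cancel,
      AffineMap.lineMap_apply_zero, AffineMap.lineMap_apply_one, AffineMap.lineMap_same,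
      AffineMap.const_apply] at h0 h1 ⊢
    exact ⟨h0 ▸ ha, h1 ▸ hb⟩

/-- A path in the annulus is homotopic, through paths with the same endpoints, to one that is
straight in the universal covering strip, which is simple when its ends are at different heights. -/
theorem isSimple_of_annulus [CompactSpace X] (hX : IsConvexHyperbolicSurface X)
    (h : X ≃ₜ Circle × unitInterval) {s : ℝ → X} {a b : ℝ} (hs : IsGeodesicPath s a b)
    (hjoin : JoinsDifferentBoundaryComponents s a b) : IsSimple s a b := by
  let P : ℝ × ℝ → X := fun w => h.symm (Circle.exp w.1, projIcc 0 1 zero_le_one w.2)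
  have hP : Continuous P := h.symm.continuous.comp
    ((Circle.exp.continuous.comp continuous_fst).prodMk (continuous_projIcc.comp continuous_snd))
  let r : unitInterval → X := fun τ => s (a + τ * (b - a))
  have hr : Continuous r := hs.continuousOn.comp_continuous (by fun_prop) fun τ => by
    constructor <;> nlinarith [τ.2.1, τ.2.2, hs.1]
  obtain ⟨θ, hθ, -⟩ := Circle.isCoveringMap_exp.exists_path_lifts
    (⟨fun τ => (h (r τ)).1, by fun_prop⟩ : C(unitInterval, Circle))
    (Complex.arg (h (r 0)).1) (Circle.exp_arg _).symm
  have hσ : ∀ τ, P (θ τ, (h (r τ)).2) = r τ := fun τ => by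
    simp only [P]
    rw [projIcc_val, show Circle.exp (θ τ) = (h (r τ)).1 from congrFun hθ τ, Prod.mk.eta,
      h.symm_apply_apply]
  refine isSimple_of_pathsHomotopic hX hs hjoin zero_lt_one
    (pathsHomotopic_lineMap_of_lift hP (by fun_prop) hσ hjoin.1 hjoin.2.1) ?_
  intro u hu v hv huv
  have hmem : ∀ {x}, x ∈ Icc (0 : ℝ) 1 →
      AffineMap.lineMap ((h (r 0)).2 : ℝ) ((h (r 1)).2 : ℝ) x ∈ Icc (0 : ℝ) 1 :=
    (convex_Icc (0 : ℝ) 1).lineMap_mem (h (r 0)).2.2 (h (r 1)).2.2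
  have heq := congrArg Prod.snd (h.symm.injective huv)
  rw [← Subtype.coe_inj, AffineMap.snd_lineMap, AffineMap.snd_lineMap,
    projIcc_of_mem _ (hmem hu), projIcc_of_mem _ (hmem hv)] at heq
  refine AffineMap.lineMap_injective ℝ (fun hne => ?_) heq
  exact height_ne_of_joins hX h hjoin (Subtype.ext (by simpa [r] using hne))

end ConvexHyperbolic

theorem proposition4p1_general {X : Type*} [MetricSpace X] [CompactSpace X]
    (hX : ConvexHyperbolic.IsConvexHyperbolicSurface X) :
    (Nonempty (X ≃ₜ Circle × unitInterval) →
      ∀ (s : ℝ → X) (a b : ℝ), ConvexHyperbolic.IsGeodesicPath s a b →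
        ConvexHyperbolic.JoinsDifferentBoundaryComponents s a b →
        ConvexHyperbolic.IsSimple s a b) ∧
    (∀ (s : ℝ → X) (a b : ℝ) (t : ℝ → X) (c d : ℝ), ConvexHyperbolic.IsGeodesicPath s a b →
      ConvexHyperbolic.JoinsDifferentBoundaryComponents s a b →
      ConvexHyperbolic.IsGeodesicPath t c d → ConvexHyperbolic.PathsHomotopic s a b t c d →
      ConvexHyperbolic.IsSimple t c d → ConvexHyperbolic.IsSimple s a b) ∧
    (∀ (s : ℝ → X) (a b : ℝ) (t : ℝ → X) (c d : ℝ), ConvexHyperbolic.IsGeodesicPath s a b →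
      ConvexHyperbolic.JoinsDifferentBoundaryComponents s a b →
      c < d → ConvexHyperbolic.PathsHomotopic s a b t c d →
      Set.InjOn t (Set.Icc c d) → ConvexHyperbolic.IsSimple s a b) ∧
    (∀ p ∈ ConvexHyperbolic.surfaceBoundary X,
      ∀ (s : ℝ → X) (a b : ℝ) (t : ℝ → X) (c d : ℝ), ConvexHyperbolic.IsGeodesicPath s a b →
      s a = p → s b = p → c < d → ConvexHyperbolic.LoopsHomotopicRel p s a b t c d →
      ConvexHyperbolic.IsSimpleLoop t c d p → ConvexHyperbolic.IsSimpleLoop s a b p) :=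
  ⟨fun ⟨h⟩ _ _ _ hs hjoin => ConvexHyperbolic.isSimple_of_annulus hX h hs hjoin,
    fun _ _ _ _ _ _ hs hjoin ht hst hts =>
      ConvexHyperbolic.isSimple_of_pathsHomotopic_geodesic hX hs hjoin ht hst hts,
    fun _ _ _ _ _ _ hs hjoin hcd hst ht =>
      ConvexHyperbolic.isSimple_of_pathsHomotopic hX hs hjoin hcd hst ht,
    fun _ hp _ _ _ _ _ _ hs hsa hsb hcd hst ht =>
      ConvexHyperbolic.isSimpleLoop_of_loopsHomotopicRel hX hp hs hsa hsb hcd hst ht⟩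

theorem proposition4p1 {X : Type*} [MetricSpace X] [CompactSpace X] [ConnectedSpace X]
    (hX : ConvexHyperbolic.IsConvexHyperbolicSurface X) (hπ : ¬ SimplyConnectedSpace X) :
    -- (1) the annulus
    (Nonempty (X ≃ₜ Circle × unitInterval) →
      ∀ (s : ℝ → X) (a b : ℝ), ConvexHyperbolic.IsGeodesicPath s a b →
        ConvexHyperbolic.JoinsDifferentBoundaryComponents s a b →
        ConvexHyperbolic.IsSimple s a b) ∧
    -- (2) paths between different boundary components: `t` a simple geodesic path
    (∀ (s : ℝ → X) (a b : ℝ) (t : ℝ → X) (c d : ℝ), ConvexHyperbolic.IsGeodesicPath s a b →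
      ConvexHyperbolic.JoinsDifferentBoundaryComponents s a b →
      ConvexHyperbolic.IsGeodesicPath t c d → ConvexHyperbolic.PathsHomotopic s a b t c d →
      ConvexHyperbolic.IsSimple t c d → ConvexHyperbolic.IsSimple s a b) ∧
    -- (2) more generally, `t` an arbitrary simple arc
    (∀ (s : ℝ → X) (a b : ℝ) (t : ℝ → X) (c d : ℝ), ConvexHyperbolic.IsGeodesicPath s a b →
      ConvexHyperbolic.JoinsDifferentBoundaryComponents s a b →
      c < d → ConvexHyperbolic.PathsHomotopic s a b t c d →
      Set.InjOn t (Set.Icc c d) → ConvexHyperbolic.IsSimple s a b) ∧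
    -- (3) loops at a boundary point
    (∀ p ∈ ConvexHyperbolic.surfaceBoundary X,
      ∀ (s : ℝ → X) (a b : ℝ) (t : ℝ → X) (c d : ℝ), ConvexHyperbolic.IsGeodesicPath s a b →
      s a = p → s b = p → c < d → ConvexHyperbolic.LoopsHomotopicRel p s a b t c d →
      ConvexHyperbolic.IsSimpleLoop t c d p → ConvexHyperbolic.IsSimpleLoop s a b p) :=
  proposition4p1_general hX
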